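/- Let $K$ be a Markov transition kernel on a measurable space $\mathcal X$ and $\Pi$ a probability measure on $\mathcal X$. Suppose that $K$ is reversible with respect to $\Pi$, i.e. $\int_A K(x,B)\,\Pi(dx)=\int_B K(x,A)\,\Pi(dx)$ for all measurable $A,B$, and geometrically ergodic, i.e. there are $\kappa\in[0,1)$ and $Q:\mathcal X\to[0,\infty)$ with $\sup_{A}|K^m(x,A)-\Pi(A)|\le Q(x)\kappa^m$ for all $x\in\mathcal X$ and $m\ge 1$ (supremum over measurable $A$, $K^m$ the $m$-step kernel). Let $(X_i)_{i\ge1}$ be a stationary Markov chain with transition kernel $K$ and $X_1\sim\Pi$; $E_\pi$, $\operatorname{Var}_\pi$ and $\operatorname{Cov}_\pi$ refer to this chain. Let $f:\mathcal X\to\mathbb R$ be measurable with $E_\pi f^8=\int f^8\,d\Pi<\infty$. Let $(a_n)$ and $(b_n)$ be sequences of natural numbers with $a_n\to\infty$ and $b_n\to\infty$ as $n\to\infty$. Put $Y_i=f(X_i)-\int f\,d\Pi$ and $$\bar Y_k=\frac1{b_n}\sum_{i=1}^{b_n}Y_{(k-1)b_n+i}\quad(1\le k\le a_n),\qquad \bar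 Y=\frac1{a_n}\sum_{k=1}^{a_n}\bar Y_k,\qquad \tilde\sigma^2_{BM,f}=\frac{b_n}{a_n}\sum_{k=1}^{a_n}\bar Y_k^2-b_n\bar Y^2 .$$ Then the series in $$\sigma_f^2=\operatorname{Var}_\pi f(X_1)+2\sum_{i=2}^\infty\operatorname{Cov}_\pi\bigl(f(X_1),f(X_i)\bigr)$$ converges absolutely, and, as $n\to\infty$, $$\sqrt{a_n}\,\bigl[\tilde\sigma^2_{BM,f}-E_\pi\tilde\sigma^2_{BM,f}-E_\pi(b_n\bar Y^2)\bigr]\xrightarrow{d}N(0,2\sigma_f^4),$$ and likewise $$\sqrt{a_n}\,\bigl[(\tilde\sigma^2_{BM,f}-\sigma_f^2)-\bigl(E_\pi\tilde\sigma^2_{BM,f}-E_\pi(b_n\bar Y^2)-\sigma_f^2\bigr)\bigr]\xrightarrow{d}N(0,2\sigma_f^4),$$ where $N(0,0)$ denotes the point mass at $0$. -/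

import Mathlib

open MeasureTheory ProbabilityTheory Filter

namespace BatchMeans

noncomputable section

/-- Geometric ergodicity: there are `κ ∈ [0, 1)` and `Q : S → [0, ∞)` such that the total
variation distance `sup_A |K^m(x, A) - Π(A)|` is at most `Q(x) κ^m` for all `x` and `m ≥ 1`.
Here `K ^ m` is the `m`-step transition kernel. -/
def GeometricallyErgodic {S : Type*} [MeasurableSpace S] (K : Kernel S S) (Pi : Measure S) :
    Prop :=
  ∃ (κ : ℝ) (Q : S → ℝ), 0 ≤ κ ∧ κ < 1 ∧ (∀ x, 0 ≤ Q x) ∧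
    ∀ (x : S) (m : ℕ), 1 ≤ m → ∀ A : Set S, MeasurableSet A →
      |((K ^ m) x).real A - Pi.real A| ≤ Q x * κ ^ m

/-- `X 0, X 1, X 2, …` (that is, `X_1, X_2, X_3, …` when counting from one) is a Markov chain
with transition kernel `K` and initial distribution `Pi`, the Markov property being taken with
respect to the natural filtration `σ(X 0, …, X n)`. -/
structure IsMarkovChain {S Ω : Type*} [MeasurableSpace S] [MeasurableSpace Ω]
    (K : Kernel S S) (Pi : Measure S) (P : Measure Ω) (X : ℕ → Ω → S) : Prop where
  measurable : ∀ n, Measurable (X n)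
  initial : P.map (X 0) = Pi
  markov : ∀ (n : ℕ) (A : Set S), MeasurableSet A →
    P[(X (n + 1) ⁻¹' A).indicator (fun _ => (1 : ℝ)) |
        ⨆ j : Fin (n + 1), MeasurableSpace.comap (X j) inferInstance]
      =ᵐ[P] fun ω => (K (X n ω)).real A

section Estimator

variable {S Ω : Type*} [MeasurableSpace S] [MeasurableSpace Ω]

/-- The centred observations `Y_i = f(X_i) - E_π f`. -/
def centred (Pi : Measure S) (f : S → ℝ) (X : ℕ → Ω → S) (i : ℕ) (ω : Ω) : ℝ :=
  f (X i ω) - ∫ x, f x ∂Pi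

/-- The mean of the `k`-th batch (`k = 0, …, a - 1`) of size `b` of the centred observations. -/
def batchMean (Pi : Measure S) (f : S → ℝ) (X : ℕ → Ω → S) (b k : ℕ) (ω : Ω) : ℝ :=
  (∑ i ∈ Finset.range b, centred Pi f X (k * b + i) ω) / b

/-- The overall mean `Ȳ` of the `a` batch means. -/
def overallMean (Pi : Measure S) (f : S → ℝ) (X : ℕ → Ω → S) (a b : ℕ) (ω : Ω) : ℝ :=
  (∑ k ∈ Finset.range a, batchMean Pi f X b k ω) / a

/-- The modified batch means estimator `(b / a) ∑_k Ȳ_k² - b Ȳ²`. -/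
def modifiedBM (Pi : Measure S) (f : S → ℝ) (X : ℕ → Ω → S) (a b : ℕ) (ω : Ω) : ℝ :=
  (b : ℝ) / a * ∑ k ∈ Finset.range a, batchMean Pi f X b k ω ^ 2
    - b * overallMean Pi f X a b ω ^ 2

/-- The autocovariance `Cov(f(X_1), f(X_{1+h}))`. -/
def autocov (P : Measure Ω) (f : S → ℝ) (X : ℕ → Ω → S) (h : ℕ) : ℝ :=
  covariance (fun ω => f (X 0 ω)) (fun ω => f (X h ω)) P

/-- The MCMC variance `σ_f² = Var f(X_1) + 2 ∑_{i ≥ 2} Cov(f(X_1), f(X_i))`. -/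
def mcmcVar (P : Measure Ω) (f : S → ℝ) (X : ℕ → Ω → S) : ℝ :=
  variance (fun ω => f (X 0 ω)) P + 2 * ∑' i : ℕ, autocov P f X (i + 1)

end Estimator

end

end BatchMeans

/-! Write T for the Markov operator `markovOp K` and f₀ = f - ∫ f dΠ. Reversibility makes T
self-adjoint on L²(Π). For the centred indicator u of a set on which Q is bounded, geometric
ergodicity gives ‖T^m u‖ ≤ C κ^m with C depending on u. Self-adjointness makes ‖T^m u‖² log-convex
in m, so the constant drops out already at m = 1, and density extends ‖Tu‖ ≤ κ‖u‖ to all centred u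
(`exists_spectral_gap`). Combined with the Markov property for the whole future, this yields
exponential decay of the maximal correlation between past and future
(`IsMarkovChain.abs_covariance_le`).

Interpolating the L² decay against bounded L⁸ norms gives geometric decay of T^m f₀ in L⁶. So g = ∑
T^m f₀ exists in L⁶ and solves g - Tg = f₀ (`exists_poisson_solution`). Hence f₀(X_i) = d_i + g(X_i)
- g(X_{i+1}), where the d_i = g(X_{i+1}) - (Tg)(X_i) are martingale differences with variance σ_f²
(`IsMarkovChain.mcmcVar_eq`).

A batch sum is therefore a martingale sum plus a boundary term. Its square divided by b splits into
(2/b) ∑_{i<j} d_i d_j and a remainder `batchError` made of the diagonal and the boundary terms. The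
remainder has variance O(1/b) and is nearly uncorrelated across batches, and b Ȳ² has mean O(1/a);
both vanish after scaling by √a, whatever the relative growth of a and b.

The pair sums are martingale differences along the batches. Their second moments tend to 2σ_f⁴
because E(d_j² M_j²) nearly factorises, and their third moments are bounded because E M_b⁶ = O(b³).
Their squares decouple from everything one full batch earlier, so each batch multiplies the
characteristic function by about 1 - t²σ_f⁴/a (`norm_integral_cexp_sub_pow_le`). The product tends
to exp(-t²σ_f⁴).

The two displayed limits differ by the deterministic shift 2√a E(b Ȳ²) = O(a^{-1/2}). -/

namespace BatchMeans

noncomputable section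

/-! ### Square-integrable functions -/

section CauchySchwarz

variable {α : Type*} [MeasurableSpace α] {μ : Measure α}

/-- Cauchy–Schwarz for the integral of a product of two square-integrable functions. -/
theorem sq_integral_mul_le {u v : α → ℝ} (hu : MemLp u 2 μ) (hv : MemLp v 2 μ) :
    (∫ x, u x * v x ∂μ) ^ 2 ≤ (∫ x, u x ^ 2 ∂μ) * ∫ x, v x ^ 2 ∂μ := by
  have huv : Integrable (fun x => u x * v x) μ := hu.integrable_mul hv
  have key : ∀ t : ℝ, 0 ≤ (∫ x, u x ^ 2 ∂μ) * (t * t) + (2 * ∫ x, u x * v x ∂μ) * t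
      + ∫ x, v x ^ 2 ∂μ := by
    intro t
    have h : ∫ x, (t * u x + v x) ^ 2 ∂μ = (∫ x, u x ^ 2 ∂μ) * (t * t)
        + (2 * ∫ x, u x * v x ∂μ) * t + ∫ x, v x ^ 2 ∂μ := by
      have e : (fun x => (t * u x + v x) ^ 2)
          = fun x => (t * t * u x ^ 2 + 2 * t * (u x * v x)) + v x ^ 2 := by
        ext x; ring
      rw [e, integral_add ((hu.integrable_sq.const_mul _).fun_add (huv.const_mul _))
        hv.integrable_sq, integral_add (hu.integrable_sq.const_mul _) (huv.const_mul _),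
        integral_const_mul, integral_const_mul]
      ring
    rw [← h]
    exact integral_nonneg fun x => sq_nonneg _
  have := discrim_le_zero key
  rw [discrim] at this
  nlinarith

theorem abs_integral_mul_le_sqrt {u v : α → ℝ} (hu : MemLp u 2 μ) (hv : MemLp v 2 μ) :
    |∫ x, u x * v x ∂μ| ≤ √(∫ x, u x ^ 2 ∂μ) * √(∫ x, v x ^ 2 ∂μ) := by
  rw [← Real.sqrt_mul (integral_nonneg fun x => sq_nonneg _)]
  exact Real.abs_le_sqrt (sq_integral_mul_le hu hv)

theorem sqrt_integral_sq_eq_eLpNorm {u : α → ℝ} (hu : MemLp u 2 μ) :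
    √(∫ x, u x ^ 2 ∂μ) = (eLpNorm u 2 μ).toReal := by
  rw [hu.eLpNorm_eq_integral_rpow_norm (by simp) (by simp),
    ENNReal.toReal_ofReal (by positivity), Real.sqrt_eq_rpow]
  simp

/-- Minkowski's inequality in `L²`. -/
theorem sqrt_integral_add_sq_le {u v : α → ℝ} (hu : MemLp u 2 μ) (hv : MemLp v 2 μ) :
    √(∫ x, (u x + v x) ^ 2 ∂μ) ≤ √(∫ x, u x ^ 2 ∂μ) + √(∫ x, v x ^ 2 ∂μ) := by
  have := sqrt_integral_sq_eq_eLpNorm (hu.add hv)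
  simp only [Pi.add_apply] at this
  rw [this, sqrt_integral_sq_eq_eLpNorm hu, sqrt_integral_sq_eq_eLpNorm hv,
    ← ENNReal.toReal_add hu.eLpNorm_ne_top hv.eLpNorm_ne_top]
  exact ENNReal.toReal_mono (ENNReal.add_ne_top.2 ⟨hu.eLpNorm_ne_top, hv.eLpNorm_ne_top⟩)
    (eLpNorm_add_le hu.1 hv.1 (by norm_num))

end CauchySchwarz

/-! ### The Markov operator -/

section Operator

variable {S : Type*} [MeasurableSpace S]

/-- The Markov operator `u ↦ ∫ u(y) K(·, dy)`. -/
def markovOp (K : Kernel S S) (u : S → ℝ) (x : S) : ℝ := ∫ y, u y ∂K x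

variable {K : Kernel S S} {Pi : Measure S}

theorem measurable_markovOp {u : S → ℝ} (hu : Measurable u) : Measurable (markovOp K u) :=
  (hu.stronglyMeasurable.integral_kernel (κ := K)).measurable

theorem measurable_markovOp_iterate {u : S → ℝ} (hu : Measurable u) (m : ℕ) :
    Measurable ((markovOp K)^[m] u) := by
  induction m with
  | zero => exact hu
  | succ m ih => rw [Function.iterate_succ_apply']; exact measurable_markovOp ih

theorem lintegral_lintegral_of_invariant (hinv : K.Invariant Pi) {u : S → ENNReal}
    (hu : Measurable u) : ∫⁻ x, ∫⁻ y, u y ∂K x ∂Pi = ∫⁻ x, u x ∂Pi := by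
  conv_rhs => rw [← hinv.def]
  rw [Measure.lintegral_bind K.aemeasurable hu.aemeasurable]

theorem markovOp_const_mul (c : ℝ) (u : S → ℝ) :
    markovOp K (fun x => c * u x) = fun x => c * markovOp K u x := by
  ext x; exact integral_const_mul _ _

/-- By invariance a Π-null set is `K x`-null for Π-almost every x, so T acts on almost-everywhere
classes. Additivity of T and of its iterates holds only almost everywhere, since an integrable
function need not be integrable under every `K x`. -/
theorem ae_markovOp_congr (hinv : K.Invariant Pi) {u v : S → ℝ} (h : u =ᵐ[Pi] v) :
    markovOp K u =ᵐ[Pi] markovOp K v := by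
  have h' : ∀ᵐ x ∂Pi, ∀ᵐ y ∂K x, u y = v y := by
    have : ∀ᵐ y ∂(Pi.bind K), u y = v y := by rw [hinv.def]; exact h
    exact Measure.ae_ae_of_ae_bind K.aemeasurable this
  filter_upwards [h'] with x hx
  exact integral_congr_ae hx

variable [IsMarkovKernel K]

/-- The Markov operator is a contraction of `L^p` of an invariant measure. -/
theorem eLpNorm_markovOp_le (hinv : K.Invariant Pi) {u : S → ℝ} (hu : Measurable u)
    {p : ENNReal} (hp : 1 ≤ p) (hp' : p ≠ ⊤) :
    eLpNorm (markovOp K u) p Pi ≤ eLpNorm u p Pi := by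
  have hp0 : p ≠ 0 := (zero_lt_one.trans_le hp).ne'
  have hpr : 0 < p.toReal := ENNReal.toReal_pos hp0 hp'
  rw [eLpNorm_eq_lintegral_rpow_enorm_toReal hp0 hp',
    eLpNorm_eq_lintegral_rpow_enorm_toReal hp0 hp']
  gcongr ?_ ^ _
  rw [← lintegral_lintegral_of_invariant hinv (u := fun y => ‖u y‖ₑ ^ p.toReal) (by fun_prop)]
  refine lintegral_mono fun x => ?_
  -- Jensen at each point: `K x` is a probability measure, so its L¹ norm is at most its L^p norm.
  -- Invariance then removes the inner kernel.
  have h1 : ‖markovOp K u x‖ₑ ≤ eLpNorm u p (K x) := by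
    refine (enorm_integral_le_lintegral_enorm _).trans ?_
    rw [← eLpNorm_one_eq_lintegral_enorm]
    exact eLpNorm_le_eLpNorm_of_exponent_le hp hu.aestronglyMeasurable
  refine (ENNReal.rpow_le_rpow h1 hpr.le).trans ?_
  rw [eLpNorm_eq_lintegral_rpow_enorm_toReal hp0 hp', ← ENNReal.rpow_mul, one_div,
    inv_mul_cancel₀ hpr.ne', ENNReal.rpow_one]

theorem memLp_markovOp (hinv : K.Invariant Pi) {u : S → ℝ} (hu : Measurable u)
    {p : ENNReal} (hp : 1 ≤ p) (hp' : p ≠ ⊤) (h : MemLp u p Pi) : MemLp (markovOp K u) p Pi :=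
  ⟨(measurable_markovOp hu).aestronglyMeasurable,
    (eLpNorm_markovOp_le hinv hu hp hp').trans_lt h.2⟩

theorem eLpNorm_markovOp_iterate_le (hinv : K.Invariant Pi) {u : S → ℝ} (hu : Measurable u)
    {p : ENNReal} (hp : 1 ≤ p) (hp' : p ≠ ⊤) (m : ℕ) :
    eLpNorm ((markovOp K)^[m] u) p Pi ≤ eLpNorm u p Pi := by
  induction m with
  | zero => exact le_rfl
  | succ m ih =>
    rw [Function.iterate_succ_apply']
    exact (eLpNorm_markovOp_le hinv (measurable_markovOp_iterate hu m) hp hp').trans ih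

theorem memLp_markovOp_iterate (hinv : K.Invariant Pi) {u : S → ℝ} (hu : Measurable u)
    {p : ENNReal} (hp : 1 ≤ p) (hp' : p ≠ ⊤) (h : MemLp u p Pi) (m : ℕ) :
    MemLp ((markovOp K)^[m] u) p Pi :=
  ⟨(measurable_markovOp_iterate hu m).aestronglyMeasurable,
    (eLpNorm_markovOp_iterate_le hinv hu hp hp' m).trans_lt h.2⟩

variable [IsProbabilityMeasure Pi]

theorem measurePreserving_snd_compProd (hinv : K.Invariant Pi) :
    MeasurePreserving Prod.snd (Pi ⊗ₘ K) Pi :=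
  ⟨measurable_snd, by
    change (Pi ⊗ₘ K).snd = Pi
    rw [Measure.snd_compProd]; exact hinv.def⟩

theorem measurePreserving_fst_compProd : MeasurePreserving Prod.fst (Pi ⊗ₘ K) Pi :=
  ⟨measurable_fst, by
    change (Pi ⊗ₘ K).fst = Pi
    rw [Measure.fst_compProd]⟩

theorem ae_integrable_kernel (hinv : K.Invariant Pi) {u : S → ℝ}
    (h : Integrable u Pi) : ∀ᵐ x ∂Pi, Integrable u (K x) := by
  have h1 : Integrable (fun z : S × S => u z.2) (Pi ⊗ₘ K) :=
    (measurePreserving_snd_compProd hinv).integrable_comp_of_integrable h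
  exact ((Measure.integrable_compProd_iff h1.aestronglyMeasurable).1 h1).1

theorem integral_markovOp (hinv : K.Invariant Pi) {u : S → ℝ} (hu : Measurable u)
    (h : Integrable u Pi) : ∫ x, markovOp K u x ∂Pi = ∫ x, u x ∂Pi := by
  have h1 : Integrable (fun z : S × S => u z.2) (Pi ⊗ₘ K) :=
    (measurePreserving_snd_compProd hinv).integrable_comp_of_integrable h
  have h2 := Measure.integral_compProd h1
  have h3 : ∫ z : S × S, u z.2 ∂(Pi ⊗ₘ K) = ∫ x, u x ∂Pi := by
    conv_rhs => rw [← (measurePreserving_snd_compProd hinv (K := K)).map_eq]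
    rw [integral_map measurable_snd.aemeasurable hu.aestronglyMeasurable]
  rw [← h3, h2]
  rfl

theorem integral_markovOp_iterate (hinv : K.Invariant Pi) {u : S → ℝ} (hu : Measurable u)
    (h : Integrable u Pi) (m : ℕ) : ∫ x, (markovOp K)^[m] u x ∂Pi = ∫ x, u x ∂Pi := by
  induction m with
  | zero => rfl
  | succ m ih =>
    rw [Function.iterate_succ_apply', integral_markovOp hinv (measurable_markovOp_iterate hu m), ih]
    exact memLp_one_iff_integrable.1
      (memLp_markovOp_iterate hinv hu le_rfl (by simp) (memLp_one_iff_integrable.2 h) m)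

theorem markovOp_add_ae (hinv : K.Invariant Pi) {u v : S → ℝ}
    (hu : Integrable u Pi) (hv : Integrable v Pi) :
    markovOp K (fun x => u x + v x) =ᵐ[Pi] fun x => markovOp K u x + markovOp K v x := by
  filter_upwards [ae_integrable_kernel hinv hu, ae_integrable_kernel hinv hv] with x h1 h2
  exact integral_add h1 h2

theorem markovOp_sub_ae (hinv : K.Invariant Pi) {u v : S → ℝ}
    (hu : Integrable u Pi) (hv : Integrable v Pi) :
    markovOp K (fun x => u x - v x) =ᵐ[Pi] fun x => markovOp K u x - markovOp K v x := by
  filter_upwards [ae_integrable_kernel hinv hu, ae_integrable_kernel hinv hv] with x h1 h2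
  exact integral_sub h1 h2

/-- Reversibility is the symmetry of Π ⊗ K on rectangles, and rectangles determine a finite measure.
Symmetry of the joint law of two consecutive states is what makes T self-adjoint. -/
theorem map_swap_compProd (hrev : K.IsReversible Pi) :
    (Pi ⊗ₘ K).map Prod.swap = Pi ⊗ₘ K := by
  refine Measure.ext_prod fun {s t} hs ht => ?_
  rw [Measure.map_apply measurable_swap (hs.prod ht), Set.preimage_swap_prod,
    Measure.compProd_apply_prod ht hs, Measure.compProd_apply_prod hs ht]
  exact hrev ht hs

/-- The Markov operator of a reversible kernel is symmetric on `L²`. -/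
theorem integral_mul_markovOp_comm (hrev : K.IsReversible Pi) {u v : S → ℝ}
    (hu : Measurable u) (hv : Measurable v) (hu2 : MemLp u 2 Pi) (hv2 : MemLp v 2 Pi) :
    ∫ x, u x * markovOp K v x ∂Pi = ∫ x, markovOp K u x * v x ∂Pi := by
  have hinv := hrev.invariant
  have key : ∀ {u v : S → ℝ}, Measurable u → Measurable v → MemLp u 2 Pi → MemLp v 2 Pi →
      ∫ x, u x * markovOp K v x ∂Pi = ∫ z : S × S, u z.1 * v z.2 ∂(Pi ⊗ₘ K) := by
    intro u v hu hv hu2 hv2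
    have h1 : MemLp (fun z : S × S => u z.1) 2 (Pi ⊗ₘ K) :=
      hu2.comp_measurePreserving measurePreserving_fst_compProd
    have h2 : MemLp (fun z : S × S => v z.2) 2 (Pi ⊗ₘ K) :=
      hv2.comp_measurePreserving (measurePreserving_snd_compProd hinv)
    have h12 : Integrable (fun z : S × S => u z.1 * v z.2) (Pi ⊗ₘ K) := h1.integrable_mul h2
    rw [Measure.integral_compProd h12]
    refine integral_congr_ae (Eventually.of_forall fun x => ?_)
    exact (integral_const_mul _ _).symm
  rw [key hu hv hu2 hv2]
  simp_rw [mul_comm (markovOp K u _)]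
  rw [key hv hu hv2 hu2]
  conv_rhs => rw [← map_swap_compProd hrev]
  rw [integral_map measurable_swap.aemeasurable (by fun_prop)]
  simp [mul_comm]

end Operator
/-! ### The spectral gap of a reversible geometrically ergodic kernel -/

/-- For a log-convex nonnegative sequence the first ratio is at most its exponential growth rate. -/
theorem le_mul_of_sq_le_mul {x : ℕ → ℝ} (h0 : ∀ m, 0 ≤ x m)
    (hx : ∀ m, x (m + 1) ^ 2 ≤ x m * x (m + 2)) {C r : ℝ} (hr : 0 ≤ r)
    (hC : ∀ m, 1 ≤ m → x m ≤ C * r ^ m) : x 1 ≤ r * x 0 := by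
  rcases (h0 0).eq_or_lt with h | hpos
  · have := hx 0
    rw [← h, zero_mul] at this
    have h1 : x 1 = 0 := pow_eq_zero_iff (two_ne_zero) |>.1 (le_antisymm this (sq_nonneg _))
    rw [h1, ← h, mul_zero]
  by_contra! hcon
  -- If the first ratio q exceeded r, log-convexity would keep all later ratios at least q, and q^m
  -- x₀ would outgrow C r^m.
  set q := x 1 / x 0 with hq
  have hrq : r < q := by rwa [hq, lt_div_iff₀ hpos]
  have hq0 : 0 < q := hr.trans_lt hrq
  have step : ∀ m, 0 < x m ∧ q * x m ≤ x (m + 1) := by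
    intro m
    induction m with
    | zero => exact ⟨hpos, by rw [hq, div_mul_cancel₀ _ hpos.ne']⟩
    | succ m ih =>
      obtain ⟨hm, hm'⟩ := ih
      have hm1 : 0 < x (m + 1) := (mul_pos hq0 hm).trans_le hm'
      refine ⟨hm1, ?_⟩
      have h2 := hx m
      have : q * x m * x (m + 1) ≤ x m * x (m + 2) := by nlinarith
      have : x m * (q * x (m + 1)) ≤ x m * x (m + 2) := by linarith
      exact le_of_mul_le_mul_left this hm
  have geom : ∀ m, q ^ m * x 0 ≤ x m := by
    intro m
    induction m with
    | zero => simp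
    | succ m ih =>
      calc q ^ (m + 1) * x 0 = q * (q ^ m * x 0) := by ring
        _ ≤ q * x m := by gcongr
        _ ≤ x (m + 1) := (step m).2
  have hlim : Tendsto (fun m : ℕ => C * (r / q) ^ m) atTop (nhds (C * 0)) :=
    (tendsto_pow_atTop_nhds_zero_of_lt_one (by positivity) (by rwa [div_lt_one hq0])).const_mul C
  have : x 0 ≤ C * 0 := by
    refine ge_of_tendsto hlim ((eventually_ge_atTop 1).mono fun m hm => ?_)
    rw [div_pow, ← mul_div_assoc, le_div_iff₀ (by positivity), mul_comm]
    exact (geom m).trans (hC m hm)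
  linarith

section Gap

variable {S : Type*} [MeasurableSpace S] {K : Kernel S S} {Pi : Measure S}

theorem markovOp_iterate_const_mul (c : ℝ) (u : S → ℝ) (m : ℕ) :
    (markovOp K)^[m] (fun x => c * u x) = fun x => c * (markovOp K)^[m] u x := by
  induction m with
  | zero => rfl
  | succ m ih => rw [Function.iterate_succ_apply', ih, markovOp_const_mul,
      Function.iterate_succ_apply']

/-- Q is not assumed measurable, so its level sets are replaced by measurable hulls. The set where
the bound fails is measurable and misses the level set, hence meets the hull in a null set. -/
theorem ae_abs_sub_le_of_toMeasurable {κ : ℝ} {Q : S → ℝ}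
    [IsProbabilityMeasure Pi] (h : ∀ (x : S) (m : ℕ), 1 ≤ m → ∀ A : Set S, MeasurableSet A →
      |((K ^ m) x).real A - Pi.real A| ≤ Q x * κ ^ m) (hκ : 0 ≤ κ) (j : ℕ) {m : ℕ} (hm : 1 ≤ m)
    {E : Set S} (hE : MeasurableSet E) :
    ∀ᵐ x ∂Pi, x ∈ toMeasurable Pi {x | Q x ≤ j} →
      |((K ^ m) x).real E - Pi.real E| ≤ j * κ ^ m := by
  set B := {x | |((K ^ m) x).real E - Pi.real E| ≤ j * κ ^ m}
  have hB : MeasurableSet B := by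
    have : Measurable fun x => ((K ^ m) x).real E := ((K ^ m).measurable_coe hE).ennreal_toReal
    exact measurableSet_le (by fun_prop) measurable_const
  have hsub : {x | Q x ≤ j} ∩ Bᶜ = ∅ := by
    ext x
    simp only [Set.mem_inter_iff, Set.mem_compl_iff, Set.mem_empty_iff_false, iff_false, not_and,
      not_not]
    intro hx
    exact (h x m hm E hE).trans (mul_le_mul_of_nonneg_right hx (pow_nonneg hκ m))
  have h0 : Pi (toMeasurable Pi {x | Q x ≤ j} ∩ Bᶜ) = 0 := by
    rw [Measure.measure_toMeasurable_inter hB.compl (measure_ne_top _ _), hsub, measure_empty]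
  rw [ae_iff]
  convert h0 using 2
  ext x
  simp [B]

variable [IsMarkovKernel K]

theorem markovOp_iterate_const (c : ℝ) (m : ℕ) :
    (markovOp K)^[m] (fun _ => c) = fun _ => c := by
  induction m with
  | zero => rfl
  | succ m ih => rw [Function.iterate_succ_apply', ih]; ext x; simp [markovOp]

theorem isMarkovKernel_pow (m : ℕ) : IsMarkovKernel (K ^ m) := by
  induction m with
  | zero => exact inferInstanceAs (IsMarkovKernel Kernel.id)
  | succ m ih => rw [Kernel.pow_add, pow_one]; infer_instance

/-- Link between the iterates of T and the m-step kernel of the ergodicity hypothesis. -/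
theorem markovOp_iterate_indicator {E : Set S} (hE : MeasurableSet E) (m : ℕ) (x : S) :
    (markovOp K)^[m] (E.indicator fun _ => 1) x = ((K ^ m) x).real E := by
  induction m generalizing x with
  | zero =>
    have h1 : (K ^ 0) x = Measure.dirac x := Kernel.id_apply x
    rw [Function.iterate_zero, id, measureReal_def, h1]
    by_cases hx : x ∈ E <;> simp [hE, hx]
  | succ m ih =>
    rw [Function.iterate_succ_apply', markovOp]
    simp_rw [ih]
    rw [measureReal_def, Kernel.pow_add, pow_one, Kernel.comp_apply' _ _ _ hE]
    rw [← integral_toReal]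
    · rfl
    · exact ((K ^ m).measurable_coe hE).aemeasurable
    · have := isMarkovKernel_pow (K := K) m
      exact Eventually.of_forall fun y => measure_lt_top _ _

theorem integrable_markovOp_iterate (hinv : K.Invariant Pi) {u : S → ℝ} (hu : Measurable u)
    (h : Integrable u Pi) (m : ℕ) : Integrable ((markovOp K)^[m] u) Pi :=
  memLp_one_iff_integrable.1
    (memLp_markovOp_iterate hinv hu le_rfl (by simp) (memLp_one_iff_integrable.2 h) m)

variable [IsProbabilityMeasure Pi]

theorem markovOp_iterate_add_ae (hinv : K.Invariant Pi) {u v : S → ℝ} (hum : Measurable u)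
    (hvm : Measurable v) (hu : Integrable u Pi) (hv : Integrable v Pi) (m : ℕ) :
    (markovOp K)^[m] (fun x => u x + v x)
      =ᵐ[Pi] fun x => (markovOp K)^[m] u x + (markovOp K)^[m] v x := by
  induction m with
  | zero => rfl
  | succ m ih =>
    rw [Function.iterate_succ_apply', Function.iterate_succ_apply', Function.iterate_succ_apply']
    exact (ae_markovOp_congr hinv ih).trans
      (markovOp_add_ae hinv (integrable_markovOp_iterate hinv hum hu m)
        (integrable_markovOp_iterate hinv hvm hv m))

theorem markovOp_iterate_sub_const_ae (hinv : K.Invariant Pi) {u : S → ℝ} (hum : Measurable u)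
    (hu : Integrable u Pi) (c : ℝ) (m : ℕ) :
    (markovOp K)^[m] (fun x => u x - c) =ᵐ[Pi] fun x => (markovOp K)^[m] u x - c := by
  have := markovOp_iterate_add_ae hinv hum measurable_const hu (integrable_const (-c)) m
  simpa only [markovOp_iterate_const, ← sub_eq_add_neg] using this

theorem integral_mul_markovOp_iterate_comm (hrev : K.IsReversible Pi) {u v : S → ℝ}
    (hu : Measurable u) (hv : Measurable v) (hu2 : MemLp u 2 Pi) (hv2 : MemLp v 2 Pi) (m : ℕ) :
    ∫ x, u x * (markovOp K)^[m] v x ∂Pi = ∫ x, (markovOp K)^[m] u x * v x ∂Pi := by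
  induction m generalizing u with
  | zero => rfl
  | succ m ih =>
    have hinv := hrev.invariant
    rw [Function.iterate_succ_apply', integral_mul_markovOp_comm hrev hu
      (measurable_markovOp_iterate hv m) hu2
      (memLp_markovOp_iterate hinv hv (by norm_num) (by simp) hv2 m),
      ih (measurable_markovOp hu) (memLp_markovOp hinv hu (by norm_num) (by simp) hu2),
      Function.iterate_succ_apply]

/-- If the iterates of a function decay at rate `r` in `L²`, then a single step of a reversible
kernel already contracts its square norm by `r`. -/
theorem integral_markovOp_sq_le_of_decay (hrev : K.IsReversible Pi) {u : S → ℝ}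
    (hu : Measurable u) (hu2 : MemLp u 2 Pi) {C r : ℝ} (hr : 0 ≤ r)
    (hC : ∀ m, 1 ≤ m → ∫ x, (markovOp K)^[m] u x ^ 2 ∂Pi ≤ C * r ^ m) :
    ∫ x, markovOp K u x ^ 2 ∂Pi ≤ r * ∫ x, u x ^ 2 ∂Pi := by
  have hinv := hrev.invariant
  have hm := measurable_markovOp_iterate (K := K) hu
  have hL := memLp_markovOp_iterate hinv hu (p := 2) (by norm_num) (by simp) hu2
  -- Log-convexity: ‖T^{m+1}u‖² = ⟨T^m u, T^{m+2}u⟩ by symmetry, then Cauchy–Schwarz.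
  refine le_mul_of_sq_le_mul (x := fun m => ∫ x, (markovOp K)^[m] u x ^ 2 ∂Pi)
    (fun m => integral_nonneg fun x => sq_nonneg _) (fun m => ?_) hr hC
  refine le_trans (le_of_eq ?_) (sq_integral_mul_le (hL m) (hL (m + 2)))
  congr 1
  rw [Function.iterate_succ_apply' _ (m + 1),
    integral_mul_markovOp_comm hrev (hm m) (hm (m + 1)) (hL m) (hL (m + 1))]
  simp only [sq, ← Function.iterate_succ_apply' (markovOp K) m u]

/-- `L²` decay of the iterates of a function, at rate `r`, after centring. -/
def HasCentredDecay (K : Kernel S S) (Pi : Measure S) (r : ℝ) (u : S → ℝ) : Prop :=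
  Measurable u ∧ MemLp u 2 Pi ∧ ∃ C, ∀ m, 1 ≤ m →
    ∫ x, (markovOp K)^[m] (fun y => u y - ∫ z, u z ∂Pi) x ^ 2 ∂Pi ≤ C * r ^ m

/-- The constant C may depend on the function, so the class is closed under sums, as the density
argument `MemLp.induction_dense` requires. -/
theorem HasCentredDecay.add (hinv : K.Invariant Pi) {r : ℝ} {u v : S → ℝ}
    (hu : HasCentredDecay K Pi r u) (hv : HasCentredDecay K Pi r v) :
    HasCentredDecay K Pi r (u + v) := by
  obtain ⟨hum, hu2, C, hC⟩ := hu
  obtain ⟨hvm, hv2, D, hD⟩ := hv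
  refine ⟨hum.add hvm, hu2.add hv2, 2 * C + 2 * D, fun m hm => ?_⟩
  have hui : Integrable u Pi := hu2.integrable (by norm_num)
  have hvi : Integrable v Pi := hv2.integrable (by norm_num)
  have e : (fun y => (u + v) y - ∫ z, (u + v) z ∂Pi)
      = fun y => (u y - ∫ z, u z ∂Pi) + (v y - ∫ z, v z ∂Pi) := by
    ext y
    simp only [_root_.Pi.add_apply]
    rw [integral_add hui hvi]; ring
  rw [e]
  have hu0 : MemLp (fun y => u y - ∫ z, u z ∂Pi) 2 Pi := hu2.sub (memLp_const _)
  have hv0 : MemLp (fun y => v y - ∫ z, v z ∂Pi) 2 Pi := hv2.sub (memLp_const _)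
  have hadd := markovOp_iterate_add_ae hinv (u := fun y => u y - ∫ z, u z ∂Pi)
    (v := fun y => v y - ∫ z, v z ∂Pi) (by fun_prop) (by fun_prop)
    (hu0.integrable (by norm_num)) (hv0.integrable (by norm_num)) m
  have i1 := (memLp_markovOp_iterate hinv (by fun_prop) (by norm_num) (by simp) hu0 m).integrable_sq
  have i2 := (memLp_markovOp_iterate hinv (by fun_prop) (by norm_num) (by simp) hv0 m).integrable_sq
  calc _ ≤ ∫ x, (2 * (markovOp K)^[m] (fun y => u y - ∫ z, u z ∂Pi) x ^ 2
        + 2 * (markovOp K)^[m] (fun y => v y - ∫ z, v z ∂Pi) x ^ 2) ∂Pi := by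
        refine integral_mono_of_nonneg (Eventually.of_forall fun x => sq_nonneg _)
          ((i1.const_mul 2).fun_add (i2.const_mul 2)) ?_
        filter_upwards [hadd] with x hx
        simp only [hx]
        nlinarith [sq_nonneg ((markovOp K)^[m] (fun y => u y - ∫ z, u z ∂Pi) x
          - (markovOp K)^[m] (fun y => v y - ∫ z, v z ∂Pi) x)]
    _ ≤ _ := by
        rw [integral_add (i1.const_mul 2) (i2.const_mul 2), integral_const_mul,
          integral_const_mul]
        have := hC m hm
        have := hD m hm
        nlinarith

/-- With u₀ = 1_E - Π(E), symmetry gives ‖T^m u₀‖² = ⟨u₀, T^{2m}u₀⟩. The constant Π(E) drops out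
because T^{2m}u₀ has mean zero, leaving the integral over E of K^{2m}(x,E) - Π(E). There Q is at
most j up to a null set, so the integral is at most j κ^{2m}. -/
theorem hasCentredDecay_indicator (hrev : K.IsReversible Pi) {κ : ℝ} {Q : S → ℝ}
    (h : ∀ (x : S) (m : ℕ), 1 ≤ m → ∀ A : Set S, MeasurableSet A →
      |((K ^ m) x).real A - Pi.real A| ≤ Q x * κ ^ m) (hκ : 0 ≤ κ) (j : ℕ)
    {E : Set S} (hE : MeasurableSet E) (hEj : E ⊆ toMeasurable Pi {x | Q x ≤ j}) (c : ℝ) :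
    HasCentredDecay K Pi (κ ^ 2) (E.indicator fun _ => c) := by
  have hinv := hrev.invariant
  set u : S → ℝ := E.indicator fun _ => 1 with hu
  have hum : Measurable u := measurable_const.indicator hE
  have hu2 : MemLp u 2 Pi := memLp_indicator_const _ hE _ (by simp)
  have huc : (E.indicator fun _ => c) = fun x => c * u x := by
    ext x; by_cases hx : x ∈ E <;> simp [hu, hx]
  have hInt : ∫ z, u z ∂Pi = Pi.real E := by
    rw [hu, integral_indicator_const _ hE]; simp
  set u0 : S → ℝ := fun x => u x - Pi.real E with hu0
  have hu0m : Measurable u0 := by fun_prop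
  have hu02 : MemLp u0 2 Pi := hu2.sub (memLp_const _)
  rw [huc]
  refine ⟨by fun_prop, hu2.const_mul c, c ^ 2 * j, fun m hm => ?_⟩
  have e : (fun y => c * u y - ∫ z, c * u z ∂Pi) = fun y => c * u0 y := by
    ext y; rw [integral_const_mul, hInt]; simp only [hu0]; ring
  rw [e, markovOp_iterate_const_mul]
  simp only [mul_pow]
  rw [integral_const_mul, mul_assoc]
  refine mul_le_mul_of_nonneg_left ?_ (sq_nonneg c)
  have hL := memLp_markovOp_iterate hinv hu0m (p := 2) (by norm_num) (by simp) hu02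
  have e1 : ∫ x, (markovOp K)^[m] u0 x ^ 2 ∂Pi = ∫ x, u0 x * (markovOp K)^[2 * m] u0 x ∂Pi := by
    rw [two_mul, Function.iterate_add_apply, integral_mul_markovOp_iterate_comm hrev hu0m
      (measurable_markovOp_iterate hu0m m) hu02 (hL m)]
    simp only [sq]
  have e2 : ∫ x, u0 x * (markovOp K)^[2 * m] u0 x ∂Pi
      = ∫ x, u x * (markovOp K)^[2 * m] u0 x ∂Pi := by
    have i1 : Integrable (fun x => u x * (markovOp K)^[2 * m] u0 x) Pi :=
      hu2.integrable_mul (hL _)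
    have i2 : Integrable (fun x => Pi.real E * (markovOp K)^[2 * m] u0 x) Pi :=
      ((hL _).integrable (by norm_num)).const_mul _
    have e3 : ∀ x, u0 x * (markovOp K)^[2 * m] u0 x
        = u x * (markovOp K)^[2 * m] u0 x - Pi.real E * (markovOp K)^[2 * m] u0 x :=
      fun x => sub_mul _ _ _
    simp_rw [e3]
    rw [integral_sub i1 i2, integral_const_mul, integral_markovOp_iterate hinv hu0m
      (hu02.integrable (by norm_num)), integral_sub (hu2.integrable (by norm_num))
      (integrable_const _), hInt]
    simp
  rw [e1, e2]
  have h3 : ∀ᵐ x ∂Pi, u x * (markovOp K)^[2 * m] u0 x ≤ j * (κ ^ 2) ^ m := by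
    filter_upwards [markovOp_iterate_sub_const_ae hinv hum (hu2.integrable (by norm_num))
      (Pi.real E) (2 * m), ae_abs_sub_le_of_toMeasurable h hκ j (m := 2 * m) (by omega) hE]
      with x hx1 hx2
    rw [hx1]
    by_cases hx : x ∈ E
    · have := hx2 (hEj hx)
      rw [markovOp_iterate_indicator hE, ← pow_mul]
      simp only [hu, Set.indicator_of_mem hx, one_mul]
      exact (le_abs_self _).trans this
    · simp only [hu, Set.indicator_of_notMem hx, zero_mul]
      positivity
  calc _ ≤ ∫ _, (j * (κ ^ 2) ^ m : ℝ) ∂Pi :=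
        integral_mono_ae (hu2.integrable_mul (hL _)) (integrable_const _) h3
    _ = _ := by simp

/-- Simple functions are dense in L², and since Q is finite everywhere its level sets exhaust the
space. Cutting a set down to a high enough level set therefore changes its indicator little in L².
-/
theorem exists_hasCentredDecay_near (hrev : K.IsReversible Pi) {κ : ℝ} {Q : S → ℝ}
    (h : ∀ (x : S) (m : ℕ), 1 ≤ m → ∀ A : Set S, MeasurableSet A →
      |((K ^ m) x).real A - Pi.real A| ≤ Q x * κ ^ m) (hκ : 0 ≤ κ) {u : S → ℝ}
    (hu : MemLp u 2 Pi) {ε : ENNReal} (hε : ε ≠ 0) :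
    ∃ w, eLpNorm (u - w) 2 Pi ≤ ε ∧ HasCentredDecay K Pi (κ ^ 2) w := by
  refine MemLp.induction_dense (by simp) (HasCentredDecay K Pi (κ ^ 2)) ?_
    (fun u v hu hv => hu.add hrev.invariant hv) (fun u hu => hu.2.1.1) hu hε
  intro c s hs _ ε hε
  set A : ℕ → Set S := fun j => toMeasurable Pi {x | Q x ≤ j} with hA
  have hlim : Tendsto (fun j => Pi (s \ A j)) atTop (nhds 0) := by
    have h1 : Tendsto (fun j : ℕ => Pi {x | Q x ≤ j}) atTop (nhds (Pi Set.univ)) := by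
      have hmono : Monotone fun j : ℕ => {x | Q x ≤ j} := fun i j hij x (hx : Q x ≤ i) =>
        hx.trans (by exact_mod_cast hij)
      have := tendsto_measure_iUnion_atTop (μ := Pi) hmono
      have hU : (⋃ j : ℕ, {x | Q x ≤ j}) = Set.univ := by
        ext x; simpa using exists_nat_ge (Q x)
      rwa [hU] at this
    have h2 : ∀ j, Pi (s \ A j) ≤ 1 - Pi {x | Q x ≤ j} := by
      intro j
      rw [← measure_toMeasurable {x | Q x ≤ j}, ← prob_compl_eq_one_sub (measurableSet_toMeasurable _ _)]
      exact measure_mono fun x hx => hx.2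
    have h3 : Tendsto (fun j : ℕ => 1 - Pi {x | Q x ≤ j}) atTop (nhds 0) := by
      have := ENNReal.Tendsto.sub (tendsto_const_nhds (x := (1 : ENNReal))) h1 (by simp)
      simpa using this
    exact tendsto_of_tendsto_of_tendsto_of_le_of_le tendsto_const_nhds h3
      (fun _ => zero_le) h2
  have hlim2 : Tendsto (fun j => eLpNorm ((s \ A j).indicator fun _ => c) 2 Pi) atTop (nhds 0) := by
    have e : ∀ j, eLpNorm ((s \ A j).indicator fun _ => c) 2 Pi
        = ‖c‖ₑ * Pi (s \ A j) ^ (1 / (2 : ENNReal).toReal) := fun j =>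
      eLpNorm_indicator_const (hs.diff (measurableSet_toMeasurable _ _)) (by simp) (by simp)
    simp_rw [e]
    have := ENNReal.Tendsto.const_mul (a := ‖c‖ₑ)
      (hlim.ennrpow_const (1 / (2 : ENNReal).toReal)) (Or.inr (by simp))
    simpa using this
  obtain ⟨j, hj⟩ := ((tendsto_order.1 hlim2).2 ε (pos_iff_ne_zero.2 hε)).exists
  refine ⟨(s ∩ A j).indicator fun _ => c, ?_, hasCentredDecay_indicator hrev h hκ j
    (hs.inter (measurableSet_toMeasurable _ _)) Set.inter_subset_right c⟩
  have : ((s ∩ A j).indicator fun _ => c) - s.indicator (fun _ => c)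
      = -((s \ A j).indicator fun _ => c) := by
    ext x
    by_cases h1 : x ∈ s <;> by_cases h2 : x ∈ A j <;> simp [h1, h2]
  rw [this, eLpNorm_neg]
  exact hj.le

theorem integral_sub_integral_sq_le {u : S → ℝ} (hu : MemLp u 2 Pi) :
    ∫ x, (u x - ∫ z, u z ∂Pi) ^ 2 ∂Pi ≤ ∫ x, u x ^ 2 ∂Pi := by
  have := variance_le_expectation_sq (μ := Pi) hu.1
  rwa [variance_eq_integral hu.1.aemeasurable] at this

/-- The Markov operator contracts centred functions in `L²` by the factor `κ`. -/
def SpectralGap (K : Kernel S S) (Pi : Measure S) (κ : ℝ) : Prop :=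
  ∀ u : S → ℝ, Measurable u → MemLp u 2 Pi → ∫ x, u x ∂Pi = 0 →
    √(∫ x, markovOp K u x ^ 2 ∂Pi) ≤ κ * √(∫ x, u x ^ 2 ∂Pi)

/-- A reversible, geometrically ergodic kernel has an `L²` spectral gap. -/
theorem exists_spectral_gap (hrev : K.IsReversible Pi) (hgeo : GeometricallyErgodic K Pi) :
    ∃ κ : ℝ, 0 < κ ∧ κ < 1 ∧ SpectralGap K Pi κ := by
  obtain ⟨κ, Q, hκ, hκ1, -, h⟩ := hgeo
  have hinv := hrev.invariant
  -- The maximum makes the rate strictly positive; negative powers of √κ are needed later.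
  refine ⟨max κ (1 / 2), by positivity, max_lt hκ1 (by norm_num), fun u hu hu2 hmean => ?_⟩
  refine le_trans ?_ (mul_le_mul_of_nonneg_right (le_max_left κ _) (Real.sqrt_nonneg _))
  refine le_of_forall_pos_le_add fun ε hε => ?_
  -- The decay constant of w does not enter its one-step contraction factor κ. That factor is thus
  -- common to a dense class and survives the limit: the error v = u - w₀ costs ε/2 through ‖Tv‖ ≤
  -- ‖v‖ and at most ε/2 through κ‖w₀‖.
  obtain ⟨w, hw, hwm, hw2, C, hC⟩ := exists_hasCentredDecay_near hrev h hκ hu2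
    (ε := ENNReal.ofReal (ε / 2)) (by simpa using hε)
  set w0 : S → ℝ := fun y => w y - ∫ z, w z ∂Pi with hw0
  have hw0m : Measurable w0 := by fun_prop
  have hw02 : MemLp w0 2 Pi := hw2.sub (memLp_const _)
  have hgap : √(∫ x, markovOp K w0 x ^ 2 ∂Pi) ≤ κ * √(∫ x, w0 x ^ 2 ∂Pi) := by
    have := Real.sqrt_le_sqrt
      (integral_markovOp_sq_le_of_decay hrev hw0m hw02 (sq_nonneg κ) hC)
    rwa [Real.sqrt_mul (sq_nonneg κ), Real.sqrt_sq hκ] at this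
  set v : S → ℝ := fun x => u x - w0 x with hv
  have hvm : Measurable v := by fun_prop
  have hv2 : MemLp v 2 Pi := hu2.sub hw02
  have hvsmall : √(∫ x, v x ^ 2 ∂Pi) ≤ ε / 2 := by
    have hd : MemLp (fun x => u x - w x) 2 Pi := hu2.sub hw2
    have hvd : ∀ x, v x = (u x - w x) - ∫ z, (u z - w z) ∂Pi := by
      intro x
      rw [integral_sub (hu2.integrable (by norm_num)) (hw2.integrable (by norm_num)), hmean]
      simp only [hv, hw0]; ring
    simp_rw [hvd]
    refine (Real.sqrt_le_sqrt (integral_sub_integral_sq_le hd)).trans ?_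
    rw [sqrt_integral_sq_eq_eLpNorm hd]
    exact ENNReal.toReal_le_of_le_ofReal (by positivity) hw
  have hTv : √(∫ x, markovOp K v x ^ 2 ∂Pi) ≤ √(∫ x, v x ^ 2 ∂Pi) := by
    rw [sqrt_integral_sq_eq_eLpNorm hv2, sqrt_integral_sq_eq_eLpNorm
      (memLp_markovOp hinv hvm (by norm_num) (by simp) hv2)]
    exact ENNReal.toReal_mono hv2.eLpNorm_ne_top
      (eLpNorm_markovOp_le hinv hvm (by norm_num) (by simp))
  have hTu : √(∫ x, markovOp K u x ^ 2 ∂Pi)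
      ≤ √(∫ x, markovOp K v x ^ 2 ∂Pi) + √(∫ x, markovOp K w0 x ^ 2 ∂Pi) := by
    refine le_trans (le_of_eq ?_) (sqrt_integral_add_sq_le
      (memLp_markovOp hinv hvm (by norm_num) (by simp) hv2)
      (memLp_markovOp hinv hw0m (by norm_num) (by simp) hw02))
    congr 1
    refine integral_congr_ae ?_
    have e : (fun x => v x + w0 x) = u := by ext x; simp [hv]
    have := markovOp_add_ae hinv (hv2.integrable (by norm_num)) (hw02.integrable (by norm_num))
    rw [e] at this
    filter_upwards [this] with x hx
    rw [hx]
  have hw0u : √(∫ x, w0 x ^ 2 ∂Pi) ≤ √(∫ x, u x ^ 2 ∂Pi) + √(∫ x, v x ^ 2 ∂Pi) := by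
    have := sqrt_integral_add_sq_le hu2 hv2.neg
    simp only [_root_.Pi.neg_apply, neg_sq] at this
    refine le_trans (le_of_eq ?_) this
    congr 2
    ext x
    simp [hv]
  have : κ * √(∫ x, w0 x ^ 2 ∂Pi) ≤ κ * √(∫ x, u x ^ 2 ∂Pi) + ε / 2 := by
    calc κ * √(∫ x, w0 x ^ 2 ∂Pi) ≤ κ * (√(∫ x, u x ^ 2 ∂Pi) + ε / 2) := by gcongr; linarith
      _ ≤ _ := by nlinarith
  linarith

theorem sqrt_integral_markovOp_iterate_sq_le (hinv : K.Invariant Pi) {κ : ℝ} (hκ : 0 ≤ κ)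
    (hgap : SpectralGap K Pi κ) {u : S → ℝ} (hu : Measurable u)
    (hu2 : MemLp u 2 Pi) (hmean : ∫ x, u x ∂Pi = 0) (m : ℕ) :
    √(∫ x, (markovOp K)^[m] u x ^ 2 ∂Pi) ≤ κ ^ m * √(∫ x, u x ^ 2 ∂Pi) := by
  induction m with
  | zero => simp
  | succ m ih =>
    rw [Function.iterate_succ_apply', pow_succ', mul_assoc]
    refine (hgap _ (measurable_markovOp_iterate hu m)
      (memLp_markovOp_iterate hinv hu (by norm_num) (by simp) hu2 m) ?_).trans ?_
    · rw [integral_markovOp_iterate hinv hu (hu2.integrable (by norm_num)), hmean]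
    · gcongr

end Gap
/-! ### Conditional expectations of square-integrable variables -/

section CondExp

variable {Ω : Type*} {m mΩ : MeasurableSpace Ω} {P : Measure Ω} [IsProbabilityMeasure P]

theorem integral_mul_condExp_of_stronglyMeasurable (hm : m ≤ mΩ) {U V : Ω → ℝ}
    (hU : StronglyMeasurable[m] U) (hU2 : MemLp U 2 P) (hV2 : MemLp V 2 P) :
    ∫ ω, U ω * P[V|m] ω ∂P = ∫ ω, U ω * V ω ∂P := by
  have h := condExp_mul_of_stronglyMeasurable_left hU (hU2.integrable_mul hV2)
    (hV2.integrable (by norm_num))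
  have h1 : ∫ ω, P[U * V|m] ω ∂P = ∫ ω, (U * V) ω ∂P := integral_condExp hm
  rw [integral_congr_ae h] at h1
  simpa using h1

theorem integral_mul_condExp_comm (hm : m ≤ mΩ) {U V : Ω → ℝ} (hU2 : MemLp U 2 P)
    (hV2 : MemLp V 2 P) : ∫ ω, U ω * P[V|m] ω ∂P = ∫ ω, P[U|m] ω * V ω ∂P := by
  have h1 := integral_mul_condExp_of_stronglyMeasurable hm (stronglyMeasurable_condExp (f := U))
    (hU2.condExp (by norm_num)) hV2
  have h2 := integral_mul_condExp_of_stronglyMeasurable hm (stronglyMeasurable_condExp (f := V))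
    (hV2.condExp (by norm_num)) hU2
  rw [← h1]
  simp_rw [mul_comm (U _)]
  rw [← h2]
  simp_rw [mul_comm]

end CondExp

/-! ### Past and future σ-algebras of the chain -/

section Chain

variable {S Ω : Type*} [MeasurableSpace S] {X : ℕ → Ω → S}

/-- The σ-algebra generated by `X 0, …, X n`. -/
abbrev past (X : ℕ → Ω → S) (n : ℕ) : MeasurableSpace Ω :=
  ⨆ j : Fin (n + 1), MeasurableSpace.comap (X j) inferInstance

/-- The σ-algebra generated by `X n, X (n + 1), …`. -/
abbrev future (X : ℕ → Ω → S) (n : ℕ) : MeasurableSpace Ω :=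
  ⨆ j : ℕ, MeasurableSpace.comap (X (n + j)) inferInstance

theorem measurable_past {i n : ℕ} (h : i ≤ n) : Measurable[past X n] (X i) := by
  have : MeasurableSpace.comap (X i) inferInstance ≤ past X n :=
    le_iSup (fun j : Fin (n + 1) => MeasurableSpace.comap (X j) inferInstance)
      ⟨i, Nat.lt_succ_of_le h⟩
  exact (comap_measurable (X i)).mono this le_rfl

theorem measurable_future {i n : ℕ} (h : n ≤ i) : Measurable[future X n] (X i) := by
  obtain ⟨j, rfl⟩ := Nat.exists_eq_add_of_le h
  exact (comap_measurable (X (n + j))).mono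
    (le_iSup (fun j : ℕ => MeasurableSpace.comap (X (n + j)) inferInstance) j) le_rfl

theorem past_mono {i n : ℕ} (h : i ≤ n) : past X i ≤ past X n :=
  iSup_le fun j => (measurable_past (by omega)).comap_le

theorem comap_le_past (n : ℕ) : MeasurableSpace.comap (X n) inferInstance ≤ past X n :=
  (measurable_past le_rfl).comap_le

theorem comap_le_future (n : ℕ) : MeasurableSpace.comap (X n) inferInstance ≤ future X n :=
  (measurable_future le_rfl).comap_le

theorem past_le [mΩ : MeasurableSpace Ω] (hX : ∀ n, Measurable (X n)) (n : ℕ) : past X n ≤ mΩ :=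
  iSup_le fun j => (hX j).comap_le

theorem future_le [mΩ : MeasurableSpace Ω] (hX : ∀ n, Measurable (X n)) (n : ℕ) :
    future X n ≤ mΩ :=
  iSup_le fun j => (hX (n + j)).comap_le

theorem future_eq_generateFrom (n : ℕ) :
    future X n = MeasurableSpace.generateFrom (piiUnionInter
      (fun j : ℕ => {s | MeasurableSet[MeasurableSpace.comap (X (n + j)) inferInstance] s})
        Set.univ) := by
  rw [generateFrom_piiUnionInter_measurableSet
    (fun j : ℕ => MeasurableSpace.comap (X (n + j)) inferInstance)]
  simp

theorem isPiSystem_future_cylinders (n : ℕ) :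
    IsPiSystem (piiUnionInter
      (fun j : ℕ => {s | MeasurableSet[MeasurableSpace.comap (X (n + j)) inferInstance] s})
        Set.univ) :=
  isPiSystem_piiUnionInter _ (fun j => @MeasurableSpace.isPiSystem_measurableSet _
    (MeasurableSpace.comap (X (n + j)) inferInstance)) _

theorem integral_bind_kernel {K : Kernel S S} [IsMarkovKernel K] {μ : Measure S}
    [IsFiniteMeasure μ] {u : S → ℝ} (hu : Measurable u) (h : Integrable u (μ.bind K)) :
    ∫ x, u x ∂(μ.bind K) = ∫ x, markovOp K u x ∂μ := by
  rw [← Measure.snd_compProd, Measure.snd] at h ⊢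
  rw [integral_map measurable_snd.aemeasurable hu.aestronglyMeasurable]
  have h1 : Integrable (fun z : S × S => u z.2) (μ ⊗ₘ K) := h.comp_measurable measurable_snd
  rw [Measure.integral_compProd h1]
  rfl

/-! ### The Markov property -/

variable [mΩ : MeasurableSpace Ω] {K : Kernel S S} [IsMarkovKernel K] {Pi : Measure S}
  {P : Measure Ω} [IsProbabilityMeasure P]

/-- The defining property concerns indicators only. Integrating it over a past event gives an
identity of measures, which yields the law of each X n and the conditional expectation of any
integrable function of the next state. -/
theorem IsMarkovChain.map_restrict_succ (hX : IsMarkovChain K Pi P X) (n : ℕ) {B : Set Ω}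
    (hB : MeasurableSet[past X n] B) :
    (P.restrict B).map (X (n + 1)) = ((P.restrict B).map (X n)).bind K := by
  have hle := past_le hX.measurable n
  ext A hA
  rw [Measure.bind_apply hA K.aemeasurable,
    lintegral_map (K.measurable_coe hA) (hX.measurable n),
    Measure.map_apply (hX.measurable _) hA]
  have hInt : Integrable ((X (n + 1) ⁻¹' A).indicator fun _ => (1 : ℝ)) P :=
    (integrable_const _).indicator (hX.measurable _ hA)
  have h1 := setIntegral_condExp hle hInt hB
  rw [setIntegral_congr_ae (hle _ hB) ((hX.markov n A hA).mono fun ω h _ => h),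
    integral_indicator_const _ (hX.measurable _ hA), smul_eq_mul, mul_one] at h1
  rw [← ENNReal.ofReal_toReal (measure_ne_top (P.restrict B) (X (n + 1) ⁻¹' A)),
    ← measureReal_def, ← h1]
  have hi : Integrable (fun ω => (K (X n ω)).real A) (P.restrict B) := by
    refine Integrable.mono' (integrable_const (1 : ℝ)) ?_ ?_
    · exact (((K.measurable_coe hA).comp (hX.measurable n)).ennreal_toReal).aestronglyMeasurable
    · refine Eventually.of_forall fun ω => ?_
      rw [Real.norm_of_nonneg measureReal_nonneg]
      exact measureReal_le_one
  rw [ofReal_integral_eq_lintegral_ofReal hi (Eventually.of_forall fun ω => measureReal_nonneg)]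
  refine lintegral_congr fun ω => ?_
  rw [measureReal_def, ENNReal.ofReal_toReal (measure_ne_top _ _)]

theorem IsMarkovChain.map_eq (hX : IsMarkovChain K Pi P X) (hinv : K.Invariant Pi) (n : ℕ) :
    P.map (X n) = Pi := by
  induction n with
  | zero => exact hX.initial
  | succ n ih =>
    have := hX.map_restrict_succ n (B := Set.univ) MeasurableSet.univ
    simp only [Measure.restrict_univ] at this
    rw [this, ih, hinv.def]

theorem IsMarkovChain.measurePreserving (hX : IsMarkovChain K Pi P X) (hinv : K.Invariant Pi)
    (n : ℕ) : MeasurePreserving (X n) P Pi := ⟨hX.measurable n, hX.map_eq hinv n⟩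

theorem IsMarkovChain.integral_comp (hX : IsMarkovChain K Pi P X) (hinv : K.Invariant Pi)
    {u : S → ℝ} (hu : Measurable u) (n : ℕ) : ∫ ω, u (X n ω) ∂P = ∫ x, u x ∂Pi := by
  rw [← hX.map_eq hinv n, integral_map (hX.measurable n).aemeasurable hu.aestronglyMeasurable]

theorem IsMarkovChain.condExp_comp_succ (hX : IsMarkovChain K Pi P X) (hinv : K.Invariant Pi)
    {u : S → ℝ} (hu : Measurable u) (hui : Integrable u Pi) (n : ℕ) :
    P[fun ω => u (X (n + 1) ω)|past X n] =ᵐ[P] fun ω => markovOp K u (X n ω) := by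
  have hle := past_le hX.measurable n
  have hT : Integrable (markovOp K u) Pi := memLp_one_iff_integrable.1
    (memLp_markovOp hinv hu le_rfl (by simp) (memLp_one_iff_integrable.2 hui))
  have hi1 : Integrable (fun ω => u (X (n + 1) ω)) P :=
    (hX.measurePreserving hinv (n + 1)).integrable_comp_of_integrable hui
  have hi2 : Integrable (fun ω => markovOp K u (X n ω)) P :=
    (hX.measurePreserving hinv n).integrable_comp_of_integrable hT
  refine (ae_eq_condExp_of_forall_setIntegral_eq hle hi1 (fun _ _ _ => hi2.integrableOn)
    (fun B hB _ => ?_) ?_).symm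
  · have h := hX.map_restrict_succ n hB
    have hi3 : Integrable u ((P.restrict B).map (X (n + 1))) :=
      (integrable_map_measure hu.aestronglyMeasurable (hX.measurable _).aemeasurable).2
        hi1.integrableOn
    have h2 : ∫ ω in B, u (X (n + 1) ω) ∂P = ∫ x, u x ∂((P.restrict B).map (X (n + 1))) :=
      (integral_map (hX.measurable _).aemeasurable hu.aestronglyMeasurable).symm
    rw [h2]
    rw [h] at hi3 ⊢
    rw [integral_bind_kernel hu hi3, integral_map (hX.measurable _).aemeasurable
      (measurable_markovOp hu).aestronglyMeasurable]
  · exact ((measurable_markovOp hu).comp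
      (measurable_past le_rfl)).stronglyMeasurable.aestronglyMeasurable

theorem IsMarkovChain.condExp_comp_add (hX : IsMarkovChain K Pi P X) (hinv : K.Invariant Pi)
    {u : S → ℝ} (hu : Measurable u) (hui : Integrable u Pi) (n k : ℕ) :
    P[fun ω => u (X (n + k) ω)|past X n] =ᵐ[P] fun ω => (markovOp K)^[k] u (X n ω) := by
  have hle := past_le hX.measurable
  induction k generalizing u with
  | zero =>
    exact (condExp_of_stronglyMeasurable (hle n)
      (hu.comp (measurable_past le_rfl)).stronglyMeasurable
      ((hX.measurePreserving hinv n).integrable_comp_of_integrable hui)).eventuallyEq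
  | succ k ih =>
    have hT : Integrable (markovOp K u) Pi := memLp_one_iff_integrable.1
      (memLp_markovOp hinv hu le_rfl (by simp) (memLp_one_iff_integrable.2 hui))
    have h1 := condExp_condExp_of_le (μ := P) (f := fun ω => u (X (n + k + 1) ω))
      (past_mono (X := X) (Nat.le_add_right n k)) (hle _)
    refine h1.symm.trans ?_
    rw [Function.iterate_succ_apply]
    exact (condExp_congr_ae (hX.condExp_comp_succ hinv hu hui (n + k))).trans
      (ih (measurable_markovOp hu) hT)

variable [IsProbabilityMeasure Pi]

/-- Induction on the number of factors: condition first on the past up to n + 1, which turns the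
later factors into some w(X_{n+1}), then on the past up to n, which gives h₀(X_n)(Tw)(X_n). The
bound 1 keeps every function integrable. -/
theorem IsMarkovChain.exists_condExp_prod (hX : IsMarkovChain K Pi P X) (hinv : K.Invariant Pi)
    (N : ℕ) (n : ℕ) (h : ℕ → S → ℝ) (hm : ∀ i, Measurable (h i)) (hb : ∀ i x, |h i x| ≤ 1) :
    ∃ w : S → ℝ, Measurable w ∧ (∀ x, |w x| ≤ 1) ∧
      P[fun ω => ∏ i ∈ Finset.range N, h i (X (n + i) ω)|past X n] =ᵐ[P] fun ω => w (X n ω) := by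
  have hle := past_le hX.measurable
  induction N generalizing n h with
  | zero =>
    refine ⟨fun _ => 1, measurable_const, by simp, ?_⟩
    simp only [Finset.range_zero, Finset.prod_empty]
    rw [condExp_const (hle n)]
  | succ N ih =>
    obtain ⟨w, hwm, hwb, hw⟩ := ih (n + 1) (fun i => h (i + 1)) (fun i => hm _) (fun i => hb _)
    have hwi : Integrable w Pi := Integrable.mono' (integrable_const 1)
      hwm.aestronglyMeasurable (Eventually.of_forall hwb)
    have hTb : ∀ x, |markovOp K w x| ≤ 1 := by
      intro x
      have := norm_integral_le_of_norm_le_const (μ := K x) (f := w) (C := 1)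
        (Eventually.of_forall hwb)
      simpa [markovOp] using this
    refine ⟨fun x => h 0 x * markovOp K w x, (hm 0).mul (measurable_markovOp hwm), fun x => ?_, ?_⟩
    · rw [abs_mul]
      exact mul_le_one₀ (hb 0 x) (abs_nonneg _) (hTb x)
    · set V : Ω → ℝ := fun ω => ∏ i ∈ Finset.range N, h (i + 1) (X (n + 1 + i) ω) with hV
      have hVm : Measurable V := Finset.measurable_fun_prod _ fun i _ =>
        (hm _).comp (hX.measurable _)
      have hVb : ∀ ω, |V ω| ≤ 1 := fun ω => by
        rw [hV, Finset.abs_prod]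
        exact Finset.prod_le_one (fun _ _ => abs_nonneg _) fun i _ => hb _ _
      have hV2 : MemLp V 2 P := MemLp.of_bound hVm.aestronglyMeasurable 1
        (Eventually.of_forall hVb)
      have h02 : MemLp (fun ω => h 0 (X n ω)) 2 P := MemLp.of_bound
        ((hm 0).comp (hX.measurable n)).aestronglyMeasurable 1 (Eventually.of_forall fun ω => hb _ _)
      have e : (fun ω => ∏ i ∈ Finset.range (N + 1), h i (X (n + i) ω))
          = (fun ω => h 0 (X n ω)) * V := by
        ext ω
        simp only [Finset.prod_range_succ', hV, _root_.Pi.mul_apply, add_zero]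
        rw [mul_comm]
        congr 1
        refine Finset.prod_congr rfl fun i _ => ?_
        rw [show n + 1 + i = n + (i + 1) by omega]
      rw [e]
      have h1 := condExp_mul_of_stronglyMeasurable_left (μ := P) (m := past X n)
        ((hm 0).comp (measurable_past le_rfl)).stronglyMeasurable (h02.integrable_mul hV2)
        (hV2.integrable (by norm_num))
      have h2 := condExp_condExp_of_le (μ := P) (f := V)
        (past_mono (X := X) (Nat.le_succ n)) (hle _)
      have h3 : P[V|past X n] =ᵐ[P] fun ω => markovOp K w (X n ω) :=
        h2.symm.trans ((condExp_congr_ae hw).trans (hX.condExp_comp_succ hinv hwm hwi n))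
      filter_upwards [h1, h3] with ω h1 h3
      simp only [Function.comp_def] at h1
      rw [h1, _root_.Pi.mul_apply, h3]

theorem memLp_indicator_one {A : Set Ω} (hA : MeasurableSet A) :
    MemLp (A.indicator fun _ => (1 : ℝ)) 2 P :=
  memLp_indicator_const _ hA _ (by simp)

/-- Given the present, the probability of a past event does not depend on the future. -/
theorem IsMarkovChain.integral_inter_future (hX : IsMarkovChain K Pi P X) (hinv : K.Invariant Pi)
    (n : ℕ) {A : Set Ω} (hA : MeasurableSet[past X n] A) {B : Set Ω}
    (hB : MeasurableSet[future X n] B) :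
    ∫ ω in B, (P[A.indicator (fun _ => (1 : ℝ))|MeasurableSpace.comap (X n) inferInstance]) ω ∂P
      = ∫ ω in B, A.indicator (fun _ => (1 : ℝ)) ω ∂P := by
  have hle := past_le hX.measurable n
  have hfle := future_le hX.measurable n
  have hcle : MeasurableSpace.comap (X n) inferInstance ≤ mΩ := (hX.measurable n).comap_le
  set φ := P[A.indicator (fun _ => (1 : ℝ))|MeasurableSpace.comap (X n) inferInstance] with hφ
  have hA2 : MemLp (A.indicator fun _ => (1 : ℝ)) 2 P := memLp_indicator_one (hle _ hA)
  have hφ2 : MemLp φ 2 P := hA2.condExp (by norm_num)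
  have hA1 := hA2.integrable (by norm_num)
  have hφ1 := hφ2.integrable (by norm_num)
  -- Both sides are countably additive in B, so it suffices to treat cylinder events, which form a
  -- π-system generating the future.
  induction B, hB using MeasurableSpace.induction_on_inter (future_eq_generateFrom n)
    (isPiSystem_future_cylinders n) with
  | empty => simp
  | basic B hB =>
    obtain ⟨t, -, F, hF, rfl⟩ := hB
    choose! C hC hCF using hF
    classical
    set h : ℕ → S → ℝ := fun i => if i ∈ t then (C i).indicator (fun _ => 1) else fun _ => 1 with hh
    have hhm : ∀ i, Measurable (h i) := fun i => by
      by_cases hi : i ∈ t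
      · simp only [hh, hi, if_true]; exact measurable_const.indicator (hC i hi)
      · simp only [hh, hi, if_false]; exact measurable_const
    have hhb : ∀ i x, |h i x| ≤ 1 := fun i x => by
      by_cases hi : i ∈ t
      · by_cases hx : x ∈ C i <;> simp [hh, hi, hx]
      · simp [hh, hi]
    obtain ⟨w, hwm, hwb, hw⟩ := hX.exists_condExp_prod hinv (t.sup id + 1) n h hhm hhb
    have hind : (fun ω => ∏ i ∈ Finset.range (t.sup id + 1), h i (X (n + i) ω))
        = (⋂ x ∈ t, F x).indicator fun _ => (1 : ℝ) := by
      ext ω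
      have hsub : t ⊆ Finset.range (t.sup id + 1) := fun i hi =>
        Finset.mem_range.2 (Nat.lt_succ_of_le (Finset.le_sup (f := id) hi))
      rw [← Finset.prod_subset hsub (fun i _ hi => by simp [hh, hi])]
      by_cases hω : ω ∈ ⋂ x ∈ t, F x
      · rw [Set.indicator_of_mem hω]
        refine Finset.prod_eq_one fun i hi => ?_
        have : X (n + i) ω ∈ C i := by
          have := Set.mem_iInter₂.1 hω i hi
          rwa [← hCF i hi] at this
        simp [hh, hi, this]
      · rw [Set.indicator_of_notMem hω]
        simp only [Set.mem_iInter, not_forall] at hω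
        obtain ⟨i, hi, hiω⟩ := hω
        refine Finset.prod_eq_zero hi ?_
        have : X (n + i) ω ∉ C i := by
          rw [← hCF i hi] at hiω; exact hiω
        simp [hh, hi, this]
    rw [hind] at hw
    have hBm : MeasurableSet (⋂ x ∈ t, F x) := by
      refine Finset.measurableSet_biInter _ fun i hi => ?_
      rw [← hCF i hi]; exact hX.measurable _ (hC i hi)
    have hB2 : MemLp ((⋂ x ∈ t, F x).indicator fun _ => (1 : ℝ)) 2 P := memLp_indicator_one hBm
    have hw2 : MemLp (fun ω => w (X n ω)) 2 P := MemLp.of_bound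
      (hwm.comp (hX.measurable n)).aestronglyMeasurable 1 (Eventually.of_forall fun ω => hwb _)
    have hwm₀ : StronglyMeasurable[MeasurableSpace.comap (X n) inferInstance] fun ω => w (X n ω) :=
      (hwm.comp (comap_measurable (X n))).stronglyMeasurable
    -- Given the past, the cylinder's indicator has conditional expectation w(X_n), so integrating a
    -- past variable over the cylinder pairs it with w(X_n). Apply this to φ = E[1_A | X_n] and to
    -- 1_A: the pairings agree because w(X_n) depends on X_n alone.
    have key : ∀ U : Ω → ℝ, StronglyMeasurable[past X n] U → MemLp U 2 P →
        ∫ ω in ⋂ x ∈ t, F x, U ω ∂P = ∫ ω, U ω * w (X n ω) ∂P := by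
      intro U hU hU2
      rw [← integral_indicator hBm]
      have e : (fun ω => (⋂ x ∈ t, F x).indicator U ω)
          = fun ω => U ω * (⋂ x ∈ t, F x).indicator (fun _ => (1 : ℝ)) ω := by
        ext ω; by_cases hω : ω ∈ ⋂ x ∈ t, F x
        · rw [Set.indicator_of_mem hω, Set.indicator_of_mem hω, mul_one]
        · rw [Set.indicator_of_notMem hω, Set.indicator_of_notMem hω, mul_zero]
      rw [e, ← integral_mul_condExp_of_stronglyMeasurable hle hU hU2 hB2]
      refine integral_congr_ae ?_
      filter_upwards [hw] with ω hω
      rw [hω]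
    rw [key φ (stronglyMeasurable_condExp.mono (comap_le_past n)) hφ2,
      key _ (stronglyMeasurable_const.indicator hA) hA2]
    simp_rw [mul_comm _ (w _)]
    exact integral_mul_condExp_of_stronglyMeasurable hcle hwm₀ hw2 hA2
  | compl B hB ih =>
    have hB' := hfle _ hB
    have h1 := integral_add_compl hB' hφ1
    have h2 := integral_add_compl hB' hA1
    have h3 : ∫ ω, φ ω ∂P = ∫ ω, A.indicator (fun _ => (1 : ℝ)) ω ∂P := integral_condExp hcle
    linarith
  | iUnion f hd hf ih =>
    have hf' := fun i => hfle _ (hf i)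
    have h1 := hasSum_integral_iUnion hf' hd hφ1.integrableOn
    have h2 := hasSum_integral_iUnion hf' hd hA1.integrableOn
    simp_rw [ih] at h1
    exact h1.unique h2

/-- The Markov property for functionals of the whole future. -/
theorem IsMarkovChain.condExp_future (hX : IsMarkovChain K Pi P X) (hinv : K.Invariant Pi)
    (n : ℕ) {V : Ω → ℝ} (hV : StronglyMeasurable[future X n] V) (hV2 : MemLp V 2 P) :
    P[V|MeasurableSpace.comap (X n) inferInstance] =ᵐ[P] P[V|past X n] := by
  have hle := past_le hX.measurable n
  have hfle := future_le hX.measurable n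
  have hcle : MeasurableSpace.comap (X n) inferInstance ≤ mΩ := (hX.measurable n).comap_le
  refine ae_eq_condExp_of_forall_setIntegral_eq hle (hV2.integrable (by norm_num))
    (fun _ _ _ => integrable_condExp.integrableOn) (fun A hA _ => ?_)
    (stronglyMeasurable_condExp.mono (comap_le_past n)).aestronglyMeasurable
  have hA2 : MemLp (A.indicator fun _ => (1 : ℝ)) 2 P := memLp_indicator_one (hle _ hA)
  -- The preceding lemma says E[1_A | X_n] = E[1_A | future]. Self-adjointness of conditional
  -- expectation moves this identity from past events to V.
  have h1 : P[A.indicator (fun _ => (1 : ℝ))|MeasurableSpace.comap (X n) inferInstance]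
      =ᵐ[P] P[A.indicator (fun _ => (1 : ℝ))|future X n] :=
    ae_eq_condExp_of_forall_setIntegral_eq hfle (hA2.integrable (by norm_num))
      (fun _ _ _ => integrable_condExp.integrableOn)
      (fun B hB _ => hX.integral_inter_future hinv n hA hB)
      (stronglyMeasurable_condExp.mono (comap_le_future n)).aestronglyMeasurable
  have e : ∀ U : Ω → ℝ, ∫ ω in A, U ω ∂P = ∫ ω, A.indicator (fun _ => (1 : ℝ)) ω * U ω ∂P := by
    intro U
    rw [← integral_indicator (hle _ hA)]
    congr 1
    ext ω
    by_cases hω : ω ∈ A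
    · rw [Set.indicator_of_mem hω, Set.indicator_of_mem hω, one_mul]
    · rw [Set.indicator_of_notMem hω, Set.indicator_of_notMem hω, zero_mul]
  rw [e, e, integral_mul_condExp_comm hcle hA2 hV2]
  have h2 := integral_mul_condExp_of_stronglyMeasurable hfle hV hV2 hA2
  simp_rw [mul_comm _ (V _)]
  rw [← h2]
  refine integral_congr_ae ?_
  filter_upwards [h1] with ω hω
  rw [hω]

/-! ### Exponential decay of correlations -/

/-- The maximal correlation between past and future decays at the rate of the spectral gap. -/
theorem IsMarkovChain.abs_covariance_le (hX : IsMarkovChain K Pi P X) (hinv : K.Invariant Pi)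
    {κ : ℝ} (hκ : 0 ≤ κ) (hgap : SpectralGap K Pi κ)
    (n k : ℕ) {U V : Ω → ℝ} (hU : StronglyMeasurable[past X n] U) (hU2 : MemLp U 2 P)
    (hV : StronglyMeasurable[future X (n + k)] V) (hV2 : MemLp V 2 P) :
    |cov[U, V; P]| ≤ κ ^ k * (√Var[U; P] * √Var[V; P]) := by
  have hle := past_le hX.measurable
  set U₀ : Ω → ℝ := fun ω => U ω - P[U] with hU₀
  set V₀ : Ω → ℝ := fun ω => V ω - P[V] with hV₀
  have hU₀2 : MemLp U₀ 2 P := hU2.sub (memLp_const _)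
  have hV₀2 : MemLp V₀ 2 P := hV2.sub (memLp_const _)
  have hU₀m : StronglyMeasurable[past X n] U₀ := hU.sub stronglyMeasurable_const
  have hV₀m : StronglyMeasurable[future X (n + k)] V₀ := hV.sub stronglyMeasurable_const
  -- By the Markov property E[V₀ | past up to n + k] = u(X_{n+k}) with u centred and ‖u‖ ≤ ‖V₀‖.
  -- Conditioning on the past up to n gives (T^k u)(X_n), and the spectral gap supplies the factor
  -- κ^k.
  obtain ⟨u, hum, hu⟩ := (stronglyMeasurable_condExp (μ := P) (f := V₀)
    (m := MeasurableSpace.comap (X (n + k)) inferInstance)).exists_eq_measurable_comp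
  have hu' : P[V₀|past X (n + k)] =ᵐ[P] fun ω => u (X (n + k) ω) := by
    refine (hX.condExp_future hinv (n + k) hV₀m hV₀2).symm.trans ?_
    rw [hu]; rfl
  have hcomp2 : MemLp (fun ω => u (X (n + k) ω)) 2 P :=
    (hV₀2.condExp (by norm_num) (m := past X (n + k))).ae_eq hu'
  have hu2 : MemLp u 2 Pi := by
    rw [← hX.map_eq hinv (n + k)]
    exact (memLp_map_measure_iff hum.aestronglyMeasurable (hX.measurable _).aemeasurable).2 hcomp2
  have hmean : ∫ x, u x ∂Pi = 0 := by
    rw [← hX.integral_comp hinv hum.measurable (n + k), ← integral_congr_ae hu',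
      integral_condExp (hle _), hV₀, integral_sub (hV2.integrable (by norm_num))
      (integrable_const _)]
    simp
  have hcond : P[V₀|past X n] =ᵐ[P] fun ω => (markovOp K)^[k] u (X n ω) :=
    (condExp_condExp_of_le (past_mono (Nat.le_add_right n k)) (hle _)).symm.trans
      ((condExp_congr_ae hu').trans
        (hX.condExp_comp_add hinv hum.measurable (hu2.integrable (by norm_num)) n k))
  have h1 : cov[U, V; P] = ∫ ω, U₀ ω * (markovOp K)^[k] u (X n ω) ∂P := by
    rw [covariance, ← integral_mul_condExp_of_stronglyMeasurable (hle n) hU₀m hU₀2 hV₀2]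
    refine integral_congr_ae ?_
    filter_upwards [hcond] with ω hω
    rw [hω]
  have hTm := measurable_markovOp_iterate (K := K) hum.measurable k
  have hT2 : MemLp (fun ω => (markovOp K)^[k] u (X n ω)) 2 P :=
    (memLp_markovOp_iterate hinv hum.measurable (by norm_num) (by simp) hu2
      k).comp_measurePreserving (hX.measurePreserving hinv n)
  have h2 := abs_integral_mul_le_sqrt hU₀2 hT2
  have h3 : ∫ ω, (markovOp K)^[k] u (X n ω) ^ 2 ∂P = ∫ x, (markovOp K)^[k] u x ^ 2 ∂Pi :=
    hX.integral_comp hinv (u := fun x => (markovOp K)^[k] u x ^ 2) (by fun_prop) n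
  have h4 := sqrt_integral_markovOp_iterate_sq_le hinv hκ hgap hum.measurable hu2 hmean k
  have h5 : √(∫ x, u x ^ 2 ∂Pi) ≤ √(∫ ω, V₀ ω ^ 2 ∂P) := by
    rw [sqrt_integral_sq_eq_eLpNorm hu2, sqrt_integral_sq_eq_eLpNorm hV₀2]
    refine ENNReal.toReal_mono hV₀2.eLpNorm_ne_top ?_
    have e : eLpNorm u 2 Pi = eLpNorm (fun ω => u (X (n + k) ω)) 2 P :=
      (eLpNorm_comp_measurePreserving hu2.1 (hX.measurePreserving hinv (n + k))).symm
    rw [e, ← eLpNorm_congr_ae hu']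
    exact eLpNorm_condExp_le_eLpNorm _ (by norm_num)
  rw [variance_eq_integral hU2.1.aemeasurable, variance_eq_integral hV2.1.aemeasurable, h1]
  rw [h3] at h2
  calc _ ≤ _ := h2
    _ ≤ √(∫ ω, U₀ ω ^ 2 ∂P) * (κ ^ k * √(∫ ω, V₀ ω ^ 2 ∂P)) := by
        gcongr
        exact h4.trans (by gcongr)
    _ = _ := by ring

end Chain
/-! ### The Poisson equation -/

section Moments

variable {α : Type*} [MeasurableSpace α] {μ : Measure α}

theorem integrable_even_pow {n : ℕ} (hn : Even n) (h0 : n ≠ 0) {u : α → ℝ}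
    (hu : MemLp u n μ) : Integrable (fun x => u x ^ n) μ := by
  have := hu.integrable_norm_pow h0
  simpa only [Real.norm_eq_abs, hn.pow_abs] using this

theorem memLp_of_integrable_even_pow {n : ℕ} (hn : Even n) (h0 : n ≠ 0) {u : α → ℝ}
    (hum : AEStronglyMeasurable u μ) (h : Integrable (fun x => u x ^ n) μ) : MemLp u n μ := by
  rw [← integrable_norm_rpow_iff hum (by exact_mod_cast h0) (by simp)]
  simpa only [ENNReal.toReal_natCast, Real.rpow_natCast, Real.norm_eq_abs, hn.pow_abs] using h

theorem toReal_eLpNorm_eq {n : ℕ} (hn : Even n) (h0 : n ≠ 0) {u : α → ℝ} (hu : MemLp u n μ) :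
    (eLpNorm u n μ).toReal = (∫ x, u x ^ n ∂μ) ^ ((n : ℝ)⁻¹) := by
  rw [hu.eLpNorm_eq_integral_rpow_norm (by exact_mod_cast h0) (by simp),
    ENNReal.toReal_ofReal (by positivity)]
  simp only [ENNReal.toReal_natCast, Real.rpow_natCast, Real.norm_eq_abs, hn.pow_abs]

theorem integral_even_pow_le_of_eLpNorm_le {n : ℕ} (hn : Even n) (h0 : n ≠ 0) {u v : α → ℝ}
    (hu : MemLp u n μ) (hv : MemLp v n μ) (h : eLpNorm u n μ ≤ eLpNorm v n μ) :
    ∫ x, u x ^ n ∂μ ≤ ∫ x, v x ^ n ∂μ := by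
  have := ENNReal.toReal_mono hv.eLpNorm_ne_top h
  rw [toReal_eLpNorm_eq hn h0 hu, toReal_eLpNorm_eq hn h0 hv] at this
  have hp : (0 : ℝ) < (n : ℝ)⁻¹ := by positivity
  exact (Real.rpow_le_rpow_iff (integral_nonneg fun x => hn.pow_nonneg _)
    (integral_nonneg fun x => hn.pow_nonneg _) hp).1 this

/-- A series that converges absolutely in `L^p` converges in `L^p`. -/
theorem exists_tendsto_eLpNorm_sum {p : ENNReal} [Fact (1 ≤ p)] {u : ℕ → α → ℝ}
    (hu : ∀ m, MemLp (u m) p μ) (hsum : Summable fun m => (eLpNorm (u m) p μ).toReal) :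
    ∃ g : α → ℝ, Measurable g ∧ MemLp g p μ ∧
      Tendsto (fun N => eLpNorm ((fun x => ∑ m ∈ Finset.range N, u m x) - g) p μ) atTop
        (nhds 0) := by
  have hs : ∀ N, MemLp (fun x => ∑ m ∈ Finset.range N, u m x) p μ := fun N =>
    memLp_finsetSum _ fun m _ => hu m
  have hsLp : ∀ N, (hs N).toLp (fun x => ∑ m ∈ Finset.range N, u m x)
      = ∑ m ∈ Finset.range N, (hu m).toLp (u m) := by
    intro N
    induction N with
    | zero =>
      rw [Finset.sum_range_zero, Lp.eq_zero_iff_ae_eq_zero]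
      filter_upwards [(hs 0).coeFn_toLp] with x hx
      rw [hx]
      rfl
    | succ N ih =>
      have h1 : (hs (N + 1)).toLp (fun x => ∑ m ∈ Finset.range (N + 1), u m x)
          = ((hs N).add (hu N)).toLp ((fun x => ∑ m ∈ Finset.range N, u m x) + u N) :=
        MemLp.toLp_congr _ _ (Eventually.of_forall fun x => by simp [Finset.sum_range_succ])
      rw [h1, MemLp.toLp_add (hs N) (hu N), ih, Finset.sum_range_succ]
  have hsum' : Summable fun m => (hu m).toLp (u m) :=
    Summable.of_norm (by simpa only [Lp.norm_toLp] using hsum)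
  obtain ⟨G, hG⟩ := hsum'
  have hGp : MemLp (G : α → ℝ) p μ := Lp.memLp G
  refine ⟨G, (Lp.stronglyMeasurable G).measurable, hGp, ?_⟩
  refine (Lp.tendsto_Lp_iff_tendsto_eLpNorm'' _ hs _ hGp).1 ?_
  rw [Lp.toLp_coeFn]
  exact hG.tendsto_sum_nat.congr fun N => (hsLp N).symm

/-- Interpolation of L⁶ between L² and L⁸ with a free weight t, obtained by comparing t x² with 1.
-/
theorem pow_six_le (t : ℝ) (ht : 0 < t) (x : ℝ) : x ^ 6 ≤ t * x ^ 8 + (t ^ 2)⁻¹ * x ^ 2 := by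
  have ht2 : 0 < t ^ 2 := by positivity
  rcases le_total 1 (t * x ^ 2) with h | h
  · have h1 : x ^ 6 * 1 ≤ x ^ 6 * (t * x ^ 2) := mul_le_mul_of_nonneg_left h (by positivity)
    have h2 : 0 ≤ (t ^ 2)⁻¹ * x ^ 2 := by positivity
    nlinarith
  · have h1 : x ^ 4 ≤ (t ^ 2)⁻¹ := by
      have h0 : 0 ≤ t * x ^ 2 := by positivity
      rw [← one_div, le_div_iff₀ ht2]
      nlinarith
    have h2 : x ^ 4 * x ^ 2 ≤ (t ^ 2)⁻¹ * x ^ 2 := mul_le_mul_of_nonneg_right h1 (by positivity)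
    have h3 : 0 ≤ t * x ^ 8 := by positivity
    nlinarith

end Moments

section Poisson

variable {S : Type*} [MeasurableSpace S] {K : Kernel S S} {Pi : Measure S}
  [IsMarkovKernel K] [IsProbabilityMeasure Pi]

/-- The eighth moments stay bounded and the second moments decay like κ^{2m}. With r = √κ and weight
t = r^m, the two interpolation terms have orders r^m and r^{-2m} r^{4m} = r^{2m}, so L⁶ inherits
geometric decay. This is the use of eight moments. -/
theorem integral_markovOp_iterate_pow_six_le (hinv : K.Invariant Pi) {κ : ℝ} (hκ : 0 < κ)
    (hκ1 : κ < 1) (hgap : SpectralGap K Pi κ) {f : S → ℝ} (hf : Measurable f) (hf8 : MemLp f 8 Pi)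
    (hmean : ∫ x, f x ∂Pi = 0) (m : ℕ) :
    ∫ x, (markovOp K)^[m] f x ^ 6 ∂Pi
      ≤ √κ ^ m * (∫ x, f x ^ 8 ∂Pi + ∫ x, f x ^ 2 ∂Pi) := by
  have hf2 : MemLp f 2 Pi := hf8.mono_exponent (by norm_num)
  have hu8 : MemLp ((markovOp K)^[m] f) 8 Pi :=
    memLp_markovOp_iterate hinv hf (by norm_num) (by simp) hf8 m
  have hu2 : MemLp ((markovOp K)^[m] f) 2 Pi := hu8.mono_exponent (by norm_num)
  have i8 : Integrable (fun x => (markovOp K)^[m] f x ^ 8) Pi :=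
    integrable_even_pow (n := 8) (by decide) (by norm_num) (by simpa using hu8)
  have b8 : ∫ x, (markovOp K)^[m] f x ^ 8 ∂Pi ≤ ∫ x, f x ^ 8 ∂Pi :=
    integral_even_pow_le_of_eLpNorm_le (n := 8) (by decide) (by norm_num) (by simpa using hu8)
      (by simpa using hf8) (by
        simpa using eLpNorm_markovOp_iterate_le hinv hf (p := 8) (by norm_num) (by simp) m)
  have b2 : ∫ x, (markovOp K)^[m] f x ^ 2 ∂Pi ≤ κ ^ (2 * m) * ∫ x, f x ^ 2 ∂Pi := by
    have h := sqrt_integral_markovOp_iterate_sq_le hinv hκ.le hgap hf hf2 hmean m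
    have h' := pow_le_pow_left₀ (Real.sqrt_nonneg _) h 2
    rwa [mul_pow, Real.sq_sqrt (integral_nonneg fun x => sq_nonneg _),
      Real.sq_sqrt (integral_nonneg fun x => sq_nonneg _), ← pow_mul, mul_comm m 2] at h'
  have hr : 0 < √κ := Real.sqrt_pos.2 hκ
  have hr1 : √κ < 1 := by rw [Real.sqrt_lt' one_pos]; simpa using hκ1
  have hκr : κ = √κ ^ 2 := (Real.sq_sqrt hκ.le).symm
  set r := √κ
  have ht : 0 < r ^ m := pow_pos hr m
  calc ∫ x, (markovOp K)^[m] f x ^ 6 ∂Pi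
      ≤ ∫ x, (r ^ m * (markovOp K)^[m] f x ^ 8
          + ((r ^ m) ^ 2)⁻¹ * (markovOp K)^[m] f x ^ 2) ∂Pi :=
        integral_mono_of_nonneg (Eventually.of_forall fun x => by positivity)
          ((i8.const_mul _).fun_add (hu2.integrable_sq.const_mul _))
          (Eventually.of_forall fun x => pow_six_le _ ht _)
    _ = r ^ m * ∫ x, (markovOp K)^[m] f x ^ 8 ∂Pi
          + ((r ^ m) ^ 2)⁻¹ * ∫ x, (markovOp K)^[m] f x ^ 2 ∂Pi := by
        rw [integral_add (i8.const_mul _) (hu2.integrable_sq.const_mul _), integral_const_mul,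
          integral_const_mul]
    _ ≤ r ^ m * ∫ x, f x ^ 8 ∂Pi
          + ((r ^ m) ^ 2)⁻¹ * (κ ^ (2 * m) * ∫ x, f x ^ 2 ∂Pi) := by gcongr
    _ = r ^ m * ∫ x, f x ^ 8 ∂Pi + (r ^ m) ^ 2 * ∫ x, f x ^ 2 ∂Pi := by
        have e : κ ^ (2 * m) = (r ^ m) ^ 2 * (r ^ m) ^ 2 := by rw [hκr]; ring
        rw [e]; field_simp
    _ ≤ _ := by
        have h1 : (r ^ m) ^ 2 ≤ r ^ m := by
          have : r ^ m ≤ 1 := pow_le_one₀ hr.le hr1.le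
          nlinarith
        have h2 : 0 ≤ ∫ x, f x ^ 2 ∂Pi := integral_nonneg fun x => sq_nonneg _
        nlinarith

/-- The Poisson equation `g - K g = f` has a solution with six moments, and pairing it with `f`
sums the autocovariances. -/
theorem exists_poisson_solution (hinv : K.Invariant Pi) {κ : ℝ} (hκ : 0 < κ)
    (hκ1 : κ < 1) (hgap : SpectralGap K Pi κ) {f : S → ℝ} (hf : Measurable f) (hf8 : MemLp f 8 Pi)
    (hmean : ∫ x, f x ∂Pi = 0) :
    ∃ g : S → ℝ, Measurable g ∧ MemLp g 6 Pi ∧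
      (∀ᵐ x ∂Pi, g x - markovOp K g x = f x) ∧
      Tendsto (fun N => ∑ m ∈ Finset.range N, ∫ x, f x * (markovOp K)^[m] f x ∂Pi) atTop
        (nhds (∫ x, f x * g x ∂Pi)) := by
  set u : ℕ → S → ℝ := fun m => (markovOp K)^[m] f with hu
  have hf2 : MemLp f 2 Pi := hf8.mono_exponent (by norm_num)
  have hf6 : MemLp f 6 Pi := hf8.mono_exponent (by norm_num)
  have hum : ∀ m, Measurable (u m) := fun m => measurable_markovOp_iterate hf m
  have hu6 : ∀ m, MemLp (u m) 6 Pi := fun m =>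
    memLp_markovOp_iterate hinv hf (by norm_num) (by simp) hf6 m
  have hr : 0 < √κ := Real.sqrt_pos.2 hκ
  have hr1 : √κ < 1 := by rw [Real.sqrt_lt' one_pos]; simpa using hκ1
  set C := ∫ x, f x ^ 8 ∂Pi + ∫ x, f x ^ 2 ∂Pi with hC
  have hC0 : 0 ≤ C := add_nonneg (integral_nonneg fun x => by positivity)
    (integral_nonneg fun x => by positivity)
  have : Fact ((1 : ENNReal) ≤ 6) := ⟨by norm_num⟩
  have hnorm : ∀ m, (eLpNorm (u m) 6 Pi).toReal ≤ (√κ ^ ((6 : ℝ)⁻¹)) ^ m * C ^ ((6 : ℝ)⁻¹) := by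
    intro m
    have h6 := toReal_eLpNorm_eq (n := 6) (by decide) (by norm_num) (u := u m) (μ := Pi)
      (by simpa using hu6 m)
    simp only [Nat.cast_ofNat] at h6
    rw [h6, ← Real.rpow_natCast, ← Real.rpow_mul hr.le, mul_comm (6 : ℝ)⁻¹,
      Real.rpow_mul hr.le, Real.rpow_natCast, ← Real.mul_rpow (by positivity) hC0]
    exact Real.rpow_le_rpow (integral_nonneg fun x => by positivity)
      (integral_markovOp_iterate_pow_six_le hinv hκ hκ1 hgap hf hf8 hmean m) (by positivity)
  -- The L⁶ norms are bounded by a geometric sequence of ratio κ^{1/12}, so G = ∑ T^m f converges in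
  -- L⁶.
  have hsum : Summable fun m => (eLpNorm (u m) 6 Pi).toReal :=
    Summable.of_nonneg_of_le (fun _ => ENNReal.toReal_nonneg) hnorm
      ((summable_geometric_of_lt_one (by positivity)
        (Real.rpow_lt_one hr.le hr1 (by positivity))).mul_right _)
  have hs6 : ∀ N, MemLp (fun x => ∑ m ∈ Finset.range N, u m x) 6 Pi := fun N =>
    memLp_finsetSum _ fun m _ => hu6 m
  obtain ⟨G, hGm, hG6, hlim6⟩ := exists_tendsto_eLpNorm_sum hu6 hsum
  have hlim : ∀ p : ENNReal, p ≤ 6 → Tendsto (fun N =>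
      eLpNorm ((fun x => ∑ m ∈ Finset.range N, u m x) - G) p Pi) atTop (nhds 0) := by
    intro p hp
    exact tendsto_of_tendsto_of_tendsto_of_le_of_le tendsto_const_nhds hlim6
      (fun _ => zero_le)
      (fun N => eLpNorm_le_eLpNorm_of_exponent_le hp ((hs6 N).sub hG6).1)
  refine ⟨G, hGm, hG6, ?_, ?_⟩
  · have hGi : Integrable (G : S → ℝ) Pi := hG6.integrable (by norm_num)
    have hui : ∀ m, Integrable (u m) Pi := fun m => (hu6 m).integrable (by norm_num)
    have hsi : ∀ N, Integrable (fun x => ∑ m ∈ Finset.range N, u m x) Pi :=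
      fun N => (hs6 N).integrable (by norm_num)
    -- Telescoping: T applied to a partial sum shifts it by one term and loses the term f.
    have hTs : ∀ N, markovOp K (fun x => ∑ m ∈ Finset.range N, u m x)
        =ᵐ[Pi] fun x => ∑ m ∈ Finset.range (N + 1), u m x - f x := by
      intro N
      induction N with
      | zero => exact Eventually.of_forall fun x => by simp [hu, markovOp]
      | succ N ih =>
        have h1 := markovOp_add_ae hinv (hsi N) (hui N)
        simp_rw [← Finset.sum_range_succ (fun m => u m _)] at h1
        filter_upwards [h1, ih] with x h1 h2
        rw [h1, h2, Finset.sum_range_succ _ (N + 1)]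
        simp only [hu, Function.iterate_succ_apply']
        ring
    have hTG : MemLp (markovOp K G) 1 Pi :=
      memLp_markovOp hinv hGm le_rfl (by simp) (memLp_one_iff_integrable.2 hGi)
    have hf1 : MemLp f 1 Pi := hf8.mono_exponent (by norm_num)
    have hG1 : MemLp G 1 Pi := hG6.mono_exponent (by norm_num)
    -- With s_N the partial sums, G - TG - f = -(s_{N+1} - G) + T(s_N - G) almost everywhere. Both
    -- terms vanish in L¹, since T is a contraction.
    have hle : ∀ N, eLpNorm (fun x => G x - markovOp K G x - f x) 1 Pi
        ≤ eLpNorm ((fun x => ∑ m ∈ Finset.range (N + 1), u m x) - G) 1 Pi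
          + eLpNorm ((fun x => ∑ m ∈ Finset.range N, u m x) - G) 1 Pi := by
      intro N
      have hsm : ∀ N, Measurable fun x => ∑ m ∈ Finset.range N, u m x := fun N =>
        Finset.measurable_fun_sum _ fun m _ => hum m
      have h1 : (fun x => G x - markovOp K G x - f x) =ᵐ[Pi]
          -((fun x => ∑ m ∈ Finset.range (N + 1), u m x) - G)
            + markovOp K (fun x => ∑ m ∈ Finset.range N, u m x - G x) := by
        filter_upwards [hTs N, markovOp_sub_ae hinv (hsi N) hGi] with x h1 h2
        simp only [_root_.Pi.add_apply, _root_.Pi.neg_apply, _root_.Pi.sub_apply]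
        rw [h2, h1]; ring
      rw [eLpNorm_congr_ae h1]
      refine (eLpNorm_add_le (((hsm _).sub hGm).neg.aestronglyMeasurable)
        (measurable_markovOp ((hsm N).sub hGm)).aestronglyMeasurable le_rfl).trans ?_
      rw [eLpNorm_neg]
      gcongr
      exact eLpNorm_markovOp_le hinv ((hsm N).sub hGm) le_rfl (by simp)
    have hl : Tendsto (fun N => eLpNorm ((fun x => ∑ m ∈ Finset.range (N + 1), u m x) - G) 1 Pi
          + eLpNorm ((fun x => ∑ m ∈ Finset.range N, u m x) - G) 1 Pi) atTop (nhds (0 + 0)) :=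
      ((hlim 1 (by norm_num)).comp (tendsto_add_atTop_nat 1)).add (hlim 1 (by norm_num))
    have h0 : eLpNorm (fun x => G x - markovOp K G x - f x) 1 Pi = 0 := by
      have := ge_of_tendsto' hl hle
      simpa using this
    have := (eLpNorm_eq_zero_iff ((hG1.sub hTG).sub hf1).1 (by simp)).1 h0
    filter_upwards [this] with x hx
    exact sub_eq_zero.1 hx
  · have hG2 : MemLp G 2 Pi := hG6.mono_exponent (by norm_num)
    have hs2 : ∀ N, MemLp (fun x => ∑ m ∈ Finset.range N, u m x) 2 Pi :=
      fun N => (hs6 N).mono_exponent (by norm_num)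
    have hu2 : ∀ m, MemLp (u m) 2 Pi := fun m => (hu6 m).mono_exponent (by norm_num)
    have e : ∀ N, ∑ m ∈ Finset.range N, ∫ x, f x * u m x ∂Pi - ∫ x, f x * G x ∂Pi
        = ∫ x, f x * ((fun x => ∑ m ∈ Finset.range N, u m x) - G) x ∂Pi := by
      intro N
      have i1 : ∀ m, Integrable (fun x => f x * u m x) Pi := fun m => hf2.integrable_mul (hu2 m)
      have i2 : Integrable (fun x => f x * G x) Pi := hf2.integrable_mul hG2
      rw [← integral_finsetSum _ fun m _ => i1 m, ← integral_sub
        (integrable_finsetSum _ fun m _ => i1 m) i2]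
      refine integral_congr_ae (Eventually.of_forall fun x => ?_)
      simp [Finset.mul_sum, mul_sub]
    rw [tendsto_iff_norm_sub_tendsto_zero]
    have hl : Tendsto (fun N => √(∫ x, f x ^ 2 ∂Pi)
        * (eLpNorm ((fun x => ∑ m ∈ Finset.range N, u m x) - G) 2 Pi).toReal) atTop
        (nhds (√(∫ x, f x ^ 2 ∂Pi) * 0)) := by
      refine Tendsto.const_mul _ ?_
      simpa [Function.comp_def] using
        (ENNReal.tendsto_toReal ENNReal.zero_ne_top).comp (hlim 2 (by norm_num))
    rw [mul_zero] at hl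
    refine squeeze_zero (fun _ => norm_nonneg _) (fun N => ?_) hl
    rw [e, Real.norm_eq_abs, ← sqrt_integral_sq_eq_eLpNorm ((hs2 N).sub hG2)]
    exact abs_integral_mul_le_sqrt hf2 ((hs2 N).sub hG2)

end Poisson
/-! ### Variance of sums of weakly correlated variables -/

section Variance

variable {Ω : Type*} {mΩ : MeasurableSpace Ω} {P : Measure Ω} [IsProbabilityMeasure P]

theorem sum_geometric_reverse_le {ρ : ℝ} (h0 : 0 ≤ ρ) (h1 : ρ < 1) (n : ℕ) :
    ∑ i ∈ Finset.range n, ρ ^ (n - i - 1) ≤ (1 - ρ)⁻¹ := by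
  have e : ∑ i ∈ Finset.range n, ρ ^ (n - i - 1) = ∑ i ∈ Finset.range n, ρ ^ i := by
    rw [← Finset.sum_range_reflect]
    refine Finset.sum_congr rfl fun i hi => ?_
    have := Finset.mem_range.1 hi
    congr 1
    omega
  rw [e, ← tsum_geometric_of_lt_one h0 h1]
  exact (summable_geometric_of_lt_one h0 h1).sum_le_tsum _ fun i _ => pow_nonneg h0 i

/-- The exponent is j - i - 1 because the term with index i is known only at time i + 1, so
neighbours enjoy no decay. Geometric summation still bounds the variance linearly in n. It serves
both for the squares d_i² inside a batch and for the errors of different batches. -/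
theorem variance_sum_le {W : ℕ → Ω → ℝ} (hW : ∀ i, MemLp (W i) 2 P) {ρ B : ℝ} (h0 : 0 ≤ ρ)
    (h1 : ρ < 1) (hB : 0 ≤ B) (hvar : ∀ i, Var[W i; P] ≤ B)
    (hcov : ∀ i j, i < j → |cov[W i, W j; P]| ≤ ρ ^ (j - i - 1) * B) (n : ℕ) :
    Var[fun ω => ∑ i ∈ Finset.range n, W i ω; P] ≤ n * (B * (1 + 2 * (1 - ρ)⁻¹)) := by
  induction n with
  | zero => simp [variance_zero, ← _root_.Pi.zero_def]
  | succ n ih =>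
    have hS : MemLp (fun ω => ∑ i ∈ Finset.range n, W i ω) 2 P := memLp_finsetSum _ fun i _ => hW i
    simp_rw [Finset.sum_range_succ]
    rw [variance_fun_add hS (hW n), covariance_fun_sum_left' (fun i _ => hW i) (hW n)]
    have h2 : ∑ i ∈ Finset.range n, cov[W i, W n; P] ≤ (1 - ρ)⁻¹ * B := by
      calc _ ≤ ∑ i ∈ Finset.range n, ρ ^ (n - i - 1) * B :=
            Finset.sum_le_sum fun i hi =>
              (le_abs_self _).trans (hcov i n (Finset.mem_range.1 hi))
        _ = (∑ i ∈ Finset.range n, ρ ^ (n - i - 1)) * B := by rw [Finset.sum_mul]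
        _ ≤ _ := mul_le_mul_of_nonneg_right (sum_geometric_reverse_le h0 h1 n) hB
    have := hvar n
    push_cast
    nlinarith

theorem variance_le_integral_sq {U : Ω → ℝ} (hU : MemLp U 2 P) : Var[U; P] ≤ ∫ ω, U ω ^ 2 ∂P := by
  simpa using variance_le_expectation_sq (μ := P) hU.1

/-- Parallelogram law, with the variance of the difference dropped. -/
theorem variance_add_le {U V : Ω → ℝ} (hU : MemLp U 2 P) (hV : MemLp V 2 P) :
    Var[fun ω => U ω + V ω; P] ≤ 2 * Var[U; P] + 2 * Var[V; P] := by
  have h1 := variance_fun_add hU hV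
  have h2 := variance_fun_sub hU hV
  have h3 := variance_nonneg (fun ω => U ω - V ω) P
  linarith

end Variance

/-! ### Differences with exponentially decaying correlations -/

theorem holderTriple_six_six_three : ENNReal.HolderTriple 6 6 3 := ⟨by
  rw [← ENNReal.toReal_eq_toReal_iff' (by simp) (by simp), ENNReal.toReal_add (by simp) (by simp)]
  norm_num⟩

theorem holderTriple_three_six_two : ENNReal.HolderTriple 3 6 2 := ⟨by
  rw [← ENNReal.toReal_eq_toReal_iff' (by simp) (by simp), ENNReal.toReal_add (by simp) (by simp)]
  norm_num⟩

/-- Martingale differences with respect to the filtration `ℱ`, bounded in `L⁶` and with constant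
variance `s`, such that the correlation between `ℱ n` and `𝒢 (n + k)` is at most `κ ^ k`. -/
structure MixingDifferences {Ω : Type*} {mΩ : MeasurableSpace Ω} (P : Measure Ω)
    (ℱ 𝒢 : ℕ → MeasurableSpace Ω) (κ D s : ℝ) (d : ℕ → Ω → ℝ) : Prop where
  le : ∀ n, ℱ n ≤ mΩ
  mono : Monotone ℱ
  anti : Antitone 𝒢
  past : ∀ i, StronglyMeasurable[ℱ (i + 1)] (d i)
  future : ∀ i, StronglyMeasurable[𝒢 i] (d i)
  memLp : ∀ i, MemLp (d i) 6 P
  six : ∀ i, ∫ ω, d i ω ^ 6 ∂P ≤ D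
  condExp : ∀ i, P[d i|ℱ i] =ᵐ[P] 0
  sq : ∀ i, ∫ ω, d i ω ^ 2 ∂P = s
  nonneg : 0 ≤ κ
  lt_one : κ < 1
  mixing : ∀ (n k : ℕ) {U V : Ω → ℝ}, StronglyMeasurable[ℱ n] U → MemLp U 2 P →
    StronglyMeasurable[𝒢 (n + k)] V → MemLp V 2 P →
      |cov[U, V; P]| ≤ κ ^ k * (√Var[U; P] * √Var[V; P])

/-- The partial sum of `j` terms of `d` from the index `a` on. -/
def partialSum {Ω : Type*} (d : ℕ → Ω → ℝ) (a j : ℕ) (ω : Ω) : ℝ :=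
  ∑ i ∈ Finset.range j, d (a + i) ω

/-- The sum of the products of pairs of distinct terms among `j` terms of `d` from `a` on. -/
def pairSum {Ω : Type*} (d : ℕ → Ω → ℝ) (a j : ℕ) (ω : Ω) : ℝ :=
  ∑ i ∈ Finset.range j, d (a + i) ω * partialSum d a i ω

theorem partialSum_succ {Ω : Type*} (d : ℕ → Ω → ℝ) (a j : ℕ) (ω : Ω) :
    partialSum d a (j + 1) ω = partialSum d a j ω + d (a + j) ω :=
  Finset.sum_range_succ _ _

theorem pairSum_succ {Ω : Type*} (d : ℕ → Ω → ℝ) (a j : ℕ) (ω : Ω) :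
    pairSum d a (j + 1) ω = pairSum d a j ω + d (a + j) ω * partialSum d a j ω :=
  Finset.sum_range_succ _ _

theorem partialSum_sq {Ω : Type*} (d : ℕ → Ω → ℝ) (a j : ℕ) (ω : Ω) :
    partialSum d a j ω ^ 2 = ∑ i ∈ Finset.range j, d (a + i) ω ^ 2 + 2 * pairSum d a j ω := by
  induction j with
  | zero => simp [partialSum, pairSum]
  | succ j ih =>
    rw [partialSum_succ, pairSum_succ, Finset.sum_range_succ]
    linear_combination ih

/-- The term 6 m⁵ d is kept exactly, since its expectation vanishes when d is a martingale
difference; all other mixed terms are absorbed. -/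
theorem add_pow_six_le (m d : ℝ) :
    (m + d) ^ 6 ≤ m ^ 6 + 6 * (m ^ 5 * d) + 39 * (m ^ 4 * d ^ 2 + d ^ 6) := by
  nlinarith [mul_nonneg (sq_nonneg (m*d)) (sq_nonneg (m-d)), sq_nonneg (m*d^2 - d^3),
    sq_nonneg (m^2*d-m*d^2), sq_nonneg (m^2*d-d^3), sq_nonneg (m*d^2), sq_nonneg (d^3),
    sq_nonneg (m^2*d)]

/-- With b the block length, the coefficient 1/b of m⁶ is small enough to be compounded b times. -/
theorem pow_four_mul_sq_le {b : ℝ} (hb : 0 < b) (m d : ℝ) :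
    m ^ 4 * d ^ 2 ≤ m ^ 6 / b + b ^ 2 * d ^ 6 := by
  rcases le_total (b * d ^ 2) (m ^ 2) with h | h
  · have h1 : m ^ 4 * d ^ 2 ≤ m ^ 6 / b := by
      rw [le_div_iff₀ hb]
      have := mul_le_mul_of_nonneg_left h (by positivity : 0 ≤ m ^ 4)
      nlinarith
    have : 0 ≤ b ^ 2 * d ^ 6 := by positivity
    linarith
  · have h1 : m ^ 4 ≤ (b * d ^ 2) ^ 2 := by
      have := pow_le_pow_left₀ (sq_nonneg m) h 2
      nlinarith
    have h2 := mul_le_mul_of_nonneg_right h1 (sq_nonneg d)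
    have : 0 ≤ m ^ 6 / b := by positivity
    nlinarith

namespace MixingDifferences

variable {Ω : Type*} {mΩ : MeasurableSpace Ω} {P : Measure Ω}
  {ℱ 𝒢 : ℕ → MeasurableSpace Ω} {κ D s : ℝ} {d : ℕ → Ω → ℝ}

theorem stronglyMeasurable_partialSum (h : MixingDifferences P ℱ 𝒢 κ D s d) (a j : ℕ) :
    StronglyMeasurable[ℱ (a + j)] (partialSum d a j) := by
  refine Finset.stronglyMeasurable_fun_sum _ fun i hi => ?_
  have := Finset.mem_range.1 hi
  exact (h.past (a + i)).mono (h.mono (by omega))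

theorem stronglyMeasurable_pairSum (h : MixingDifferences P ℱ 𝒢 κ D s d) (a j : ℕ) :
    StronglyMeasurable[ℱ (a + j)] (pairSum d a j) := by
  refine Finset.stronglyMeasurable_fun_sum _ fun i hi => ?_
  have := Finset.mem_range.1 hi
  exact ((h.past (a + i)).mono (h.mono (by omega))).mul
    ((h.stronglyMeasurable_partialSum a i).mono (h.mono (by omega)))

theorem stronglyMeasurable_partialSum_future (h : MixingDifferences P ℱ 𝒢 κ D s d) (a j : ℕ) :
    StronglyMeasurable[𝒢 a] (partialSum d a j) :=
  Finset.stronglyMeasurable_fun_sum _ fun i _ => (h.future (a + i)).mono (h.anti (by omega))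

theorem stronglyMeasurable_pairSum_future (h : MixingDifferences P ℱ 𝒢 κ D s d) (a j : ℕ) :
    StronglyMeasurable[𝒢 a] (pairSum d a j) :=
  Finset.stronglyMeasurable_fun_sum _ fun i _ => ((h.future (a + i)).mono (h.anti (by omega))).mul
    (h.stronglyMeasurable_partialSum_future a i)

theorem memLp_partialSum (h : MixingDifferences P ℱ 𝒢 κ D s d) (a j : ℕ) :
    MemLp (partialSum d a j) 6 P :=
  memLp_finsetSum _ fun i _ => h.memLp (a + i)

theorem memLp_mul_partialSum (h : MixingDifferences P ℱ 𝒢 κ D s d) (k a j : ℕ) :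
    MemLp (fun ω => d k ω * partialSum d a j ω) 3 P :=
  have := holderTriple_six_six_three
  (h.memLp_partialSum a j).mul' (h.memLp k)

theorem memLp_pairSum (h : MixingDifferences P ℱ 𝒢 κ D s d) (a j : ℕ) :
    MemLp (pairSum d a j) 3 P :=
  memLp_finsetSum _ fun i _ => h.memLp_mul_partialSum (a + i) a i

theorem integrable_pow_six (h : MixingDifferences P ℱ 𝒢 κ D s d) (k : ℕ) :
    Integrable (fun ω => d k ω ^ 6) P :=
  integrable_even_pow (n := 6) (by decide) (by norm_num) (by simpa using h.memLp k)

theorem integrable_partialSum_pow_six (h : MixingDifferences P ℱ 𝒢 κ D s d) (a j : ℕ) :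
    Integrable (fun ω => partialSum d a j ω ^ 6) P :=
  integrable_even_pow (n := 6) (by decide) (by norm_num) (by simpa using h.memLp_partialSum a j)

theorem D_nonneg (h : MixingDifferences P ℱ 𝒢 κ D s d) : 0 ≤ D :=
  (integral_nonneg fun ω => by positivity).trans (h.six 0)

variable [IsProbabilityMeasure P]

theorem integral_mul_eq_zero (h : MixingDifferences P ℱ 𝒢 κ D s d) {k : ℕ} {U : Ω → ℝ}
    (hU : StronglyMeasurable[ℱ k] U) (hi : Integrable (fun ω => U ω * d k ω) P) :
    ∫ ω, U ω * d k ω ∂P = 0 := by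
  have h1 := condExp_mul_of_stronglyMeasurable_left hU hi ((h.memLp k).integrable (by norm_num))
  have h2 : ∫ ω, P[U * d k|ℱ k] ω ∂P = ∫ ω, (U * d k) ω ∂P := integral_condExp (h.le k)
  have h3 : ∫ ω, (U * d k) ω ∂P = ∫ ω, U ω * d k ω ∂P := rfl
  rw [← h3, ← h2, integral_congr_ae h1]
  refine integral_eq_zero_of_ae ?_
  filter_upwards [h.condExp k] with ω hω
  simp [hω]

/-- Orthogonality removes the cross term m⁵ d, leaving a linear recursion with growth factor 1 +
39/b and source of order b². -/
theorem integral_partialSum_succ_pow_six_le (h : MixingDifferences P ℱ 𝒢 κ D s d) (a j : ℕ)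
    {b : ℝ} (hb : 1 ≤ b) :
    ∫ ω, partialSum d a (j + 1) ω ^ 6 ∂P
      ≤ (1 + 39 / b) * ∫ ω, partialSum d a j ω ^ 6 ∂P + 78 * b ^ 2 * D := by
  have hb0 : 0 < b := one_pos.trans_le hb
  have im := h.integrable_partialSum_pow_six a j
  have idd := h.integrable_pow_six (a + j)
  have icross : Integrable (fun ω => partialSum d a j ω ^ 5 * d (a + j) ω) P := by
    refine Integrable.mono' (im.fun_add idd) (((h.memLp_partialSum a j).1.pow 5).mul
      (h.memLp (a + j)).1) (Eventually.of_forall fun ω => ?_)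
    rw [Real.norm_eq_abs, abs_mul, abs_pow]
    have e1 : partialSum d a j ω ^ 6 = |partialSum d a j ω| ^ 6 :=
      (Even.pow_abs (by decide) _).symm
    have e2 : d (a + j) ω ^ 6 = |d (a + j) ω| ^ 6 := (Even.pow_abs (by decide) _).symm
    rw [e1, e2]
    set x := |partialSum d a j ω|
    set y := |d (a + j) ω|
    have hx : 0 ≤ x := abs_nonneg _
    have hy : 0 ≤ y := abs_nonneg _
    rcases le_total x y with hxy | hxy
    · have := mul_le_mul_of_nonneg_right (pow_le_pow_left₀ hx hxy 5) hy
      have : 0 ≤ x ^ 6 := by positivity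
      nlinarith
    · have := mul_le_mul_of_nonneg_left hxy (pow_nonneg hx 5)
      have : 0 ≤ y ^ 6 := by positivity
      nlinarith
  have hz : ∫ ω, partialSum d a j ω ^ 5 * d (a + j) ω ∂P = 0 :=
    h.integral_mul_eq_zero ((h.stronglyMeasurable_partialSum a j).pow 5) icross
  have hpt : ∀ ω, partialSum d a (j + 1) ω ^ 6 ≤ (1 + 39 / b) * partialSum d a j ω ^ 6
      + 6 * (partialSum d a j ω ^ 5 * d (a + j) ω) + 78 * b ^ 2 * d (a + j) ω ^ 6 := by
    intro ω
    rw [partialSum_succ]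
    have h1 := add_pow_six_le (partialSum d a j ω) (d (a + j) ω)
    have h2 := pow_four_mul_sq_le hb0 (partialSum d a j ω) (d (a + j) ω)
    have h3 : d (a + j) ω ^ 6 ≤ b ^ 2 * d (a + j) ω ^ 6 := by
      have : 1 ≤ b ^ 2 := one_le_pow₀ hb
      exact le_mul_of_one_le_left (by positivity) this
    have e : (1 + 39 / b) * partialSum d a j ω ^ 6
        = partialSum d a j ω ^ 6 + 39 * (partialSum d a j ω ^ 6 / b) := by ring
    rw [e]
    linarith
  have i1 := im.const_mul (1 + 39 / b)
  have i2 := icross.const_mul 6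
  have i3 := idd.const_mul (78 * b ^ 2)
  calc _ ≤ ∫ ω, ((1 + 39 / b) * partialSum d a j ω ^ 6
      + 6 * (partialSum d a j ω ^ 5 * d (a + j) ω) + 78 * b ^ 2 * d (a + j) ω ^ 6) ∂P :=
        integral_mono (h.integrable_partialSum_pow_six a (j + 1)) ((i1.fun_add i2).fun_add i3) hpt
    _ = (1 + 39 / b) * ∫ ω, partialSum d a j ω ^ 6 ∂P
        + 78 * b ^ 2 * ∫ ω, d (a + j) ω ^ 6 ∂P := by
        rw [integral_add (i1.fun_add i2) i3, integral_add i1 i2, integral_const_mul,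
          integral_const_mul, integral_const_mul, hz]
        ring
    _ ≤ _ := by
        have := h.six (a + j)
        gcongr

/-- The constant in the sixth moment bound. -/
def sixthConst (D : ℝ) : ℝ := 78 * D * Real.exp 39

/-- Sixth moments of partial sums grow like the cube of the number of terms. -/
theorem integral_partialSum_pow_six_le (h : MixingDifferences P ℱ 𝒢 κ D s d) (a : ℕ) {j b : ℕ}
    (hj : j ≤ b) (hb : 1 ≤ b) :
    ∫ ω, partialSum d a j ω ^ 6 ∂P ≤ sixthConst D * b ^ 3 := by
  have hb' : (1 : ℝ) ≤ b := by exact_mod_cast hb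
  have hb0 : (0 : ℝ) < b := one_pos.trans_le hb'
  have hD := h.D_nonneg
  have hq : (0 : ℝ) ≤ 39 / b := by positivity
  -- Discrete Grönwall: at most b sources of order b² give b³, and (1 + 39/b)^b ≤ e^39.
  have key : ∀ j : ℕ, ∫ ω, partialSum d a j ω ^ 6 ∂P
      ≤ 78 * b ^ 2 * D * j * (1 + 39 / (b : ℝ)) ^ j := by
    intro j
    induction j with
    | zero => simp [partialSum]
    | succ j ih =>
      refine (h.integral_partialSum_succ_pow_six_le a j hb').trans ?_
      have h1 : (1 : ℝ) ≤ (1 + 39 / (b : ℝ)) ^ (j + 1) := one_le_pow₀ (by linarith)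
      have hc : 0 ≤ 78 * (b : ℝ) ^ 2 * D := by positivity
      calc _ ≤ (1 + 39 / (b : ℝ)) * (78 * b ^ 2 * D * j * (1 + 39 / (b : ℝ)) ^ j)
            + 78 * b ^ 2 * D * 1 := by rw [mul_one]; gcongr
        _ ≤ (1 + 39 / (b : ℝ)) * (78 * b ^ 2 * D * j * (1 + 39 / (b : ℝ)) ^ j)
            + 78 * b ^ 2 * D * (1 + 39 / (b : ℝ)) ^ (j + 1) := by gcongr
        _ = _ := by push_cast; ring
  have hexp : (1 + 39 / (b : ℝ)) ^ j ≤ Real.exp 39 := by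
    have h1 : (1 + 39 / (b : ℝ)) ≤ Real.exp (39 / b) := by
      have := Real.add_one_le_exp (39 / (b : ℝ)); linarith
    calc (1 + 39 / (b : ℝ)) ^ j ≤ (1 + 39 / (b : ℝ)) ^ b := pow_le_pow_right₀ (by linarith) hj
      _ ≤ Real.exp (39 / b) ^ b := pow_le_pow_left₀ (by positivity) h1 _
      _ = Real.exp 39 := by rw [← Real.exp_nat_mul]; congr 1; field_simp
  have hjb : (j : ℝ) ≤ b := by exact_mod_cast hj
  calc _ ≤ _ := key j
    _ ≤ 78 * b ^ 2 * D * b * Real.exp 39 := by gcongr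
    _ = _ := by rw [sixthConst]; ring

end MixingDifferences
-- Moments of the pair sums in a block
namespace MixingDifferences

variable {Ω : Type*} {mΩ : MeasurableSpace Ω} {P : Measure Ω}
  {ℱ 𝒢 : ℕ → MeasurableSpace Ω} {κ D s : ℝ} {d : ℕ → Ω → ℝ}

theorem sixthConst_nonneg (h : MixingDifferences P ℱ 𝒢 κ D s d) : 0 ≤ sixthConst D := by
  have := h.D_nonneg
  rw [sixthConst]; positivity

theorem integrable_pairSum_cube (h : MixingDifferences P ℱ 𝒢 κ D s d) (c : ℝ) (a j : ℕ) :
    Integrable (fun ω => |c * pairSum d a j ω| ^ 3) P := by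
  have h3 : MemLp (fun ω => c * pairSum d a j ω) (3 : ℕ) P := by
    simpa using (h.memLp_pairSum a j).const_mul c
  simpa only [Real.norm_eq_abs] using h3.integrable_norm_pow (by norm_num)

variable [IsProbabilityMeasure P]

theorem pow_four_le_one_add (x : ℝ) : x ^ 4 ≤ 1 + x ^ 6 := by
  rcases le_total (x ^ 2) 1 with h | h
  · have : x ^ 4 ≤ 1 := by nlinarith [sq_nonneg x]
    have : 0 ≤ x ^ 6 := by positivity
    linarith
  · have := mul_le_mul_of_nonneg_left h (by positivity : 0 ≤ x ^ 4)
    nlinarith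

theorem pow_four_le_of_pos {b : ℝ} (hb : 0 < b) (x : ℝ) : x ^ 4 ≤ b ^ 2 + x ^ 6 / b := by
  rcases le_total (x ^ 2) b with h | h
  · have h1 : x ^ 4 ≤ b ^ 2 := by nlinarith [sq_nonneg x]
    have : 0 ≤ x ^ 6 / b := by positivity
    linarith
  · have h1 := mul_le_mul_of_nonneg_left h (by positivity : 0 ≤ x ^ 4)
    have h2 : x ^ 4 ≤ x ^ 6 / b := by rw [le_div_iff₀ hb]; nlinarith
    have : 0 ≤ b ^ 2 := by positivity
    linarith

theorem integrable_sq_mul_sq {U V : Ω → ℝ} (hU : MemLp U 6 P) (hV : MemLp V 6 P) :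
    MemLp (fun ω => U ω * V ω) 2 P := by
  have := holderTriple_six_six_three
  exact (hV.mul' (r := 3) hU).mono_exponent (by norm_num)

theorem memLp_sq_two {U : Ω → ℝ} (hU : MemLp U 6 P) : MemLp (fun ω => U ω ^ 2) 2 P := by
  simpa only [pow_two] using integrable_sq_mul_sq hU hU

theorem integrable_pow_four {U : Ω → ℝ} (hU : MemLp U 6 P) :
    Integrable (fun ω => U ω ^ 4) P := by
  have := (memLp_sq_two hU).integrable_sq
  simpa only [← pow_mul] using this

theorem integral_pow_four_le (h : MixingDifferences P ℱ 𝒢 κ D s d) (k : ℕ) :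
    ∫ ω, d k ω ^ 4 ∂P ≤ 1 + D := by
  calc _ ≤ ∫ ω, (1 + d k ω ^ 6) ∂P :=
        integral_mono (integrable_pow_four (h.memLp k))
          ((integrable_const _).fun_add (h.integrable_pow_six k)) fun ω => pow_four_le_one_add _
    _ = 1 + ∫ ω, d k ω ^ 6 ∂P := by
        rw [integral_add (integrable_const _) (h.integrable_pow_six k)]; simp
    _ ≤ _ := by linarith [h.six k]

theorem integral_partialSum_pow_four_le (h : MixingDifferences P ℱ 𝒢 κ D s d) (a : ℕ) {j b : ℕ}
    (hj : j ≤ b) (hb : 1 ≤ b) :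
    ∫ ω, partialSum d a j ω ^ 4 ∂P ≤ (1 + sixthConst D) * b ^ 2 := by
  have hb' : (1 : ℝ) ≤ b := by exact_mod_cast hb
  have hb0 : (0 : ℝ) < b := one_pos.trans_le hb'
  have i6 := (h.integrable_partialSum_pow_six a j).div_const (b : ℝ)
  calc _ ≤ ∫ ω, ((b : ℝ) ^ 2 + partialSum d a j ω ^ 6 / b) ∂P :=
        integral_mono (integrable_pow_four (h.memLp_partialSum a j))
          ((integrable_const _).fun_add i6) fun ω => pow_four_le_of_pos hb0 _
    _ = (b : ℝ) ^ 2 + (∫ ω, partialSum d a j ω ^ 6 ∂P) / b := by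
        rw [integral_add (integrable_const _) i6, integral_div]; simp
    _ ≤ (b : ℝ) ^ 2 + sixthConst D * b ^ 3 / b := by
        gcongr; exact h.integral_partialSum_pow_six_le a hj hb
    _ = _ := by field_simp

theorem integral_partialSum_sq (h : MixingDifferences P ℱ 𝒢 κ D s d) (a j : ℕ) :
    ∫ ω, partialSum d a j ω ^ 2 ∂P = s * j := by
  induction j with
  | zero => simp [partialSum]
  | succ j ih =>
    have hm2 : MemLp (partialSum d a j) 2 P := (h.memLp_partialSum a j).mono_exponent (by norm_num)
    have hd2 : MemLp (d (a + j)) 2 P := (h.memLp (a + j)).mono_exponent (by norm_num)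
    have hi : Integrable (fun ω => partialSum d a j ω * d (a + j) ω) P := hm2.integrable_mul hd2
    have hz := h.integral_mul_eq_zero (h.stronglyMeasurable_partialSum a j) hi
    have e : ∀ ω, partialSum d a (j + 1) ω ^ 2 = partialSum d a j ω ^ 2
        + 2 * (partialSum d a j ω * d (a + j) ω) + d (a + j) ω ^ 2 := fun ω => by
      rw [partialSum_succ]; ring
    simp_rw [e]
    rw [integral_add (hm2.integrable_sq.fun_add (hi.const_mul 2)) hd2.integrable_sq,
      integral_add hm2.integrable_sq (hi.const_mul 2), integral_const_mul, hz, ih, h.sq]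
    push_cast; ring

/-- The summands d_j M_j are again martingale differences, so the cross terms vanish. Integrability
of pairSum · M · d uses the exponents 3, 6 and 2. -/
theorem integral_pairSum_sq (h : MixingDifferences P ℱ 𝒢 κ D s d) (a j : ℕ) :
    ∫ ω, pairSum d a j ω ^ 2 ∂P
      = ∑ i ∈ Finset.range j, ∫ ω, (d (a + i) ω * partialSum d a i ω) ^ 2 ∂P := by
  induction j with
  | zero => simp [pairSum]
  | succ j ih =>
    have := holderTriple_three_six_two
    have hq2 : MemLp (pairSum d a j) 2 P := (h.memLp_pairSum a j).mono_exponent (by norm_num)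
    have hd2 : MemLp (d (a + j)) 2 P := (h.memLp (a + j)).mono_exponent (by norm_num)
    have hdm : MemLp (fun ω => d (a + j) ω * partialSum d a j ω) 2 P :=
      (h.memLp_mul_partialSum (a + j) a j).mono_exponent (by norm_num)
    have hqm : MemLp (fun ω => pairSum d a j ω * partialSum d a j ω) 2 P :=
      (h.memLp_partialSum a j).mul' (h.memLp_pairSum a j)
    have hi : Integrable (fun ω => pairSum d a j ω * partialSum d a j ω * d (a + j) ω) P :=
      hqm.integrable_mul hd2
    have hz := h.integral_mul_eq_zero
      ((h.stronglyMeasurable_pairSum a j).mul (h.stronglyMeasurable_partialSum a j)) hi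
    simp only [_root_.Pi.mul_apply] at hz
    have e : ∀ ω, pairSum d a (j + 1) ω ^ 2 = pairSum d a j ω ^ 2
        + 2 * (pairSum d a j ω * partialSum d a j ω * d (a + j) ω)
        + (d (a + j) ω * partialSum d a j ω) ^ 2 := fun ω => by
      rw [pairSum_succ]; ring
    simp_rw [e]
    rw [integral_add (hq2.integrable_sq.fun_add (hi.const_mul 2)) hdm.integrable_sq,
      integral_add hq2.integrable_sq (hi.const_mul 2), integral_const_mul, hz, ih,
      Finset.sum_range_succ]
    ring

theorem memLp_increment (h : MixingDifferences P ℱ 𝒢 κ D s d) (a j : ℕ) :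
    MemLp (fun ω => 2 * (d (a + j) ω * partialSum d a j ω) + d (a + j) ω ^ 2) 2 P :=
  ((integrable_sq_mul_sq (h.memLp (a + j)) (h.memLp_partialSum a j)).const_mul 2).add
    (memLp_sq_two (h.memLp (a + j)))

/-- The integrand is the squared increment of M² at step j. Weighting d⁴ by b and M⁴ by 1/b gives
order b, since E M⁴ = O(b²). -/
theorem integral_increment_sq_le (h : MixingDifferences P ℱ 𝒢 κ D s d) (a : ℕ) {j b : ℕ}
    (hj : j ≤ b) (hb : 1 ≤ b) :
    ∫ ω, (2 * (d (a + j) ω * partialSum d a j ω) + d (a + j) ω ^ 2) ^ 2 ∂P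
      ≤ (6 * (1 + D) + 4 * (1 + sixthConst D)) * b := by
  have hb' : (1 : ℝ) ≤ b := by exact_mod_cast hb
  have hb0 : (0 : ℝ) < b := one_pos.trans_le hb'
  have i1 := (integrable_pow_four (h.memLp (a + j))).const_mul (6 * (b : ℝ))
  have i2 := (integrable_pow_four (h.memLp_partialSum a j)).const_mul (4 / (b : ℝ))
  have hpt : ∀ ω, (2 * (d (a + j) ω * partialSum d a j ω) + d (a + j) ω ^ 2) ^ 2
      ≤ 6 * (b : ℝ) * d (a + j) ω ^ 4 + 4 / (b : ℝ) * partialSum d a j ω ^ 4 := by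
    intro ω
    set x := d (a + j) ω
    set m := partialSum d a j ω
    have h1 : (2 * (x * m) + x ^ 2) ^ 2 ≤ 8 * (x ^ 2 * m ^ 2) + 2 * x ^ 4 := by
      nlinarith [sq_nonneg (2 * (x * m) - x ^ 2)]
    have h2 : 2 * (x ^ 2 * m ^ 2) ≤ b * x ^ 4 + m ^ 4 / b := by
      have h3 : 0 ≤ (b * x ^ 2 - m ^ 2) ^ 2 / b := by positivity
      have h4 : (b * x ^ 2 - m ^ 2) ^ 2 / b = b * x ^ 4 - 2 * (x ^ 2 * m ^ 2) + m ^ 4 / b := by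
        field_simp
        ring
      linarith
    have h3 : x ^ 4 ≤ b * x ^ 4 := le_mul_of_one_le_left (by positivity) hb'
    have e : 4 / (b : ℝ) * m ^ 4 = 4 * (m ^ 4 / b) := by ring
    rw [e]
    linarith
  calc _ ≤ ∫ ω, (6 * (b : ℝ) * d (a + j) ω ^ 4 + 4 / (b : ℝ) * partialSum d a j ω ^ 4) ∂P :=
        integral_mono (h.memLp_increment a j).integrable_sq (i1.fun_add i2) hpt
    _ = 6 * (b : ℝ) * ∫ ω, d (a + j) ω ^ 4 ∂P
        + 4 / (b : ℝ) * ∫ ω, partialSum d a j ω ^ 4 ∂P := by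
        rw [integral_add i1 i2, integral_const_mul, integral_const_mul]
    _ ≤ 6 * (b : ℝ) * (1 + D) + 4 / (b : ℝ) * ((1 + sixthConst D) * b ^ 2) := by
        have := h.integral_pow_four_le (a + j)
        have := h.integral_partialSum_pow_four_le a hj hb
        gcongr
    _ = _ := by field_simp; try ring

theorem partialSum_sq_eq_sum (d : ℕ → Ω → ℝ) (a j : ℕ) (ω : Ω) :
    partialSum d a j ω ^ 2
      = ∑ i ∈ Finset.range j, (2 * (d (a + i) ω * partialSum d a i ω) + d (a + i) ω ^ 2) := by
  rw [partialSum_sq, pairSum, Finset.sum_add_distrib, Finset.mul_sum]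
  ring

/-- Cauchy–Schwarz on M_j² directly would give order b, as large as the main term. Instead M_j² is a
sum of increments of L² size O(√b), the i-th being j - i - 1 steps away from d_j, and the geometric
sum of their covariances stays O(√b). -/
theorem abs_covariance_partialSum_sq_le (h : MixingDifferences P ℱ 𝒢 κ D s d) (a : ℕ) {j b : ℕ}
    (hj : j ≤ b) (hb : 1 ≤ b) :
    |cov[fun ω => partialSum d a j ω ^ 2, fun ω => d (a + j) ω ^ 2; P]|
      ≤ (1 - κ)⁻¹ * (√((6 * (1 + D) + 4 * (1 + sixthConst D)) * b) * √(1 + D)) := by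
  set B := √((6 * (1 + D) + 4 * (1 + sixthConst D)) * b) * √(1 + D)
  simp_rw [partialSum_sq_eq_sum d a j]
  have hV : MemLp (fun ω => d (a + j) ω ^ 2) 2 P := memLp_sq_two (h.memLp (a + j))
  rw [covariance_fun_sum_left' (fun i _ => h.memLp_increment a i) hV]
  refine (Finset.abs_sum_le_sum_abs _ _).trans ?_
  calc _ ≤ ∑ i ∈ Finset.range j, κ ^ (j - i - 1) * B := by
        refine Finset.sum_le_sum fun i hi => ?_
        have hij := Finset.mem_range.1 hi
        have hmU : StronglyMeasurable[ℱ (a + i + 1)]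
            (fun ω => 2 * (d (a + i) ω * partialSum d a i ω) + d (a + i) ω ^ 2) :=
          ((stronglyMeasurable_const.mul ((h.past (a + i)).mul
            ((h.stronglyMeasurable_partialSum a i).mono (h.mono (by omega))))).add
              ((h.past (a + i)).pow 2))
        have hmV : StronglyMeasurable[𝒢 (a + i + 1 + (j - i - 1))] (fun ω => d (a + j) ω ^ 2) := by
          rw [show a + i + 1 + (j - i - 1) = a + j by omega]
          exact (h.future (a + j)).pow 2
        refine (h.mixing (a + i + 1) (j - i - 1) hmU (h.memLp_increment a i) hmV hV).trans ?_
        refine mul_le_mul_of_nonneg_left ?_ (pow_nonneg h.nonneg _)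
        refine mul_le_mul (Real.sqrt_le_sqrt ?_) (Real.sqrt_le_sqrt ?_) (Real.sqrt_nonneg _)
          (Real.sqrt_nonneg _)
        · exact (variance_le_integral_sq (h.memLp_increment a i)).trans
            (h.integral_increment_sq_le a (by omega) hb)
        · refine (variance_le_integral_sq hV).trans ?_
          simpa only [← pow_mul] using h.integral_pow_four_le (a + j)
    _ = (∑ i ∈ Finset.range j, κ ^ (j - i - 1)) * B := by rw [Finset.sum_mul]
    _ ≤ _ := mul_le_mul_of_nonneg_right (sum_geometric_reverse_le h.nonneg h.lt_one j)
        (by positivity)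

/-- E(d_j² M_j²) is the product E d_j² · E M_j² = s · s j plus the covariance just bounded. -/
theorem exists_abs_integral_mul_partialSum_sq_sub_le (h : MixingDifferences P ℱ 𝒢 κ D s d) :
    ∃ C, 0 ≤ C ∧ ∀ a j b : ℕ, j ≤ b → 1 ≤ b →
      |∫ ω, (d (a + j) ω * partialSum d a j ω) ^ 2 ∂P - s ^ 2 * j| ≤ C * √b := by
  have hκ : 0 < 1 - κ := sub_pos.2 h.lt_one
  refine ⟨(1 - κ)⁻¹ * (√(6 * (1 + D) + 4 * (1 + sixthConst D)) * √(1 + D)), by positivity,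
    fun a j b hj hb => ?_⟩
  have h1 := h.abs_covariance_partialSum_sq_le a hj hb
  have h0 : 0 ≤ 6 * (1 + D) + 4 * (1 + sixthConst D) := by
    have := h.D_nonneg; have := h.sixthConst_nonneg; positivity
  rw [covariance_eq_sub (memLp_sq_two (h.memLp_partialSum a j)) (memLp_sq_two (h.memLp (a + j))),
    h.integral_partialSum_sq, h.sq, Real.sqrt_mul h0] at h1
  have e : ∫ ω, (d (a + j) ω * partialSum d a j ω) ^ 2 ∂P
      = ∫ ω, ((fun ω => partialSum d a j ω ^ 2) * fun ω => d (a + j) ω ^ 2) ω ∂P :=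
    integral_congr_ae (Eventually.of_forall fun ω => by simp only [_root_.Pi.mul_apply]; ring)
  rw [e]
  calc _ = |∫ ω, ((fun ω => partialSum d a j ω ^ 2) * fun ω => d (a + j) ω ^ 2) ω ∂P
        - s * j * s| := by ring_nf
    _ ≤ _ := h1
    _ = _ := by ring

/-- The second moment of the normalised pair sum over a block of length `b` tends to `2 s²`. -/
theorem exists_abs_integral_pairSum_sq_sub_le (h : MixingDifferences P ℱ 𝒢 κ D s d) :
    ∃ C, 0 ≤ C ∧ ∀ a b : ℕ, 1 ≤ b →
      |∫ ω, (2 / b * pairSum d a b ω) ^ 2 ∂P - 2 * s ^ 2| ≤ C / √b := by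
  obtain ⟨C, hC0, hC⟩ := h.exists_abs_integral_mul_partialSum_sq_sub_le
  refine ⟨4 * C + 2 * s ^ 2, by positivity, fun a b hb => ?_⟩
  have hb' : (1 : ℝ) ≤ b := by exact_mod_cast hb
  have hb0 : (0 : ℝ) < b := one_pos.trans_le hb'
  have hsb : 0 < √(b : ℝ) := Real.sqrt_pos.2 hb0
  have hsb2 : √(b : ℝ) * √b = b := Real.mul_self_sqrt hb0.le
  have hsb1 : √(b : ℝ) ≤ b := by
    have : 1 ≤ √(b : ℝ) := Real.one_le_sqrt.2 hb'
    nlinarith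
  have hgauss : ∑ i ∈ Finset.range b, s ^ 2 * (i : ℝ) = s ^ 2 * (b * (b - 1) / 2) := by
    rw [← Finset.mul_sum]
    congr 1
    have : ∀ n : ℕ, ∑ i ∈ Finset.range n, (i : ℝ) = n * (n - 1) / 2 := by
      intro n
      induction n with
      | zero => simp
      | succ n ih => rw [Finset.sum_range_succ, ih]; push_cast; ring
    exact this b
  have h1 : |∑ i ∈ Finset.range b, ∫ ω, (d (a + i) ω * partialSum d a i ω) ^ 2 ∂P
      - s ^ 2 * (b * (b - 1) / 2)| ≤ b * (C * √b) := by
    rw [← hgauss, ← Finset.sum_sub_distrib]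
    refine (Finset.abs_sum_le_sum_abs _ _).trans ?_
    refine (Finset.sum_le_sum fun i hi => hC a i b (Finset.mem_range.1 hi).le hb).trans ?_
    simp
  simp_rw [mul_pow]
  rw [integral_const_mul, h.integral_pairSum_sq]
  set T := ∑ i ∈ Finset.range b, ∫ ω, (d (a + i) ω * partialSum d a i ω) ^ 2 ∂P
  -- The main term s² b(b-1)/2, multiplied by 4/b², is 2s² - 2s²/b. The b errors of size C√b
  -- contribute at most 4C/√b.
  have e : (2 / (b : ℝ)) ^ 2 * T - 2 * s ^ 2
      = (4 / (b : ℝ) ^ 2) * (T - s ^ 2 * (b * (b - 1) / 2)) - 2 * s ^ 2 / b := by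
    field_simp; ring
  rw [e]
  refine (abs_sub _ _).trans ?_
  rw [abs_mul, abs_of_nonneg (by positivity : 0 ≤ 4 / (b : ℝ) ^ 2),
    abs_of_nonneg (by positivity : 0 ≤ 2 * s ^ 2 / (b : ℝ))]
  have h2 : 4 / (b : ℝ) ^ 2 * |T - s ^ 2 * (b * (b - 1) / 2)| ≤ 4 * C / √b := by
    calc _ ≤ 4 / (b : ℝ) ^ 2 * (b * (C * √b)) := by gcongr
      _ = 4 * C * √b / b := by field_simp
      _ = 4 * C * √b / (√b * √b) := by rw [hsb2]
      _ = _ := by field_simp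
  have h3 : 2 * s ^ 2 / (b : ℝ) ≤ 2 * s ^ 2 / √b := by gcongr
  calc _ ≤ 4 * C / √b + 2 * s ^ 2 / √b := add_le_add h2 h3
    _ = _ := by ring

/-- The third absolute moment of the normalised pair sum over a block is bounded. -/
theorem exists_integral_pairSum_cube_le (h : MixingDifferences P ℱ 𝒢 κ D s d) :
    ∃ C, 0 ≤ C ∧ ∀ a b : ℕ, 1 ≤ b → ∫ ω, |2 / b * pairSum d a b ω| ^ 3 ∂P ≤ C := by
  have hD := h.D_nonneg
  have h6 := h.sixthConst_nonneg
  refine ⟨4 * sixthConst D + 4 * D, by positivity, fun a b hb => ?_⟩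
  have hb' : (1 : ℝ) ≤ b := by exact_mod_cast hb
  have hb0 : (0 : ℝ) < b := one_pos.trans_le hb'
  -- Twice the pair sum is M² - V, with V the sum of the squares. The cube of M² is handled by E M⁶
  -- = O(b³), and V³ by the power mean inequality V³ ≤ b² ∑ d⁶.
  have hpt : ∀ ω, |2 / b * pairSum d a b ω| ^ 3 ≤ 4 / (b : ℝ) ^ 3 * partialSum d a b ω ^ 6
      + 4 / (b : ℝ) * ∑ i ∈ Finset.range b, d (a + i) ω ^ 6 := by
    intro ω
    set M := partialSum d a b ω
    set V := ∑ i ∈ Finset.range b, d (a + i) ω ^ 2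
    have hV : 0 ≤ V := Finset.sum_nonneg fun i _ => sq_nonneg _
    have e : 2 / b * pairSum d a b ω = (M ^ 2 - V) / b := by
      have := partialSum_sq d a b ω
      rw [show M ^ 2 - V = 2 * pairSum d a b ω by linarith]; ring
    have hcube : V ^ 3 / (b : ℝ) ^ 2 ≤ ∑ i ∈ Finset.range b, d (a + i) ω ^ 6 := by
      have := pow_sum_div_card_le_sum_pow (s := Finset.range b) (f := fun i => d (a + i) ω ^ 2)
        (fun i _ => sq_nonneg _) 2
      simpa only [Finset.card_range, ← pow_mul] using this
    have habs : |M ^ 2 - V| ≤ M ^ 2 + V := by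
      rw [abs_le]; constructor <;> nlinarith [sq_nonneg M]
    have h4 : (M ^ 2 + V) ^ 3 ≤ 4 * M ^ 6 + 4 * V ^ 3 := by
      have hM : 0 ≤ M ^ 2 := sq_nonneg M
      nlinarith [mul_nonneg (add_nonneg hM hV) (sq_nonneg (M ^ 2 - V))]
    rw [e, abs_div, abs_of_pos hb0, div_pow]
    calc |M ^ 2 - V| ^ 3 / (b : ℝ) ^ 3 ≤ (4 * M ^ 6 + 4 * V ^ 3) / (b : ℝ) ^ 3 := by
          gcongr
          exact (pow_le_pow_left₀ (abs_nonneg _) habs 3).trans h4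
      _ = 4 / (b : ℝ) ^ 3 * M ^ 6 + 4 / (b : ℝ) * (V ^ 3 / (b : ℝ) ^ 2) := by
          field_simp
      _ ≤ _ := by gcongr
  have i1 := (h.integrable_partialSum_pow_six a b).const_mul (4 / (b : ℝ) ^ 3)
  have i2 := (integrable_finsetSum (Finset.range b) fun i _ =>
    h.integrable_pow_six (a + i)).const_mul (4 / (b : ℝ))
  calc _ ≤ _ := integral_mono (h.integrable_pairSum_cube _ a b) (i1.fun_add i2) hpt
    _ = 4 / (b : ℝ) ^ 3 * ∫ ω, partialSum d a b ω ^ 6 ∂P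
        + 4 / (b : ℝ) * ∑ i ∈ Finset.range b, ∫ ω, d (a + i) ω ^ 6 ∂P := by
        rw [integral_add i1 i2, integral_const_mul, integral_const_mul,
          integral_finsetSum _ fun i _ => h.integrable_pow_six (a + i)]
    _ ≤ 4 / (b : ℝ) ^ 3 * (sixthConst D * b ^ 3) + 4 / (b : ℝ) * (b * D) := by
        have h1 := h.integral_partialSum_pow_six_le a le_rfl hb
        have h2 : ∑ i ∈ Finset.range b, ∫ ω, d (a + i) ω ^ 6 ∂P ≤ b * D := by
          refine (Finset.sum_le_sum fun i _ => h.six (a + i)).trans ?_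
          simp
        gcongr
    _ = _ := by field_simp

/-- The normalised pair sum is a martingale difference for the block filtration. -/
theorem integral_mul_pairSum_eq_zero (h : MixingDifferences P ℱ 𝒢 κ D s d) (c : ℝ) (a b : ℕ)
    {U : Ω → ℝ} (hU : StronglyMeasurable[ℱ a] U) {B : ℝ} (hB : ∀ ω, |U ω| ≤ B) :
    ∫ ω, U ω * (c * pairSum d a b ω) ∂P = 0 := by
  have hUm : AEStronglyMeasurable U P := (hU.mono (h.le a)).aestronglyMeasurable
  have hi : ∀ i, Integrable (fun ω => U ω * partialSum d a i ω * d (a + i) ω) P := by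
    intro i
    have h1 : Integrable (fun ω => partialSum d a i ω * d (a + i) ω) P :=
      (integrable_sq_mul_sq (h.memLp_partialSum a i) (h.memLp (a + i))).integrable (by norm_num)
    have := h1.bdd_mul hUm (Eventually.of_forall hB)
    simpa only [mul_assoc] using this
  have e : ∀ ω, U ω * (c * pairSum d a b ω)
      = c * ∑ i ∈ Finset.range b, U ω * partialSum d a i ω * d (a + i) ω := by
    intro ω
    rw [pairSum, mul_left_comm, Finset.mul_sum]
    congr 1
    exact Finset.sum_congr rfl fun i _ => by ring
  simp_rw [e]
  rw [integral_const_mul, integral_finsetSum _ fun i _ => hi i]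
  refine mul_eq_zero_of_right _ (Finset.sum_eq_zero fun i _ => ?_)
  exact h.integral_mul_eq_zero ((hU.mono (h.mono (by omega))).mul
    (h.stronglyMeasurable_partialSum a i)) (hi i)

/-- The average of the squared differences over a block has variance of order `1 / b`. -/
theorem variance_sum_sq_le (h : MixingDifferences P ℱ 𝒢 κ D s d) (a b : ℕ) :
    Var[fun ω => ∑ i ∈ Finset.range b, d (a + i) ω ^ 2; P]
      ≤ b * ((1 + D) * (1 + 2 * (1 - κ)⁻¹)) := by
  have hD := h.D_nonneg
  have hvar : ∀ i, Var[fun ω => d (a + i) ω ^ 2; P] ≤ 1 + D := fun i => by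
    refine (variance_le_integral_sq (memLp_sq_two (h.memLp (a + i)))).trans ?_
    simpa only [← pow_mul] using h.integral_pow_four_le (a + i)
  refine variance_sum_le (W := fun i ω => d (a + i) ω ^ 2)
    (fun i => memLp_sq_two (h.memLp (a + i))) h.nonneg h.lt_one (by positivity) hvar
    (fun i j hij => ?_) b
  have hmV : StronglyMeasurable[𝒢 (a + i + 1 + (j - i - 1))] (fun ω => d (a + j) ω ^ 2) := by
    rw [show a + i + 1 + (j - i - 1) = a + j by omega]
    exact (h.future (a + j)).pow 2
  refine (h.mixing (a + i + 1) (j - i - 1) ((h.past (a + i)).pow 2)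
    (memLp_sq_two (h.memLp (a + i))) hmV (memLp_sq_two (h.memLp (a + j)))).trans ?_
  refine mul_le_mul_of_nonneg_left ?_ (pow_nonneg h.nonneg _)
  calc _ ≤ √(1 + D) * √(1 + D) := mul_le_mul (Real.sqrt_le_sqrt (hvar i))
        (Real.sqrt_le_sqrt (hvar j)) (Real.sqrt_nonneg _) (Real.sqrt_nonneg _)
    _ = _ := Real.mul_self_sqrt (by positivity)

end MixingDifferences
/-! ### A central limit theorem for mixing martingale difference arrays -/

theorem norm_cexp_sub_taylor_le (x : ℝ) :
    ‖Complex.exp (x * Complex.I) - (1 + x * Complex.I - (x : ℂ) ^ 2 / 2)‖ ≤ 5 * |x| ^ 3 := by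
  rcases le_total |x| 1 with h | h
  · have hn : ‖(x : ℂ) * Complex.I‖ = |x| := by simp
    have h1 := Complex.exp_bound (x := x * Complex.I) (by rwa [hn]) (n := 3) (by norm_num)
    rw [hn] at h1
    have e : ∑ m ∈ Finset.range 3, ((x : ℂ) * Complex.I) ^ m / (m.factorial : ℂ)
        = 1 + x * Complex.I - (x : ℂ) ^ 2 / 2 := by
      simp only [Finset.sum_range_succ, Finset.sum_range_zero, Nat.factorial, mul_pow,
        Complex.I_sq]
      push_cast
      ring
    rw [e] at h1
    refine h1.trans ?_
    have : 0 ≤ |x| ^ 3 := by positivity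
    norm_num [Nat.factorial]
    nlinarith
  · have h1 : ‖Complex.exp (x * Complex.I) - (1 + x * Complex.I - (x : ℂ) ^ 2 / 2)‖
        ≤ 1 + (1 + |x| + |x| ^ 2 / 2) := by
      refine (norm_sub_le _ _).trans (add_le_add (Complex.norm_exp_ofReal_mul_I x).le ?_)
      refine (norm_sub_le _ _).trans (add_le_add ((norm_add_le _ _).trans ?_) ?_)
      · simp
      · simp
    have h2 : 1 ≤ |x| ^ 2 := one_le_pow₀ h
    nlinarith

section OneStep

variable {Ω : Type*} {mΩ : MeasurableSpace Ω} {P : Measure Ω}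

theorem aestronglyMeasurable_cexp {θ : Ω → ℝ} (hθ : Measurable θ) :
    AEStronglyMeasurable (fun ω => Complex.exp (θ ω * Complex.I)) P := by
  have : Measurable fun ω => Complex.exp (θ ω * Complex.I) := by fun_prop
  exact this.aestronglyMeasurable

theorem integrable_cexp_mul {θ : Ω → ℝ} (hθ : Measurable θ) {z : Ω → ℂ} (hz : Integrable z P) :
    Integrable (fun ω => Complex.exp (θ ω * Complex.I) * z ω) P :=
  hz.bdd_mul (c := 1) (aestronglyMeasurable_cexp hθ)
    (Eventually.of_forall fun _ => (Complex.norm_exp_ofReal_mul_I _).le)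

/-- Martingale and mixing hypotheses concern real bounded test variables; they apply to the complex
phase through its cosine and sine. -/
theorem integral_cexp_mul_ofReal {θ : Ω → ℝ} (hθ : Measurable θ) {z : Ω → ℝ}
    (hz : Integrable z P) :
    ∫ ω, Complex.exp (θ ω * Complex.I) * (z ω : ℂ) ∂P
      = ((∫ ω, Real.cos (θ ω) * z ω ∂P : ℝ) : ℂ)
        + ((∫ ω, Real.sin (θ ω) * z ω ∂P : ℝ) : ℂ) * Complex.I := by
  have hc : Integrable (fun ω => Real.cos (θ ω) * z ω) P :=
    hz.bdd_mul (c := 1) (by fun_prop) (Eventually.of_forall fun ω => Real.abs_cos_le_one _)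
  have hs : Integrable (fun ω => Real.sin (θ ω) * z ω) P :=
    hz.bdd_mul (c := 1) (by fun_prop) (Eventually.of_forall fun ω => Real.abs_sin_le_one _)
  rw [← integral_complex_ofReal, ← integral_complex_ofReal, ← integral_mul_const,
    ← integral_add hc.ofReal (hs.ofReal.mul_const _)]
  refine integral_congr_ae (Eventually.of_forall fun ω => ?_)
  simp only [Complex.exp_mul_I, Complex.ofReal_mul, Complex.ofReal_cos, Complex.ofReal_sin]
  ring

theorem integrable_abs_cube {Z : Ω → ℝ} (hZ : MemLp Z 3 P) : Integrable (fun ω => |Z ω| ^ 3) P := by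
  have : MemLp Z (3 : ℕ) P := by simpa using hZ
  simpa only [Real.norm_eq_abs] using this.integrable_norm_pow (by norm_num)

theorem norm_cexp_sub_le (x y : ℝ) :
    ‖Complex.exp ((x + y : ℝ) * Complex.I) - Complex.exp (x * Complex.I)‖ ≤ |y| := by
  have e : Complex.exp ((x + y : ℝ) * Complex.I) - Complex.exp (x * Complex.I)
      = Complex.exp (x * Complex.I) * (Complex.exp (Complex.I * y) - 1) := by
    rw [mul_sub, ← Complex.exp_add, mul_one]
    congr 2
    push_cast
    ring
  rw [e, norm_mul, Complex.norm_exp_ofReal_mul_I, one_mul]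
  exact Real.norm_exp_I_mul_ofReal_sub_one_le

theorem abs_mul_sq_le (x y : ℝ) : |x| * y ^ 2 ≤ |x| ^ 3 + |y| ^ 3 := by
  rw [← sq_abs y]
  have hx := abs_nonneg x
  have hy := abs_nonneg y
  rcases le_total |x| |y| with h | h
  · have := mul_le_mul_of_nonneg_right h (sq_nonneg |y|)
    have : 0 ≤ |x| ^ 3 := by positivity
    nlinarith
  · have := mul_le_mul_of_nonneg_left (pow_le_pow_left₀ hy h 2) hx
    have : 0 ≤ |y| ^ 3 := by positivity
    nlinarith

theorem abs_le_one_add_cube (x : ℝ) : |x| ≤ 1 + |x| ^ 3 := by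
  have hx := abs_nonneg x
  rcases le_total |x| 1 with h | h
  · have : 0 ≤ |x| ^ 3 := by positivity
    linarith
  · have : 1 ≤ |x| ^ 2 := one_le_pow₀ h
    nlinarith

variable [IsProbabilityMeasure P]

/-- Y is the summand just before Z, too close to decouple from it. Dropping it from the phase costs
|c| E(|Y| Z²) ≤ 2C|c|. Then Z² decouples from θ (2δ, one for cosine and one for sine), its mean is
replaced by v (δ), and restoring Y costs v|c|(1 + C). -/
theorem norm_integral_cexp_mul_sq_sub_le {θ Y Z : Ω → ℝ} {c C v δ : ℝ} (hθ : Measurable θ)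
    (hYm : Measurable Y) (hY : MemLp Y 3 P) (hZ : MemLp Z 3 P) (hv : 0 ≤ v)
    (hY3 : ∫ ω, |Y ω| ^ 3 ∂P ≤ C) (hZ3 : ∫ ω, |Z ω| ^ 3 ∂P ≤ C)
    (hvar : |∫ ω, Z ω ^ 2 ∂P - v| ≤ δ)
    (hcos : |∫ ω, Real.cos (θ ω) * Z ω ^ 2 ∂P
      - (∫ ω, Real.cos (θ ω) ∂P) * ∫ ω, Z ω ^ 2 ∂P| ≤ δ)
    (hsin : |∫ ω, Real.sin (θ ω) * Z ω ^ 2 ∂P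
      - (∫ ω, Real.sin (θ ω) ∂P) * ∫ ω, Z ω ^ 2 ∂P| ≤ δ) :
    ‖∫ ω, Complex.exp ((θ ω + c * Y ω : ℝ) * Complex.I) * ((Z ω ^ 2 : ℝ) : ℂ) ∂P
      - v * ∫ ω, Complex.exp ((θ ω + c * Y ω : ℝ) * Complex.I) ∂P‖
      ≤ 3 * δ + |c| * (2 * C + v * (1 + C)) := by
  have hZ2 : Integrable (fun ω => Z ω ^ 2) P := (hZ.mono_exponent (by norm_num)).integrable_sq
  have hθ' : Measurable fun ω => θ ω + c * Y ω := by fun_prop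
  have iY := integrable_abs_cube hY
  have iZ := integrable_abs_cube hZ
  have iE' : Integrable (fun ω => Complex.exp ((θ ω + c * Y ω : ℝ) * Complex.I)) P := by
    simpa using integrable_cexp_mul (P := P) hθ' (integrable_const (1 : ℂ))
  have iE : Integrable (fun ω => Complex.exp (θ ω * Complex.I)) P := by
    simpa using integrable_cexp_mul (P := P) hθ (integrable_const (1 : ℂ))
  have iEZ' : Integrable
      (fun ω => Complex.exp ((θ ω + c * Y ω : ℝ) * Complex.I) * ((Z ω ^ 2 : ℝ) : ℂ)) P :=
    integrable_cexp_mul hθ' hZ2.ofReal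
  have iEZ : Integrable (fun ω => Complex.exp (θ ω * Complex.I) * ((Z ω ^ 2 : ℝ) : ℂ)) P :=
    integrable_cexp_mul hθ hZ2.ofReal
  set A' := ∫ ω, Complex.exp ((θ ω + c * Y ω : ℝ) * Complex.I) * ((Z ω ^ 2 : ℝ) : ℂ) ∂P with hA'
  set A := ∫ ω, Complex.exp (θ ω * Complex.I) * ((Z ω ^ 2 : ℝ) : ℂ) ∂P with hA
  set B' := ∫ ω, Complex.exp ((θ ω + c * Y ω : ℝ) * Complex.I) ∂P with hB'
  set B := ∫ ω, Complex.exp (θ ω * Complex.I) ∂P with hB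
  set V := ∫ ω, Z ω ^ 2 ∂P with hV
  have h1 : ‖A' - A‖ ≤ |c| * (2 * C) := by
    rw [hA', hA, ← integral_sub iEZ' iEZ]
    have hb : Integrable (fun ω => |c| * (|Y ω| ^ 3 + |Z ω| ^ 3)) P := (iY.add iZ).const_mul _
    refine (norm_integral_le_of_norm_le hb (Eventually.of_forall fun ω => ?_)).trans ?_
    · rw [← sub_mul, norm_mul, Complex.norm_real, Real.norm_of_nonneg (sq_nonneg _)]
      calc _ ≤ |c * Y ω| * Z ω ^ 2 :=
            mul_le_mul_of_nonneg_right (norm_cexp_sub_le _ _) (sq_nonneg _)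
        _ = |c| * (|Y ω| * Z ω ^ 2) := by rw [abs_mul]; ring
        _ ≤ _ := mul_le_mul_of_nonneg_left (abs_mul_sq_le _ _) (abs_nonneg _)
    · rw [integral_const_mul, integral_add iY iZ]
      exact mul_le_mul_of_nonneg_left (by linarith) (abs_nonneg _)
  have h2 : ‖A - B * V‖ ≤ 2 * δ := by
    have eB := integral_cexp_mul_ofReal (P := P) hθ (integrable_const (1 : ℝ))
    simp only [mul_one, Complex.ofReal_one] at eB
    rw [hA, hB, eB, integral_cexp_mul_ofReal hθ hZ2]
    refine (Complex.norm_le_abs_re_add_abs_im _).trans ?_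
    simp only [Complex.sub_re, Complex.add_re, Complex.ofReal_re, Complex.mul_re, Complex.I_re,
      mul_zero, Complex.ofReal_im, Complex.I_im, mul_one, sub_self, add_zero, Complex.add_im,
      Complex.mul_im, zero_add, Complex.sub_im, sub_zero]
    linarith
  have h3 : ‖B‖ ≤ 1 := by
    refine (norm_integral_le_of_norm_le_const (C := 1)
      (Eventually.of_forall fun ω => (Complex.norm_exp_ofReal_mul_I _).le)).trans ?_
    simp
  have h4 : ‖B - B'‖ ≤ |c| * (1 + C) := by
    rw [hB', hB, ← integral_sub iE iE']
    have hb : Integrable (fun ω => |c| * (1 + |Y ω| ^ 3)) P :=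
      ((integrable_const _).add iY).const_mul _
    refine (norm_integral_le_of_norm_le hb (Eventually.of_forall fun ω => ?_)).trans ?_
    · rw [norm_sub_rev]
      refine (norm_cexp_sub_le _ _).trans ?_
      rw [abs_mul]
      exact mul_le_mul_of_nonneg_left (abs_le_one_add_cube _) (abs_nonneg _)
    · rw [integral_const_mul, integral_add (integrable_const _) iY]
      simp only [integral_const, probReal_univ, smul_eq_mul, mul_one]
      exact mul_le_mul_of_nonneg_left (by linarith) (abs_nonneg _)
  have e : A' - v * B' = (A' - A) + (A - B * V) + B * ((V - v : ℝ) : ℂ) + v * (B - B') := by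
    push_cast; ring
  rw [e]
  have h5 : ‖B * ((V - v : ℝ) : ℂ)‖ ≤ δ := by
    rw [norm_mul, Complex.norm_real]
    calc _ ≤ 1 * δ := mul_le_mul h3 hvar (abs_nonneg _) zero_le_one
      _ = δ := one_mul _
  have h6 : ‖(v : ℂ) * (B - B')‖ ≤ v * (|c| * (1 + C)) := by
    rw [norm_mul, Complex.norm_real, Real.norm_of_nonneg hv]
    gcongr
  calc _ ≤ ‖A' - A‖ + ‖A - B * V‖ + ‖B * ((V - v : ℝ) : ℂ)‖ + ‖(v : ℂ) * (B - B')‖ :=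
        norm_add₄_le
    _ ≤ |c| * (2 * C) + 2 * δ + δ + v * (|c| * (1 + C)) := by gcongr
    _ = _ := by ring

/-- Adding one martingale difference `c Z` to a phase multiplies the characteristic function by
`1 - c² v / 2`, up to an error of smaller order. -/
theorem norm_integral_cexp_add_sub_le {θ Z : Ω → ℝ} {c C v η : ℝ} (hθ : Measurable θ)
    (hZm : Measurable Z) (hZ : MemLp Z 3 P) (hZ3 : ∫ ω, |Z ω| ^ 3 ∂P ≤ C)
    (hcos : ∫ ω, Real.cos (θ ω) * Z ω ∂P = 0) (hsin : ∫ ω, Real.sin (θ ω) * Z ω ∂P = 0)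
    (hη : ‖∫ ω, Complex.exp (θ ω * Complex.I) * ((Z ω ^ 2 : ℝ) : ℂ) ∂P
      - v * ∫ ω, Complex.exp (θ ω * Complex.I) ∂P‖ ≤ η) :
    ‖∫ ω, Complex.exp ((θ ω + c * Z ω : ℝ) * Complex.I) ∂P
      - (1 - c ^ 2 * v / 2 : ℝ) * ∫ ω, Complex.exp (θ ω * Complex.I) ∂P‖
      ≤ c ^ 2 / 2 * η + 5 * |c| ^ 3 * C := by
  have hZ1 : Integrable Z P := hZ.integrable (by norm_num)
  have hZ2 : Integrable (fun ω => Z ω ^ 2) P := (hZ.mono_exponent (by norm_num)).integrable_sq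
  have iZ := integrable_abs_cube hZ
  have hθ' : Measurable fun ω => θ ω + c * Z ω := by fun_prop
  have iE' : Integrable (fun ω => Complex.exp ((θ ω + c * Z ω : ℝ) * Complex.I)) P := by
    simpa using integrable_cexp_mul (P := P) hθ' (integrable_const (1 : ℂ))
  have iE : Integrable (fun ω => Complex.exp (θ ω * Complex.I)) P := by
    simpa using integrable_cexp_mul (P := P) hθ (integrable_const (1 : ℂ))
  have iE1 : Integrable (fun ω => Complex.exp (θ ω * Complex.I) * (Z ω : ℂ)) P :=
    integrable_cexp_mul hθ hZ1.ofReal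
  have iE2 : Integrable (fun ω => Complex.exp (θ ω * Complex.I) * ((Z ω ^ 2 : ℝ) : ℂ)) P :=
    integrable_cexp_mul hθ hZ2.ofReal
  have hz : ∫ ω, Complex.exp (θ ω * Complex.I) * (Z ω : ℂ) ∂P = 0 := by
    rw [integral_cexp_mul_ofReal hθ hZ1, hcos, hsin]; simp
  set B := ∫ ω, Complex.exp (θ ω * Complex.I) ∂P with hB
  set A := ∫ ω, Complex.exp (θ ω * Complex.I) * ((Z ω ^ 2 : ℝ) : ℂ) ∂P with hA
  have j1 := iE1.const_mul ((c : ℂ) * Complex.I)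
  have j2 := iE2.const_mul ((c : ℂ) ^ 2 / 2)
  have e1 : ∫ ω, (Complex.exp (θ ω * Complex.I)
        + (c : ℂ) * Complex.I * (Complex.exp (θ ω * Complex.I) * (Z ω : ℂ))
        - (c : ℂ) ^ 2 / 2 * (Complex.exp (θ ω * Complex.I) * ((Z ω ^ 2 : ℝ) : ℂ))) ∂P
      = B - (c : ℂ) ^ 2 / 2 * A := by
    rw [integral_sub (iE.fun_add j1) j2, integral_add iE j1, integral_const_mul,
      integral_const_mul, hz]
    ring
  have h1 : ‖∫ ω, Complex.exp ((θ ω + c * Z ω : ℝ) * Complex.I) ∂P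
      - (B - (c : ℂ) ^ 2 / 2 * A)‖ ≤ 5 * |c| ^ 3 * C := by
    have j3 : Integrable (fun ω => Complex.exp (θ ω * Complex.I)
        + (c : ℂ) * Complex.I * (Complex.exp (θ ω * Complex.I) * (Z ω : ℂ))
        - (c : ℂ) ^ 2 / 2 * (Complex.exp (θ ω * Complex.I) * ((Z ω ^ 2 : ℝ) : ℂ))) P :=
      (iE.add j1).sub j2
    rw [← e1, ← integral_sub iE' j3]
    have hb : Integrable (fun ω => 5 * |c| ^ 3 * |Z ω| ^ 3) P := iZ.const_mul _
    refine (norm_integral_le_of_norm_le hb (Eventually.of_forall fun ω => ?_)).trans ?_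
    · have e2 : Complex.exp ((θ ω + c * Z ω : ℝ) * Complex.I)
          - (Complex.exp (θ ω * Complex.I)
          + (c : ℂ) * Complex.I * (Complex.exp (θ ω * Complex.I) * (Z ω : ℂ))
          - (c : ℂ) ^ 2 / 2 * (Complex.exp (θ ω * Complex.I) * ((Z ω ^ 2 : ℝ) : ℂ)))
          = Complex.exp (θ ω * Complex.I) * (Complex.exp ((c * Z ω : ℝ) * Complex.I)
            - (1 + (c * Z ω : ℝ) * Complex.I - ((c * Z ω : ℝ) : ℂ) ^ 2 / 2)) := by
        rw [mul_sub, ← Complex.exp_add]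
        push_cast
        rw [add_mul]
        ring
      rw [e2, norm_mul, Complex.norm_exp_ofReal_mul_I, one_mul]
      refine (norm_cexp_sub_taylor_le _).trans (le_of_eq ?_)
      rw [abs_mul]; ring
    · rw [integral_const_mul]
      exact mul_le_mul_of_nonneg_left hZ3 (by positivity)
  have e3 : ∫ ω, Complex.exp ((θ ω + c * Z ω : ℝ) * Complex.I) ∂P
      - (1 - c ^ 2 * v / 2 : ℝ) * B
      = (∫ ω, Complex.exp ((θ ω + c * Z ω : ℝ) * Complex.I) ∂P - (B - (c : ℂ) ^ 2 / 2 * A))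
        - ((c ^ 2 / 2 : ℝ) : ℂ) * (A - v * B) := by
    push_cast; ring
  rw [e3]
  refine (norm_sub_le _ _).trans ?_
  rw [add_comm, norm_mul, Complex.norm_real, Real.norm_of_nonneg (by positivity)]
  gcongr

end OneStep
-- Characteristic functions of sums over an array
section ArrayCLT

variable {Ω : Type*} {mΩ : MeasurableSpace Ω} {P : Measure Ω} [IsProbabilityMeasure P]

/-- A quantitative central limit theorem for martingale differences whose squares are nearly
uncorrelated with the past up to the last but one term. -/
theorem norm_integral_cexp_sub_pow_le {Z : ℕ → Ω → ℝ} {ℱ : ℕ → MeasurableSpace Ω} {c C v δ : ℝ}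
    (hle : ∀ k, ℱ k ≤ mΩ) (hmono : Monotone ℱ) (hZm : ∀ k, StronglyMeasurable[ℱ (k + 1)] (Z k))
    (hZ : ∀ k, MemLp (Z k) 3 P) (hZ3 : ∀ k, ∫ ω, |Z k ω| ^ 3 ∂P ≤ C) (hv : 0 ≤ v)
    (hvar : ∀ k, |∫ ω, Z k ω ^ 2 ∂P - v| ≤ δ)
    (hmix : ∀ (k : ℕ) (U : Ω → ℝ), StronglyMeasurable[ℱ k] U → (∀ ω, |U ω| ≤ 1) →
      |∫ ω, U ω * Z (k + 1) ω ^ 2 ∂P - (∫ ω, U ω ∂P) * ∫ ω, Z (k + 1) ω ^ 2 ∂P| ≤ δ)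
    (hmart : ∀ (k : ℕ) (U : Ω → ℝ), StronglyMeasurable[ℱ k] U → (∀ ω, |U ω| ≤ 1) →
      ∫ ω, U ω * Z k ω ∂P = 0)
    (hc : c ^ 2 * v ≤ 2) (N : ℕ) :
    ‖∫ ω, Complex.exp ((c * ∑ k ∈ Finset.range N, Z k ω : ℝ) * Complex.I) ∂P
        - ((1 - c ^ 2 * v / 2 : ℝ) : ℂ) ^ N‖
      ≤ N * (c ^ 2 / 2 * (3 * δ + |c| * (2 * C + v * (1 + C))) + 5 * |c| ^ 3 * C) := by
  set ε := c ^ 2 / 2 * (3 * δ + |c| * (2 * C + v * (1 + C))) + 5 * |c| ^ 3 * C with hε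
  set q : ℝ := 1 - c ^ 2 * v / 2 with hq
  have hq1 : |q| ≤ 1 := by
    have : 0 ≤ c ^ 2 * v := by positivity
    rw [abs_le]; constructor <;> linarith
  have hC : 0 ≤ C := (integral_nonneg fun ω => by positivity).trans (hZ3 0)
  have hδ : 0 ≤ δ := (abs_nonneg _).trans (hvar 0)
  have hθF : ∀ N, StronglyMeasurable[ℱ N] fun ω => c * ∑ k ∈ Finset.range N, Z k ω := by
    intro N
    refine StronglyMeasurable.const_mul (Finset.stronglyMeasurable_fun_sum _ fun i hi => ?_) c
    exact (hZm i).mono (hmono (Finset.mem_range.1 hi))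
  have hθ : ∀ N, Measurable fun ω => c * ∑ k ∈ Finset.range N, Z k ω := fun N =>
    ((hθF N).mono (hle N)).measurable
  have hZmeas : ∀ k, Measurable (Z k) := fun k => ((hZm k).mono (hle _)).measurable
  have hcosF : ∀ N, StronglyMeasurable[ℱ N]
      fun ω => Real.cos (c * ∑ k ∈ Finset.range N, Z k ω) := fun N =>
    Real.continuous_cos.comp_stronglyMeasurable (hθF N)
  have hsinF : ∀ N, StronglyMeasurable[ℱ N]
      fun ω => Real.sin (c * ∑ k ∈ Finset.range N, Z k ω) := fun N =>
    Real.continuous_sin.comp_stronglyMeasurable (hθF N)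
  have hη : ∀ N, ‖∫ ω, Complex.exp ((c * ∑ k ∈ Finset.range N, Z k ω : ℝ) * Complex.I)
        * ((Z N ω ^ 2 : ℝ) : ℂ) ∂P
      - v * ∫ ω, Complex.exp ((c * ∑ k ∈ Finset.range N, Z k ω : ℝ) * Complex.I) ∂P‖
      ≤ 3 * δ + |c| * (2 * C + v * (1 + C)) := by
    intro N
    -- The first term has no predecessor to drop, so Y = 0 there.
    cases N with
    | zero =>
      have := norm_integral_cexp_mul_sq_sub_le (P := P) (θ := fun _ => 0) (Y := fun _ => 0)
        (Z := Z 0) (c := c) (C := C) (v := v) (δ := δ) measurable_const measurable_const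
        (memLp_const 0) (hZ 0) hv (by simpa using hC) (hZ3 0) (hvar 0) (by simpa using hδ)
        (by simpa using hδ)
      simpa using this
    | succ m =>
      have := norm_integral_cexp_mul_sq_sub_le (P := P)
        (c := c) (C := C) (v := v) (δ := δ) (hθ m) (hZmeas m) (hZ m) (hZ (m + 1)) hv (hZ3 m)
        (hZ3 (m + 1)) (hvar (m + 1)) (hmix m _ (hcosF m) fun ω => Real.abs_cos_le_one _)
        (hmix m _ (hsinF m) fun ω => Real.abs_sin_le_one _)
      simpa only [Finset.sum_range_succ, mul_add] using this
  induction N with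
  | zero => simp
  | succ N ih =>
    have h1 := norm_integral_cexp_add_sub_le (P := P) (c := c) (C := C) (v := v) (hθ N) (hZmeas N)
      (hZ N) (hZ3 N) (hmart N _ (hcosF N) fun ω => Real.abs_cos_le_one _)
      (hmart N _ (hsinF N) fun ω => Real.abs_sin_le_one _) (hη N)
    simp only [Finset.sum_range_succ, mul_add]
    set Φ := ∫ ω, Complex.exp ((c * ∑ k ∈ Finset.range N, Z k ω : ℝ) * Complex.I) ∂P
    set Φ' := ∫ ω, Complex.exp ((c * ∑ k ∈ Finset.range N, Z k ω + c * Z N ω : ℝ) * Complex.I) ∂P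
    -- Since |q| ≤ 1, which uses c² v ≤ 2, the one-step errors add up without amplification.
    have e : Φ' - (q : ℂ) ^ (N + 1) = (Φ' - q * Φ) + q * (Φ - (q : ℂ) ^ N) := by ring
    rw [e]
    refine (norm_add_le _ _).trans ?_
    rw [norm_mul, Complex.norm_real, Real.norm_eq_abs]
    have h2 : |q| * ‖Φ - (q : ℂ) ^ N‖ ≤ N * ε :=
      (mul_le_of_le_one_left (norm_nonneg _) hq1).trans ih
    push_cast
    linarith

/-- Take c = t/√a. Since a c² = t², the a one-step errors sum to a multiple of δ + |c|, which
vanishes, while (1 - t²v/(2a))^a tends to the Gaussian factor. -/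
theorem tendsto_integral_cexp_of_array {Z : ℕ → ℕ → Ω → ℝ} {ℱ : ℕ → ℕ → MeasurableSpace Ω}
    {a : ℕ → ℕ} {δ : ℕ → ℝ} {C v : ℝ} (ha : Tendsto a atTop atTop)
    (hδ : Tendsto δ atTop (nhds 0)) (hle : ∀ n k, ℱ n k ≤ mΩ) (hmono : ∀ n, Monotone (ℱ n))
    (hZm : ∀ n k, StronglyMeasurable[ℱ n (k + 1)] (Z n k)) (hZ : ∀ n k, MemLp (Z n k) 3 P)
    (hZ3 : ∀ᶠ n in atTop, ∀ k, ∫ ω, |Z n k ω| ^ 3 ∂P ≤ C) (hv : 0 ≤ v)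
    (hvar : ∀ᶠ n in atTop, ∀ k, |∫ ω, Z n k ω ^ 2 ∂P - v| ≤ δ n)
    (hmix : ∀ᶠ n in atTop, ∀ (k : ℕ) (U : Ω → ℝ), StronglyMeasurable[ℱ n k] U → (∀ ω, |U ω| ≤ 1) →
      |∫ ω, U ω * Z n (k + 1) ω ^ 2 ∂P - (∫ ω, U ω ∂P) * ∫ ω, Z n (k + 1) ω ^ 2 ∂P| ≤ δ n)
    (hmart : ∀ (n k : ℕ) (U : Ω → ℝ), StronglyMeasurable[ℱ n k] U → (∀ ω, |U ω| ≤ 1) →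
      ∫ ω, U ω * Z n k ω ∂P = 0) (t : ℝ) :
    Tendsto (fun n => ∫ ω, Complex.exp
        ((t * ((√(a n : ℝ))⁻¹ * ∑ k ∈ Finset.range (a n), Z n k ω) : ℝ) * Complex.I) ∂P)
      atTop (nhds ((Real.exp (-(t ^ 2 * v / 2)) : ℝ) : ℂ)) := by
  have haR : Tendsto (fun n => (a n : ℝ)) atTop atTop := tendsto_natCast_atTop_atTop.comp ha
  have hsq : Tendsto (fun n => √(a n : ℝ)) atTop atTop := Real.tendsto_sqrt_atTop.comp haR
  have hc0 : Tendsto (fun n => t * (√(a n : ℝ))⁻¹) atTop (nhds 0) := by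
    simpa using (tendsto_inv_atTop_zero.comp hsq).const_mul t
  have hcabs : Tendsto (fun n => |t * (√(a n : ℝ))⁻¹|) atTop (nhds 0) := by
    simpa using hc0.abs
  have hpow : Tendsto (fun n => (1 - (t * (√(a n : ℝ))⁻¹) ^ 2 * v / 2) ^ (a n)) atTop
      (nhds (Real.exp (-(t ^ 2 * v / 2)))) := by
    refine ((Real.tendsto_one_add_div_pow_exp (-(t ^ 2 * v / 2))).comp ha).congr' ?_
    refine Eventually.of_forall fun n => ?_
    simp only [Function.comp_apply]
    rw [mul_pow, inv_pow, Real.sq_sqrt (Nat.cast_nonneg _)]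
    congr 1
    ring
  have hdiff : Tendsto (fun n => ∫ ω, Complex.exp
        ((t * ((√(a n : ℝ))⁻¹ * ∑ k ∈ Finset.range (a n), Z n k ω) : ℝ) * Complex.I) ∂P
        - (((1 - (t * (√(a n : ℝ))⁻¹) ^ 2 * v / 2) ^ (a n) : ℝ) : ℂ)) atTop (nhds 0) := by
    have hbound : Tendsto (fun n => t ^ 2 / 2
          * (3 * δ n + |t * (√(a n : ℝ))⁻¹| * (2 * C + v * (1 + C)))
          + 5 * (t ^ 2 * |t * (√(a n : ℝ))⁻¹|) * C) atTop (nhds 0) := by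
      have := (((hδ.const_mul 3).add (hcabs.mul_const (2 * C + v * (1 + C)))).const_mul
        (t ^ 2 / 2)).add (((hcabs.const_mul (t ^ 2)).const_mul 5).mul_const C)
      simpa using this
    refine squeeze_zero_norm' ?_ hbound
    have hsmall : ∀ᶠ n in atTop, (t * (√(a n : ℝ))⁻¹) ^ 2 * v ≤ 2 := by
      have : Tendsto (fun n => (t * (√(a n : ℝ))⁻¹) ^ 2 * v) atTop (nhds 0) := by
        simpa using (hc0.pow 2).mul_const v
      exact this.eventually_le_const two_pos
    filter_upwards [hZ3, hvar, hmix, hsmall, ha.eventually_ge_atTop 1] with n h1 h2 h3 h4 h5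
    have h6 := norm_integral_cexp_sub_pow_le (hle n) (hmono n) (hZm n) (hZ n) h1 hv h2 h3
      (hmart n) h4 (a n)
    simp only [mul_assoc] at h6 ⊢
    push_cast at h6 ⊢
    refine h6.trans (le_of_eq ?_)
    have hapos : (0 : ℝ) < a n := by exact_mod_cast h5
    have hc2 : (a n : ℝ) * (t * (√(a n : ℝ))⁻¹) ^ 2 = t ^ 2 := by
      rw [mul_pow, inv_pow, Real.sq_sqrt hapos.le]; field_simp
    have hc3 : |t * (√(a n : ℝ))⁻¹| ^ 3
        = (t * (√(a n : ℝ))⁻¹) ^ 2 * |t * (√(a n : ℝ))⁻¹| := by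
      rw [pow_succ, sq_abs]
    rw [hc3]
    linear_combination ((3 * δ n + |t * (√(a n : ℝ))⁻¹| * (2 * C + v * (1 + C))) / 2
      + 5 * |t * (√(a n : ℝ))⁻¹| * C) * hc2
  have := hdiff.add ((Complex.continuous_ofReal.tendsto _).comp hpow)
  simpa using this

end ArrayCLT
-- The mixing bound requires a square-integrable variable, while Z² has only 3/2 moments when Z lies
-- in L³. Truncating Z² at A leaves an error controlled by the third moment.
theorem sq_sub_min_le {A : ℝ} (hA : 0 < A) (z : ℝ) : z ^ 2 - min (z ^ 2) A ≤ |z| ^ 3 / √A := by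
  have hs : 0 < √A := Real.sqrt_pos.2 hA
  rcases le_total (z ^ 2) A with h | h
  · rw [min_eq_left h, sub_self]; positivity
  · rw [min_eq_right h, le_div_iff₀ hs]
    have h1 : √A ≤ |z| := by
      rw [← Real.sqrt_sq_eq_abs]; exact Real.sqrt_le_sqrt h
    have h2 : |z| ^ 3 = z ^ 2 * |z| := by rw [pow_succ, sq_abs]
    rw [h2]
    exact mul_le_mul (by linarith) h1 hs.le (sq_nonneg _)

namespace MixingDifferences

variable {Ω : Type*} {mΩ : MeasurableSpace Ω} {P : Measure Ω}
  {ℱ 𝒢 : ℕ → MeasurableSpace Ω} {κ D s : ℝ} {d : ℕ → Ω → ℝ} [IsProbabilityMeasure P]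

/-- Squares of future variables with third moments decouple from bounded past variables. -/
theorem abs_integral_mul_sq_sub_le (h : MixingDifferences P ℱ 𝒢 κ D s d) {n k : ℕ} {U Z : Ω → ℝ}
    {A C : ℝ} (hU : StronglyMeasurable[ℱ n] U) (hU1 : ∀ ω, |U ω| ≤ 1)
    (hZm : StronglyMeasurable[𝒢 (n + k)] Z) (hZ : MemLp Z 3 P)
    (hZ3 : ∫ ω, |Z ω| ^ 3 ∂P ≤ C) (hA : 0 < A) :
    |∫ ω, U ω * Z ω ^ 2 ∂P - (∫ ω, U ω ∂P) * ∫ ω, Z ω ^ 2 ∂P| ≤ κ ^ k * A + 2 * (C / √A) := by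
  have hs : 0 < √A := Real.sqrt_pos.2 hA
  have hUm : AEStronglyMeasurable U P := (hU.mono (h.le n)).aestronglyMeasurable
  have hZ2 : Integrable (fun ω => Z ω ^ 2) P := (hZ.mono_exponent (by norm_num)).integrable_sq
  have hU2 : MemLp U 2 P := MemLp.of_bound hUm 1 (Eventually.of_forall hU1)
  have hWb : ∀ ω, |min (Z ω ^ 2) A| ≤ A := fun ω => by
    rw [abs_of_nonneg (le_min (sq_nonneg _) hA.le)]; exact min_le_right _ _
  have hWc : Continuous fun z : ℝ => min (z ^ 2) A := by fun_prop
  have hWm : AEStronglyMeasurable (fun ω => min (Z ω ^ 2) A) P :=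
    hWc.comp_aestronglyMeasurable hZ.1
  have hW2 : MemLp (fun ω => min (Z ω ^ 2) A) 2 P := MemLp.of_bound hWm A (Eventually.of_forall hWb)
  have hWi : Integrable (fun ω => min (Z ω ^ 2) A) P := hW2.integrable (by norm_num)
  have hRi : Integrable (fun ω => Z ω ^ 2 - min (Z ω ^ 2) A) P := hZ2.sub hWi
  have hR0 : ∀ ω, 0 ≤ Z ω ^ 2 - min (Z ω ^ 2) A := fun ω => sub_nonneg.2 (min_le_left _ _)
  have hR : ∫ ω, (Z ω ^ 2 - min (Z ω ^ 2) A) ∂P ≤ C / √A := by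
    calc _ ≤ ∫ ω, |Z ω| ^ 3 / √A ∂P :=
          integral_mono hRi ((integrable_abs_cube hZ).div_const _) fun ω => sq_sub_min_le hA _
      _ = (∫ ω, |Z ω| ^ 3 ∂P) / √A := integral_div _ _
      _ ≤ _ := by gcongr
  have hb : ∀ {V : Ω → ℝ}, Integrable V P → Integrable (fun ω => U ω * V ω) P := fun hV =>
    hV.bdd_mul (c := 1) hUm (Eventually.of_forall hU1)
  -- The truncated square is bounded by A, so the mixing inequality gives κ^k A. The discarded part
  -- enters twice, once in each expectation.
  have hcov := h.mixing n k hU hU2 (hWc.comp_stronglyMeasurable hZm) hW2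
  have hVU : √Var[U; P] ≤ 1 := by
    rw [Real.sqrt_le_one]
    refine (variance_le_integral_sq hU2).trans ?_
    calc _ ≤ ∫ _, (1 : ℝ) ∂P := integral_mono hU2.integrable_sq (integrable_const _) fun ω => by
          rw [sq_le_one_iff_abs_le_one]; exact hU1 ω
      _ = 1 := by simp
  have hVW : √Var[fun ω => min (Z ω ^ 2) A; P] ≤ A := by
    rw [Real.sqrt_le_left hA.le]
    refine (variance_le_integral_sq hW2).trans ?_
    calc _ ≤ ∫ _, A ^ 2 ∂P := integral_mono hW2.integrable_sq (integrable_const _) fun ω => by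
          exact sq_le_sq' (abs_le.1 (hWb ω)).1 (abs_le.1 (hWb ω)).2
      _ = A ^ 2 := by simp
  have hcov' : |∫ ω, U ω * min (Z ω ^ 2) A ∂P
      - (∫ ω, U ω ∂P) * ∫ ω, min (Z ω ^ 2) A ∂P| ≤ κ ^ k * A := by
    have e := covariance_eq_sub hU2 hW2
    simp only [_root_.Pi.mul_apply] at e
    rw [← e]
    refine hcov.trans (mul_le_mul_of_nonneg_left ?_ (pow_nonneg h.nonneg _))
    calc _ ≤ 1 * A := mul_le_mul hVU hVW (Real.sqrt_nonneg _) zero_le_one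
      _ = A := one_mul A
  have hU1' : |∫ ω, U ω ∂P| ≤ 1 := by
    have := norm_integral_le_of_norm_le_const (μ := P) (f := U) (C := 1)
      (Eventually.of_forall hU1)
    simpa using this
  have hUR : |∫ ω, U ω * (Z ω ^ 2 - min (Z ω ^ 2) A) ∂P| ≤ C / √A := by
    rw [← Real.norm_eq_abs]
    refine (norm_integral_le_of_norm_le hRi (Eventually.of_forall fun ω => ?_)).trans hR
    rw [norm_mul, Real.norm_eq_abs, Real.norm_of_nonneg (hR0 ω)]
    exact mul_le_of_le_one_left (hR0 ω) (hU1 ω)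
  have hUR' : |(∫ ω, U ω ∂P) * ∫ ω, (Z ω ^ 2 - min (Z ω ^ 2) A) ∂P| ≤ C / √A := by
    have h0 : 0 ≤ ∫ ω, (Z ω ^ 2 - min (Z ω ^ 2) A) ∂P := integral_nonneg hR0
    rw [abs_mul, abs_of_nonneg h0]
    exact (mul_le_of_le_one_left h0 hU1').trans hR
  have e1 : ∫ ω, U ω * Z ω ^ 2 ∂P = ∫ ω, U ω * min (Z ω ^ 2) A ∂P
      + ∫ ω, U ω * (Z ω ^ 2 - min (Z ω ^ 2) A) ∂P := by
    rw [← integral_add (hb hWi) (hb hRi)]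
    exact integral_congr_ae (Eventually.of_forall fun ω => by ring)
  have e2 : ∫ ω, Z ω ^ 2 ∂P = ∫ ω, min (Z ω ^ 2) A ∂P
      + ∫ ω, (Z ω ^ 2 - min (Z ω ^ 2) A) ∂P := by
    rw [← integral_add hWi hRi]
    exact integral_congr_ae (Eventually.of_forall fun ω => by ring)
  rw [e1, e2, mul_add]
  rw [abs_le] at *
  constructor <;> linarith

/-- The normalised sum over the batches of the off-diagonal part of the squared batch sums is
asymptotically normal. -/
theorem tendsto_integral_cexp (h : MixingDifferences P ℱ 𝒢 κ D s d) {a b : ℕ → ℕ}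
    (ha : Tendsto a atTop atTop) (hb : Tendsto b atTop atTop) (t : ℝ) :
    Tendsto (fun n => ∫ ω, Complex.exp ((t * ((√(a n : ℝ))⁻¹ * ∑ k ∈ Finset.range (a n),
        2 / (b n : ℝ) * pairSum d (k * b n) (b n) ω) : ℝ) * Complex.I) ∂P)
      atTop (nhds ((Real.exp (-(t ^ 2 * (2 * s ^ 2) / 2)) : ℝ) : ℂ)) := by
  obtain ⟨C2, hC20, hC2⟩ := h.exists_abs_integral_pairSum_sq_sub_le
  obtain ⟨C3, hC30, hC3⟩ := h.exists_integral_pairSum_cube_le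
  have hbR : Tendsto (fun n => (b n : ℝ)) atTop atTop := tendsto_natCast_atTop_atTop.comp hb
  have hsq : Tendsto (fun n => √(b n : ℝ)) atTop atTop := Real.tendsto_sqrt_atTop.comp hbR
  -- Truncating at A = b makes the decoupling error b κ^b + 2 C3/√b; the term C2/√b comes from the
  -- second moments.
  have hδ : Tendsto (fun n => (b n : ℝ) * κ ^ (b n) + (C2 + 2 * C3) * (√(b n : ℝ))⁻¹) atTop
      (nhds 0) := by
    have h1 := (tendsto_self_mul_const_pow_of_lt_one h.nonneg h.lt_one).comp hb
    have h2 := (tendsto_inv_atTop_zero.comp hsq).const_mul (C2 + 2 * C3)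
    simpa [Function.comp_def] using h1.add h2
  refine tendsto_integral_cexp_of_array (Z := fun n k ω => 2 / (b n : ℝ)
      * pairSum d (k * b n) (b n) ω) (ℱ := fun n k => ℱ (k * b n)) (C := C3) ha hδ
    (fun n k => h.le _) (fun n i j hij => h.mono (Nat.mul_le_mul_right _ hij))
    (fun n k => ?_) (fun n k => (h.memLp_pairSum _ _).const_mul _) ?_ (by positivity) ?_ ?_
    (fun n k U hU hU1 => h.integral_mul_pairSum_eq_zero _ _ _ hU hU1) t
  · have := (h.stronglyMeasurable_pairSum (k * b n) (b n)).const_mul (2 / (b n : ℝ))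
    rwa [← Nat.succ_mul] at this
  · filter_upwards [hb.eventually_ge_atTop 1] with n hn k using hC3 _ _ hn
  · filter_upwards [hb.eventually_ge_atTop 1] with n hn k
    refine (hC2 _ _ hn).trans ?_
    have h1 : 0 ≤ (b n : ℝ) * κ ^ (b n) := mul_nonneg (Nat.cast_nonneg _) (pow_nonneg h.nonneg _)
    have h2 : 0 ≤ C3 * (√(b n : ℝ))⁻¹ := by positivity
    rw [div_eq_mul_inv]
    linarith
  · filter_upwards [hb.eventually_ge_atTop 1] with n hn k U hU hU1
    have hbpos : (0 : ℝ) < b n := by exact_mod_cast hn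
    -- U is known when batch k begins and Z belongs to batch k + 1, so one full batch of length b
    -- separates them.
    have hm := (h.stronglyMeasurable_pairSum_future ((k + 1) * b n) (b n)).const_mul (2 / (b n : ℝ))
    rw [Nat.succ_mul] at hm
    have h1 := h.abs_integral_mul_sq_sub_le (A := b n) hU hU1 hm
      ((h.memLp_pairSum _ _).const_mul _) (hC3 _ _ hn) hbpos
    rw [Nat.succ_mul]
    refine h1.trans ?_
    have h2 : 0 ≤ C2 * (√(b n : ℝ))⁻¹ := by positivity
    rw [div_eq_mul_inv]
    linarith

end MixingDifferences
/-! ### The martingale approximation of a reversible chain -/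

section Chain

variable {S Ω : Type*} [MeasurableSpace S] {X : ℕ → Ω → S}

theorem future_anti : Antitone (future X) := fun _ _ h =>
  iSup_le fun j => (measurable_future (by omega)).comap_le

/-- The martingale differences `g(X_{i+1}) - (K g)(X_i)`. -/
def martingaleDiff (K : Kernel S S) (g : S → ℝ) (X : ℕ → Ω → S) (i : ℕ) (ω : Ω) : ℝ :=
  g (X (i + 1) ω) - markovOp K g (X i ω)

theorem sub_pow_six_le (x y : ℝ) : (x - y) ^ 6 ≤ 32 * (x ^ 6 + y ^ 6) := by
  have h := Even.add_pow_le (n := 6) (a := x) (b := -y) (by decide)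
  rw [← sub_eq_add_neg, Even.neg_pow (by decide)] at h
  norm_num at h
  exact h

variable [mΩ : MeasurableSpace Ω] {K : Kernel S S} [IsMarkovKernel K] {Pi : Measure S}
  [IsProbabilityMeasure Pi] {P : Measure Ω} [IsProbabilityMeasure P]

/-- Since (Tg)(X_i) is the conditional expectation of g(X_{i+1}), Pythagoras gives the variance E g²
- E (Tg)². The sixth moments use (x - y)⁶ ≤ 32(x⁶ + y⁶) and stationarity. -/
theorem IsMarkovChain.exists_mixingDifferences (hX : IsMarkovChain K Pi P X)
    (hinv : K.Invariant Pi) {κ : ℝ} (hκ : 0 ≤ κ) (hκ1 : κ < 1) (hgap : SpectralGap K Pi κ)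
    {g : S → ℝ} (hg : Measurable g) (hg6 : MemLp g 6 Pi) :
    ∃ D, MixingDifferences P (past X) (future X) κ D
      (∫ x, g x ^ 2 ∂Pi - ∫ x, markovOp K g x ^ 2 ∂Pi) (martingaleDiff K g X) := by
  have hTg : Measurable (markovOp K g) := measurable_markovOp hg
  have hTg6 : MemLp (markovOp K g) 6 Pi := memLp_markovOp hinv hg (by norm_num) (by simp) hg6
  have hL : ∀ {u : S → ℝ} {p : ENNReal} (i : ℕ), MemLp u p Pi → MemLp (fun ω => u (X i ω)) p P :=
    fun i hu => hu.comp_measurePreserving (hX.measurePreserving hinv i)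
  have h6 : ∀ {u : Ω → ℝ}, MemLp u 6 P → Integrable (fun x => u x ^ 6) P :=
    fun hu => integrable_even_pow (n := 6) (by decide) (by norm_num) (by simpa using hu)
  have hmem : ∀ i, MemLp (martingaleDiff K g X i) 6 P := fun i =>
    (hL (i + 1) hg6).sub (hL i hTg6)
  have hcond : ∀ i, P[fun ω => g (X (i + 1) ω)|past X i] =ᵐ[P] fun ω => markovOp K g (X i ω) :=
    fun i => hX.condExp_comp_succ hinv hg (hg6.integrable (by norm_num)) i
  refine ⟨32 * (∫ x, g x ^ 6 ∂Pi + ∫ x, markovOp K g x ^ 6 ∂Pi),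
    { le := past_le hX.measurable
      mono := fun _ _ h => past_mono h
      anti := future_anti
      past := fun i => ?_
      future := fun i => ?_
      memLp := hmem
      six := fun i => ?_
      condExp := fun i => ?_
      sq := fun i => ?_
      nonneg := hκ
      lt_one := hκ1
      mixing := fun n k _ _ hU hU2 hV hV2 => hX.abs_covariance_le hinv hκ hgap n k hU hU2 hV hV2 }⟩
  · exact ((hg.comp (measurable_past le_rfl)).sub
      (hTg.comp (measurable_past (Nat.le_succ i)))).stronglyMeasurable
  · exact ((hg.comp (measurable_future (Nat.le_succ i))).sub
      (hTg.comp (measurable_future le_rfl))).stronglyMeasurable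
  · rw [← hX.integral_comp hinv (hg.pow_const 6) (i + 1),
      ← hX.integral_comp hinv (hTg.pow_const 6) i,
      ← integral_add (h6 (hL _ hg6)) (h6 (hL _ hTg6)), ← integral_const_mul]
    exact integral_mono (h6 (hmem i)) (((h6 (hL _ hg6)).add (h6 (hL _ hTg6))).const_mul _)
      fun ω => sub_pow_six_le _ _
  · have h1 := condExp_sub (μ := P) ((hL (i + 1) hg6).integrable (by norm_num))
      ((hL i hTg6).integrable (by norm_num)) (past X i)
    have h2 : P[fun ω => markovOp K g (X i ω)|past X i] = fun ω => markovOp K g (X i ω) :=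
      condExp_of_stronglyMeasurable (past_le hX.measurable i)
        (hTg.comp (measurable_past le_rfl)).stronglyMeasurable
        ((hL i hTg6).integrable (by norm_num))
    refine h1.trans ?_
    filter_upwards [hcond i] with ω hω
    simp [hω, h2]
  · have hg2 := (hL (i + 1) hg6).mono_exponent (p := 2) (by norm_num)
    have hT2 := (hL i hTg6).mono_exponent (p := 2) (by norm_num)
    have h1 := integral_mul_condExp_of_stronglyMeasurable (past_le hX.measurable i)
      (hTg.comp (measurable_past (X := X) (le_refl i))).stronglyMeasurable hT2 hg2
    have h2 : ∫ ω, markovOp K g (X i ω) * g (X (i + 1) ω) ∂P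
        = ∫ ω, markovOp K g (X i ω) ^ 2 ∂P := by
      refine h1.symm.trans (integral_congr_ae ?_)
      filter_upwards [hcond i] with ω hω
      simp only [Function.comp_apply]
      rw [hω, pow_two]
    have i1 := hg2.integrable_sq
    have i2 : Integrable (fun ω => 2 * (markovOp K g (X i ω) * g (X (i + 1) ω))) P :=
      (hT2.integrable_mul hg2).const_mul 2
    have i3 := hT2.integrable_sq
    have e : ∫ ω, martingaleDiff K g X i ω ^ 2 ∂P
        = ∫ ω, (g (X (i + 1) ω) ^ 2 - 2 * (markovOp K g (X i ω) * g (X (i + 1) ω))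
          + markovOp K g (X i ω) ^ 2) ∂P :=
      integral_congr_ae (Eventually.of_forall fun ω => by simp only [martingaleDiff]; ring)
    rw [e, integral_add (i1.sub' i2) i3, integral_sub i1 i2, integral_const_mul, h2,
      ← hX.integral_comp hinv (hg.pow_const 2) (i + 1),
      ← hX.integral_comp hinv (hTg.pow_const 2) i]
    ring

theorem IsMarkovChain.autocov_eq (hX : IsMarkovChain K Pi P X) (hinv : K.Invariant Pi)
    {f : S → ℝ} (hf : Measurable f) (hf2 : MemLp f 2 Pi) (h : ℕ) :
    autocov P f X h = ∫ x, (f x - ∫ y, f y ∂Pi)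
      * (markovOp K)^[h] (fun x => f x - ∫ y, f y ∂Pi) x ∂Pi := by
  set f₀ : S → ℝ := fun x => f x - ∫ y, f y ∂Pi with hf₀
  have hm : Measurable f₀ := hf.sub_const _
  have hm2 : MemLp f₀ 2 Pi := hf2.sub (memLp_const _)
  have hL : ∀ i : ℕ, MemLp (fun ω => f₀ (X i ω)) 2 P :=
    fun i => hm2.comp_measurePreserving (hX.measurePreserving hinv i)
  have h1 := integral_mul_condExp_of_stronglyMeasurable (past_le hX.measurable 0)
    (hm.comp (measurable_past (X := X) (le_refl 0))).stronglyMeasurable (hL 0) (hL (0 + h))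
  have h2 := hX.condExp_comp_add hinv hm (hm2.integrable (by norm_num)) 0 h
  have hI : Measurable fun x => f₀ x * (markovOp K)^[h] f₀ x :=
    hm.mul (measurable_markovOp_iterate hm h)
  rw [← hX.integral_comp hinv hI 0, autocov, covariance, hX.integral_comp hinv hf,
    hX.integral_comp hinv hf]
  rw [zero_add] at h1 h2
  refine h1.symm.trans (integral_congr_ae ?_)
  filter_upwards [h2] with ω hω
  simp only [Function.comp_apply]
  rw [hω]

theorem IsMarkovChain.summable_autocov (hX : IsMarkovChain K Pi P X) (hinv : K.Invariant Pi)
    {κ : ℝ} (hκ : 0 ≤ κ) (hκ1 : κ < 1) (hgap : SpectralGap K Pi κ)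
    {f : S → ℝ} (hf : Measurable f) (hf2 : MemLp f 2 Pi) :
    Summable fun i : ℕ => autocov P f X i := by
  have hL : ∀ i : ℕ, MemLp (fun ω => f (X i ω)) 2 P :=
    fun i => hf2.comp_measurePreserving (hX.measurePreserving hinv i)
  have hv : ∀ i, Var[fun ω => f (X i ω); P] ≤ ∫ x, f x ^ 2 ∂Pi := fun i => by
    rw [← hX.integral_comp hinv (hf.pow_const 2) i]
    exact variance_le_integral_sq (hL i)
  refine Summable.of_norm_bounded ((summable_geometric_of_lt_one hκ hκ1).mul_right
    (∫ x, f x ^ 2 ∂Pi)) fun i => ?_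
  have h1 := hX.abs_covariance_le hinv hκ hgap 0 i
    (hf.comp (measurable_past (X := X) (le_refl 0))).stronglyMeasurable (hL 0)
    (hf.comp (measurable_future (X := X) (le_refl (0 + i)))).stronglyMeasurable (hL (0 + i))
  rw [zero_add] at h1
  refine h1.trans (mul_le_mul_of_nonneg_left ?_ (pow_nonneg hκ _))
  calc _ ≤ √(∫ x, f x ^ 2 ∂Pi) * √(∫ x, f x ^ 2 ∂Pi) :=
        mul_le_mul (Real.sqrt_le_sqrt (hv 0)) (Real.sqrt_le_sqrt (hv i)) (Real.sqrt_nonneg _)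
          (Real.sqrt_nonneg _)
    _ = _ := Real.mul_self_sqrt (integral_nonneg fun x => sq_nonneg _)

/-- With f₀ = g - Tg one has g² - (Tg)² = 2 f₀ g - f₀². The pairing ⟨f₀, g⟩ is the sum of the
autocovariances from lag 0 on, and ‖f₀‖² is the one at lag 0, which must be counted once rather than
twice. -/
theorem IsMarkovChain.mcmcVar_eq (hX : IsMarkovChain K Pi P X) (hinv : K.Invariant Pi)
    {f g : S → ℝ} (hf : Measurable f) (hf2 : MemLp f 2 Pi) (hg : Measurable g) (hg2 : MemLp g 2 Pi)
    (hsum : Summable fun i : ℕ => autocov P f X i)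
    (hp : ∀ᵐ x ∂Pi, g x - markovOp K g x = f x - ∫ y, f y ∂Pi)
    (hlim : Tendsto (fun N => ∑ m ∈ Finset.range N, ∫ x, (f x - ∫ y, f y ∂Pi)
      * (markovOp K)^[m] (fun x => f x - ∫ y, f y ∂Pi) x ∂Pi) atTop
      (nhds (∫ x, (f x - ∫ y, f y ∂Pi) * g x ∂Pi))) :
    mcmcVar P f X = ∫ x, g x ^ 2 ∂Pi - ∫ x, markovOp K g x ^ 2 ∂Pi := by
  have hTg2 : MemLp (markovOp K g) 2 Pi := memLp_markovOp hinv hg (by norm_num) (by simp) hg2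
  have hm2 : MemLp (fun x => f x - ∫ y, f y ∂Pi) 2 Pi := hf2.sub (memLp_const _)
  simp_rw [← hX.autocov_eq hinv hf hf2] at hlim
  have h1 := tendsto_nhds_unique hsum.hasSum.tendsto_sum_nat hlim
  rw [hsum.tsum_eq_zero_add] at h1
  have h0 : Var[fun ω => f (X 0 ω); P] = autocov P f X 0 :=
    (covariance_self ((hf.comp (hX.measurable 0)).aemeasurable)).symm
  have h2 := hX.autocov_eq hinv hf hf2 0
  have h3 : ∫ x, g x ^ 2 ∂Pi - ∫ x, markovOp K g x ^ 2 ∂Pi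
      = 2 * ∫ x, (f x - ∫ y, f y ∂Pi) * g x ∂Pi
        - ∫ x, (f x - ∫ y, f y ∂Pi) * (f x - ∫ y, f y ∂Pi) ∂Pi := by
    have i1 : Integrable (fun x => 2 * ((f x - ∫ y, f y ∂Pi) * g x)) Pi :=
      (hm2.integrable_mul hg2).const_mul 2
    have i2 : Integrable (fun x => (f x - ∫ y, f y ∂Pi) * (f x - ∫ y, f y ∂Pi)) Pi :=
      hm2.integrable_mul hm2
    rw [← integral_const_mul, ← integral_sub hg2.integrable_sq hTg2.integrable_sq,
      ← integral_sub i1 i2]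
    refine integral_congr_ae ?_
    filter_upwards [hp] with x hx
    rw [← hx]
    ring
  rw [h3, mcmcVar, h0, ← h1]
  simp only [Function.iterate_zero, id] at h2
  rw [← h2]
  ring

end Chain
-- The remainder of a squared batch sum
/-- The part of a squared batch sum of `d i + r i - r (i + 1)`, divided by the batch length, that
remains after removing the off-diagonal part of the square of the batch sum of `d`. -/
def batchError {Ω : Type*} (d r : ℕ → Ω → ℝ) (a b : ℕ) (ω : Ω) : ℝ :=
  (∑ i ∈ Finset.range b, d (a + i) ω ^ 2
    + (2 * (partialSum d a b ω * (r a ω - r (a + b) ω)) + (r a ω - r (a + b) ω) ^ 2)) / b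

theorem sq_partialSum_add_div_eq {Ω : Type*} (d r : ℕ → Ω → ℝ) (a b : ℕ) (ω : Ω) :
    (partialSum d a b ω + (r a ω - r (a + b) ω)) ^ 2 / b
      = 2 / (b : ℝ) * pairSum d a b ω + batchError d r a b ω := by
  rw [batchError]
  linear_combination (1 / (b : ℝ)) * partialSum_sq d a b ω

theorem sq_two_mul_add_sq_le {b : ℝ} (hb : 1 ≤ b) (m x : ℝ) :
    (2 * (m * x) + x ^ 2) ^ 2 ≤ 8 * (m ^ 4 / b) + 10 * (b * x ^ 4) := by
  have hb0 : 0 < b := by linarith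
  have h1 : m ^ 2 * x ^ 2 ≤ m ^ 4 / b + b * x ^ 4 := by
    have e : m ^ 4 / b + b * x ^ 4 - m ^ 2 * x ^ 2
        = ((m ^ 2 - b * x ^ 2) ^ 2 + b * (m ^ 2 * x ^ 2)) / b := by
      field_simp; ring
    have : 0 ≤ ((m ^ 2 - b * x ^ 2) ^ 2 + b * (m ^ 2 * x ^ 2)) / b := by positivity
    linarith
  have h2 : x ^ 4 ≤ b * x ^ 4 := le_mul_of_one_le_left (by positivity) hb
  nlinarith [sq_nonneg (2 * (m * x) - x ^ 2)]

theorem sub_pow_four_le (x y : ℝ) : (x - y) ^ 4 ≤ 8 * (x ^ 4 + y ^ 4) := by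
  have h := Even.add_pow_le (n := 4) (a := x) (b := -y) (by decide)
  rw [← sub_eq_add_neg, Even.neg_pow (by decide)] at h
  norm_num at h
  exact h

namespace MixingDifferences

variable {Ω : Type*} {mΩ : MeasurableSpace Ω} {P : Measure Ω}
  {ℱ 𝒢 : ℕ → MeasurableSpace Ω} {κ D s : ℝ} {d r : ℕ → Ω → ℝ}

theorem stronglyMeasurable_batchError (h : MixingDifferences P ℱ 𝒢 κ D s d)
    (hrp : ∀ i, StronglyMeasurable[ℱ i] (r i)) (a b : ℕ) :
    StronglyMeasurable[ℱ (a + b)] (batchError d r a b) := by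
  have hR : StronglyMeasurable[ℱ (a + b)] fun ω => r a ω - r (a + b) ω :=
    ((hrp a).mono (h.mono (Nat.le_add_right a b))).sub (hrp (a + b))
  refine StronglyMeasurable.div (StronglyMeasurable.add ?_ (StronglyMeasurable.add
    (((h.stronglyMeasurable_partialSum a b).mul hR).const_mul 2) (hR.pow 2)))
    stronglyMeasurable_const
  refine Finset.stronglyMeasurable_fun_sum _ fun i hi => ?_
  have := Finset.mem_range.1 hi
  exact ((h.past (a + i)).mono (h.mono (by omega))).pow 2

theorem stronglyMeasurable_batchError_future (h : MixingDifferences P ℱ 𝒢 κ D s d)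
    (hrf : ∀ i, StronglyMeasurable[𝒢 i] (r i)) (a b : ℕ) :
    StronglyMeasurable[𝒢 a] (batchError d r a b) := by
  have hR : StronglyMeasurable[𝒢 a] fun ω => r a ω - r (a + b) ω :=
    (hrf a).sub ((hrf (a + b)).mono (h.anti (Nat.le_add_right a b)))
  refine StronglyMeasurable.div (StronglyMeasurable.add ?_ (StronglyMeasurable.add
    (((h.stronglyMeasurable_partialSum_future a b).mul hR).const_mul 2) (hR.pow 2)))
    stronglyMeasurable_const
  exact Finset.stronglyMeasurable_fun_sum _ fun i _ =>
    ((h.future (a + i)).mono (h.anti (by omega))).pow 2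

variable [IsProbabilityMeasure P]

theorem integral_sub_pow_four_le (hr6 : ∀ i, MemLp (r i) 6 P) {B : ℝ}
    (hr4 : ∀ i, ∫ ω, r i ω ^ 4 ∂P ≤ B) (i j : ℕ) :
    ∫ ω, (r i ω - r j ω) ^ 4 ∂P ≤ 16 * B := by
  have h := fun i => integrable_pow_four (hr6 i)
  calc _ ≤ ∫ ω, 8 * (r i ω ^ 4 + r j ω ^ 4) ∂P :=
        integral_mono (integrable_pow_four ((hr6 i).sub (hr6 j))) (((h i).add (h j)).const_mul _)
          fun ω => sub_pow_four_le _ _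
    _ = 8 * (∫ ω, r i ω ^ 4 ∂P + ∫ ω, r j ω ^ 4 ∂P) := by
        rw [integral_const_mul, integral_add (h i) (h j)]
    _ ≤ _ := by linarith [hr4 i, hr4 j]

theorem memLp_batchError (h : MixingDifferences P ℱ 𝒢 κ D s d) (hr6 : ∀ i, MemLp (r i) 6 P)
    (a b : ℕ) : MemLp (batchError d r a b) 2 P := by
  have h1 : MemLp (fun ω => ∑ i ∈ Finset.range b, d (a + i) ω ^ 2) 2 P :=
    memLp_finsetSum _ fun i _ => memLp_sq_two (h.memLp (a + i))
  have hR : MemLp (fun ω => r a ω - r (a + b) ω) 6 P := (hr6 a).sub (hr6 (a + b))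
  have h2 := (integrable_sq_mul_sq (h.memLp_partialSum a b) hR).const_mul 2
  have h3 := ((h1.add (h2.add (memLp_sq_two hR))).const_mul (b : ℝ)⁻¹)
  refine h3.ae_eq (Eventually.of_forall fun ω => ?_)
  simp only [batchError, _root_.Pi.add_apply]
  rw [div_eq_inv_mul]

/-- Before division by b the diagonal sum has variance O(b) by mixing. The boundary terms have
second moment O(b), because E M⁴ = O(b²) while the boundary difference has bounded fourth moment.
Division by b² leaves O(1/b). -/
theorem exists_variance_batchError_le (h : MixingDifferences P ℱ 𝒢 κ D s d)
    (hr6 : ∀ i, MemLp (r i) 6 P) {B : ℝ} (hr4 : ∀ i, ∫ ω, r i ω ^ 4 ∂P ≤ B) :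
    ∃ C, 0 ≤ C ∧ ∀ a b : ℕ, 1 ≤ b → Var[batchError d r a b; P] ≤ C / b := by
  have hB : 0 ≤ B := (integral_nonneg fun ω => by positivity).trans (hr4 0)
  have hD := h.D_nonneg
  have h6 := h.sixthConst_nonneg
  have hκ : 0 < 1 - κ := sub_pos.2 h.lt_one
  refine ⟨2 * ((1 + D) * (1 + 2 * (1 - κ)⁻¹)) + 2 * (8 * (1 + sixthConst D) + 10 * (16 * B)),
    by positivity, fun a b hb => ?_⟩
  have hb' : (1 : ℝ) ≤ b := by exact_mod_cast hb
  have hb0 : (0 : ℝ) < b := one_pos.trans_le hb'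
  have h1 : MemLp (fun ω => ∑ i ∈ Finset.range b, d (a + i) ω ^ 2) 2 P :=
    memLp_finsetSum _ fun i _ => memLp_sq_two (h.memLp (a + i))
  have hR : MemLp (fun ω => r a ω - r (a + b) ω) 6 P := (hr6 a).sub (hr6 (a + b))
  have h2 : MemLp (fun ω => 2 * (partialSum d a b ω * (r a ω - r (a + b) ω))
      + (r a ω - r (a + b) ω) ^ 2) 2 P :=
    ((integrable_sq_mul_sq (h.memLp_partialSum a b) hR).const_mul 2).add (memLp_sq_two hR)
  have e : batchError d r a b = fun ω => (b : ℝ)⁻¹ * (∑ i ∈ Finset.range b, d (a + i) ω ^ 2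
      + (2 * (partialSum d a b ω * (r a ω - r (a + b) ω)) + (r a ω - r (a + b) ω) ^ 2)) := by
    funext ω; rw [batchError, div_eq_inv_mul]
  have i1 := (integrable_pow_four (h.memLp_partialSum a b)).div_const (b : ℝ)
  have i2 := (integrable_pow_four hR).const_mul (b : ℝ)
  have h3 : ∫ ω, (2 * (partialSum d a b ω * (r a ω - r (a + b) ω))
      + (r a ω - r (a + b) ω) ^ 2) ^ 2 ∂P ≤ b * (8 * (1 + sixthConst D) + 10 * (16 * B)) := by
    calc _ ≤ ∫ ω, (8 * (partialSum d a b ω ^ 4 / b) + 10 * (b * (r a ω - r (a + b) ω) ^ 4)) ∂P :=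
          integral_mono h2.integrable_sq ((i1.const_mul 8).add (i2.const_mul 10))
            fun ω => sq_two_mul_add_sq_le hb' _ _
      _ = 8 * ((∫ ω, partialSum d a b ω ^ 4 ∂P) / b)
          + 10 * (b * ∫ ω, (r a ω - r (a + b) ω) ^ 4 ∂P) := by
          rw [integral_add (i1.const_mul 8) (i2.const_mul 10), integral_const_mul,
            integral_const_mul, integral_const_mul, integral_div]
      _ ≤ 8 * ((1 + sixthConst D) * b ^ 2 / b) + 10 * (b * (16 * B)) := by
          gcongr
          · exact h.integral_partialSum_pow_four_le a le_rfl hb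
          · exact integral_sub_pow_four_le hr6 hr4 a (a + b)
      _ = _ := by field_simp
  rw [e, variance_const_mul]
  have h4 := variance_add_le h1 h2
  have h5 := h.variance_sum_sq_le a b
  have h6' := (variance_le_integral_sq h2).trans h3
  calc _ ≤ (b : ℝ)⁻¹ ^ 2 * (2 * (b * ((1 + D) * (1 + 2 * (1 - κ)⁻¹)))
        + 2 * (b * (8 * (1 + sixthConst D) + 10 * (16 * B)))) := by
        refine mul_le_mul_of_nonneg_left (h4.trans ?_) (by positivity)
        linarith
    _ = _ := by field_simp

/-- Mixing also acts between batches, so the variance is of order a/b instead of the a²/b of the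
trivial bound. After division by √a the L² size is O(b^{-1/2}). -/
theorem exists_variance_sum_batchError_le (h : MixingDifferences P ℱ 𝒢 κ D s d)
    (hrp : ∀ i, StronglyMeasurable[ℱ i] (r i)) (hrf : ∀ i, StronglyMeasurable[𝒢 i] (r i))
    (hr6 : ∀ i, MemLp (r i) 6 P) {B : ℝ} (hr4 : ∀ i, ∫ ω, r i ω ^ 4 ∂P ≤ B) :
    ∃ C, 0 ≤ C ∧ ∀ a b : ℕ, 1 ≤ b →
      Var[fun ω => ∑ k ∈ Finset.range a, batchError d r (k * b) b ω; P] ≤ a * (C / b) := by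
  obtain ⟨C, hC0, hC⟩ := h.exists_variance_batchError_le hr6 hr4
  have hκ : 0 < 1 - κ := sub_pos.2 h.lt_one
  refine ⟨C * (1 + 2 * (1 - κ)⁻¹), by positivity, fun a b hb => ?_⟩
  have h1 := variance_sum_le (P := P) (W := fun k => batchError d r (k * b) b) (B := C / b)
    (fun k => h.memLp_batchError hr6 _ _) h.nonneg h.lt_one (by positivity)
    (fun k => hC _ _ hb) (fun i j hij => ?_) a
  · rwa [mul_div_right_comm]
  · obtain ⟨m, rfl⟩ : ∃ m, j = i + 1 + m := ⟨j - (i + 1), by omega⟩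
    have hm : i + 1 + m - i - 1 = m := by omega
    have hf := h.stronglyMeasurable_batchError_future hrf ((i + 1 + m) * b) b
    have hp := h.stronglyMeasurable_batchError hrp (i * b) b
    rw [show (i + 1 + m) * b = (i * b + b) + m * b by ring] at hf
    rw [hm]
    have h2 := h.mixing _ _ hp (h.memLp_batchError hr6 _ _) hf (h.memLp_batchError hr6 _ _)
    rw [show (i + 1 + m) * b = (i * b + b) + m * b by ring]
    -- Batches i and i + 1 + m are separated by m whole batches, hence by mb ≥ m steps.
    refine h2.trans (mul_le_mul (pow_le_pow_of_le_one h.nonneg h.lt_one.le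
      (Nat.le_mul_of_pos_right m hb)) ?_ (by positivity) (pow_nonneg h.nonneg _))
    calc _ ≤ √(C / b) * √(C / b) := mul_le_mul (Real.sqrt_le_sqrt (hC _ _ hb))
          (Real.sqrt_le_sqrt (hC _ _ hb)) (Real.sqrt_nonneg _) (Real.sqrt_nonneg _)
      _ = C / b := Real.mul_self_sqrt (by positivity)

/-- Orthogonality gives E M_N² = sN, and the boundary term is bounded in L². With N = ab this
controls b Ȳ². -/
theorem exists_integral_sq_partialSum_add_le (h : MixingDifferences P ℱ 𝒢 κ D s d)
    (hr6 : ∀ i, MemLp (r i) 6 P) {B : ℝ} (hr4 : ∀ i, ∫ ω, r i ω ^ 4 ∂P ≤ B) :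
    ∃ C, 0 ≤ C ∧ ∀ N : ℕ, 1 ≤ N →
      ∫ ω, (partialSum d 0 N ω + (r 0 ω - r (0 + N) ω)) ^ 2 ∂P ≤ C * N := by
  have hB : 0 ≤ B := (integral_nonneg fun ω => by positivity).trans (hr4 0)
  have hs : 0 ≤ s := (integral_nonneg fun ω => by positivity).trans (h.sq 0).le
  refine ⟨2 * s + 2 * (1 + 16 * B), by positivity, fun N hN => ?_⟩
  have hN' : (1 : ℝ) ≤ N := by exact_mod_cast hN
  have hM : MemLp (partialSum d 0 N) 2 P := (h.memLp_partialSum 0 N).mono_exponent (by norm_num)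
  have hR6 : MemLp (fun ω => r 0 ω - r (0 + N) ω) 6 P := (hr6 0).sub (hr6 (0 + N))
  have hR : MemLp (fun ω => r 0 ω - r (0 + N) ω) 2 P := hR6.mono_exponent (by norm_num)
  have i1 := hM.integrable_sq.const_mul 2
  have i2 : Integrable (fun ω => 2 * (1 + (r 0 ω - r (0 + N) ω) ^ 4)) P :=
    ((integrable_const (1 : ℝ)).add (integrable_pow_four hR6)).const_mul 2
  have h4 := integral_sub_pow_four_le hr6 hr4 0 (0 + N)
  calc _ ≤ ∫ ω, (2 * partialSum d 0 N ω ^ 2 + 2 * (1 + (r 0 ω - r (0 + N) ω) ^ 4)) ∂P :=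
        integral_mono (hM.add hR).integrable_sq (i1.add i2) fun ω => by
          dsimp only [_root_.Pi.add_apply]
          nlinarith [sq_nonneg (partialSum d 0 N ω - (r 0 ω - r (0 + N) ω)),
            sq_nonneg ((r 0 ω - r (0 + N) ω) ^ 2 - 1)]
    _ = 2 * (s * N) + 2 * (1 + ∫ ω, (r 0 ω - r (0 + N) ω) ^ 4 ∂P) := by
        rw [integral_add i1 i2, integral_const_mul, integral_const_mul,
          h.integral_partialSum_sq]
        congr 2
        have := integral_add (integrable_const (μ := P) (1 : ℝ)) (integrable_pow_four hR6)
        simpa using this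
    _ ≤ 2 * (s * N) + 2 * (1 + 16 * B) * N := by
        nlinarith
    _ = _ := by ring

end MixingDifferences
/-! ### Asymptotic normality of the batch means estimator -/

section Slutsky

variable {Ω : Type*} {mΩ : MeasurableSpace Ω} {P : Measure Ω} [IsProbabilityMeasure P]

/-- Convergence in distribution is not affected by an error that vanishes in `L¹`. -/
theorem tendstoInDistribution_of_integral_abs_sub_le {ν : Measure ℝ} [IsProbabilityMeasure ν]
    {W Y : ℕ → Ω → ℝ} {ε : ℕ → ℝ}
    (hW : TendstoInDistribution W atTop (id : ℝ → ℝ) (fun _ => P) ν)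
    (hY : ∀ n, AEMeasurable (Y n) P) (hε : Tendsto ε atTop (nhds 0))
    (hi : ∀ᶠ n in atTop, Integrable (fun ω => Y n ω - W n ω) P)
    (hle : ∀ᶠ n in atTop, ∫ ω, |Y n ω - W n ω| ∂P ≤ ε n) :
    TendstoInDistribution Y atTop (id : ℝ → ℝ) (fun _ => P) ν := by
  refine tendstoInDistribution_of_tendstoInMeasure_sub Y id hW ?_ hY
  refine tendstoInMeasure_of_tendsto_eLpNorm one_ne_zero
    (fun n => ((hY n).sub (hW.forall_aemeasurable n)).aestronglyMeasurable)
    aestronglyMeasurable_zero ?_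
  have h0 : Tendsto (fun n => ENNReal.ofReal (ε n)) atTop (nhds 0) := by
    simpa using ENNReal.tendsto_ofReal hε
  refine tendsto_of_tendsto_of_tendsto_of_le_of_le' tendsto_const_nhds h0
    (Eventually.of_forall fun _ => zero_le) ?_
  filter_upwards [hi, hle] with n h1 h2
  rw [sub_zero, eLpNorm_one_eq_lintegral_enorm]
  have h3 := ofReal_integral_norm_eq_lintegral_enorm h1
  simp only [_root_.Pi.sub_apply]
  rw [← h3]
  exact ENNReal.ofReal_le_ofReal h2

theorem integral_abs_sub_integral_le {U : Ω → ℝ} (hU : MemLp U 2 P) :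
    ∫ ω, |U ω - ∫ ω', U ω' ∂P| ∂P ≤ √Var[U; P] := by
  have h1 : MemLp (fun ω => |U ω - ∫ ω', U ω' ∂P|) 2 P := (hU.sub (memLp_const _)).abs
  refine Real.le_sqrt_of_sq_le ?_
  have h2 := variance_nonneg (fun ω => |U ω - ∫ ω', U ω' ∂P|) P
  rw [variance_eq_sub h1] at h2
  rw [variance_eq_integral hU.1.aemeasurable]
  simp only [_root_.Pi.pow_apply, sq_abs] at h2
  linarith

/-- Lévy's continuity theorem. For s = 0 the limit is the point mass, whose characteristic function
is 1, so no separate case arises. -/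
theorem MixingDifferences.tendstoInDistribution {ℱ 𝒢 : ℕ → MeasurableSpace Ω} {κ D s : ℝ}
    {d : ℕ → Ω → ℝ} (h : MixingDifferences P ℱ 𝒢 κ D s d) {a b : ℕ → ℕ}
    (ha : Tendsto a atTop atTop) (hb : Tendsto b atTop atTop) :
    TendstoInDistribution (fun n ω => (√(a n : ℝ))⁻¹ * ∑ k ∈ Finset.range (a n),
        2 / (b n : ℝ) * pairSum d (k * b n) (b n) ω) atTop (id : ℝ → ℝ) (fun _ => P)
      (gaussianReal 0 (2 * s ^ 2).toNNReal) := by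
  have hm : ∀ n, Measurable fun ω => (√(a n : ℝ))⁻¹ * ∑ k ∈ Finset.range (a n),
      2 / (b n : ℝ) * pairSum d (k * b n) (b n) ω := fun n =>
    (Finset.measurable_fun_sum _ fun k _ =>
      (((h.stronglyMeasurable_pairSum _ _).mono (h.le _)).measurable.const_mul _)).const_mul _
  refine ⟨fun n => (hm n).aemeasurable, aemeasurable_id, ?_⟩
  refine ProbabilityMeasure.tendsto_iff_tendsto_charFun.2 fun t => ?_
  simp only [ProbabilityMeasure.coe_mk, Measure.map_id]
  rw [charFun_gaussianReal]
  have h1 := h.tendsto_integral_cexp ha hb t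
  convert h1 using 2 with n
  · rw [charFun_apply_real, integral_map (hm n).aemeasurable (by fun_prop)]
    simp
  · push_cast
    congr 1
    rw [Real.coe_toNNReal _ (by positivity)]
    push_cast
    ring

end Slutsky

/-! ### Estimator in terms of martingale sums and telescoping terms -/

section Decomposition

variable {S Ω : Type*} [MeasurableSpace S] {Pi : Measure S} {f : S → ℝ}
  {X : ℕ → Ω → S} {d r : ℕ → Ω → ℝ} {ω : Ω}

theorem sum_centred_eq (hω : ∀ j, centred Pi f X j ω = d j ω + (r j ω - r (j + 1) ω)) (a b : ℕ) :
    ∑ i ∈ Finset.range b, centred Pi f X (a + i) ω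
      = partialSum d a b ω + (r a ω - r (a + b) ω) := by
  simp only [hω, Finset.sum_add_distrib, partialSum]
  congr 1
  exact Finset.sum_range_sub' (fun i => r (a + i) ω) b

theorem mul_batchMean_sq_eq (hω : ∀ j, centred Pi f X j ω = d j ω + (r j ω - r (j + 1) ω))
    {b : ℕ} (hb : 1 ≤ b) (k : ℕ) :
    b * batchMean Pi f X b k ω ^ 2
      = 2 / (b : ℝ) * pairSum d (k * b) b ω + batchError d r (k * b) b ω := by
  have hb0 : (b : ℝ) ≠ 0 := by positivity
  rw [← sq_partialSum_add_div_eq, batchMean, sum_centred_eq hω]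
  field_simp

theorem overallMean_eq (Pi : Measure S) (f : S → ℝ) (X : ℕ → Ω → S) (a b : ℕ) (ω : Ω) :
    overallMean Pi f X a b ω = (∑ i ∈ Finset.range (a * b), centred Pi f X i ω) / b / a := by
  simp only [overallMean, batchMean]
  rw [← Finset.sum_div]
  congr 2
  induction a with
  | zero => simp
  | succ a ih => rw [Finset.sum_range_succ, ih, Nat.succ_mul, Finset.sum_range_add]

theorem mul_overallMean_sq_eq (hω : ∀ j, centred Pi f X j ω = d j ω + (r j ω - r (j + 1) ω))
    {a b : ℕ} (ha : 1 ≤ a) (hb : 1 ≤ b) :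
    b * overallMean Pi f X a b ω ^ 2 = ((a : ℝ) ^ 2 * b)⁻¹
      * (partialSum d 0 (a * b) ω + (r 0 ω - r (0 + a * b) ω)) ^ 2 := by
  have hb0 : (b : ℝ) ≠ 0 := by positivity
  have ha0 : (a : ℝ) ≠ 0 := by positivity
  have := sum_centred_eq hω 0 (a * b)
  simp only [zero_add] at this
  rw [overallMean_eq, this]
  simp only [zero_add]
  field_simp

end Decomposition

section Measurability

variable {S Ω : Type*} [MeasurableSpace S] [MeasurableSpace Ω] {Pi : Measure S} {f : S → ℝ}
  {X : ℕ → Ω → S}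

theorem measurable_batchMean (hf : Measurable f) (hX : ∀ n, Measurable (X n)) (b k : ℕ) :
    Measurable (batchMean Pi f X b k) :=
  (Finset.measurable_fun_sum _ fun i _ => (hf.comp (hX (k * b + i))).sub_const _).div_const _

theorem measurable_overallMean (hf : Measurable f) (hX : ∀ n, Measurable (X n)) (a b : ℕ) :
    Measurable (overallMean Pi f X a b) :=
  (Finset.measurable_fun_sum _ fun k _ => measurable_batchMean hf hX b k).div_const _

theorem measurable_modifiedBM (hf : Measurable f) (hX : ∀ n, Measurable (X n)) (a b : ℕ) :
    Measurable (modifiedBM Pi f X a b) :=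
  ((Finset.measurable_fun_sum _ fun k _ =>
    (measurable_batchMean hf hX b k).pow_const 2).const_mul _).sub
    (((measurable_overallMean hf hX a b).pow_const 2).const_mul _)

end Measurability
-- Error bounds and the limit law of the estimator
namespace MixingDifferences

variable {S Ω : Type*} [MeasurableSpace S] {mΩ : MeasurableSpace Ω} {P : Measure Ω}
  [IsProbabilityMeasure P] {ℱ 𝒢 : ℕ → MeasurableSpace Ω} {κ D s : ℝ} {d r : ℕ → Ω → ℝ}
  {Pi : Measure S} {f : S → ℝ} {X : ℕ → Ω → S}

theorem exists_integral_overallMean_sq_le (h : MixingDifferences P ℱ 𝒢 κ D s d)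
    (hr6 : ∀ i, MemLp (r i) 6 P) {B : ℝ} (hr4 : ∀ i, ∫ ω, r i ω ^ 4 ∂P ≤ B)
    (hY : ∀ᵐ ω ∂P, ∀ j, centred Pi f X j ω = d j ω + (r j ω - r (j + 1) ω)) :
    ∃ C, 0 ≤ C ∧ ∀ a b : ℕ, 1 ≤ a → 1 ≤ b →
      Integrable (fun ω => b * overallMean Pi f X a b ω ^ 2) P ∧
      ∫ ω, b * overallMean Pi f X a b ω ^ 2 ∂P ≤ C / a := by
  obtain ⟨C, hC0, hC⟩ := h.exists_integral_sq_partialSum_add_le hr6 hr4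
  refine ⟨C, hC0, fun a b ha hb => ?_⟩
  have hb0 : (0 : ℝ) < b := by positivity
  have ha0 : (0 : ℝ) < a := by positivity
  have e : (fun ω => b * overallMean Pi f X a b ω ^ 2) =ᵐ[P] fun ω => ((a : ℝ) ^ 2 * b)⁻¹
      * (partialSum d 0 (a * b) ω + (r 0 ω - r (0 + a * b) ω)) ^ 2 := by
    filter_upwards [hY] with ω hω using mul_overallMean_sq_eq hω ha hb
  have hL : MemLp (fun ω => partialSum d 0 (a * b) ω + (r 0 ω - r (0 + a * b) ω)) 2 P :=
    ((h.memLp_partialSum 0 (a * b)).add ((hr6 0).sub (hr6 _))).mono_exponent (by norm_num)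
  refine ⟨(hL.integrable_sq.const_mul _).congr e.symm, ?_⟩
  rw [integral_congr_ae e, integral_const_mul]
  calc _ ≤ ((a : ℝ) ^ 2 * b)⁻¹ * (C * (a * b : ℕ)) := by
        gcongr
        exact hC _ (Nat.mul_pos ha hb)
    _ = C / a := by
        push_cast
        field_simp

/-- The pair sums have mean zero, so the estimator has mean a⁻¹ E(∑ errors) - E(b Ȳ²). Subtracting
E(b Ȳ²) once more cancels it exactly, which leaves b Ȳ² uncentred. -/
theorem modifiedBM_sub_ae_eq (h : MixingDifferences P ℱ 𝒢 κ D s d) (hr6 : ∀ i, MemLp (r i) 6 P)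
    (hY : ∀ᵐ ω ∂P, ∀ j, centred Pi f X j ω = d j ω + (r j ω - r (j + 1) ω)) {a b : ℕ}
    (ha : 1 ≤ a) (hb : 1 ≤ b)
    (hV : Integrable (fun ω => b * overallMean Pi f X a b ω ^ 2) P) :
    ∀ᵐ ω ∂P, √(a : ℝ) * (modifiedBM Pi f X a b ω - ∫ ω', modifiedBM Pi f X a b ω' ∂P
        - ∫ ω', b * overallMean Pi f X a b ω' ^ 2 ∂P)
      = (√(a : ℝ))⁻¹ * ∑ k ∈ Finset.range a, 2 / (b : ℝ) * pairSum d (k * b) b ω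
        + ((√(a : ℝ))⁻¹ * (∑ k ∈ Finset.range a, batchError d r (k * b) b ω
          - ∫ ω', ∑ k ∈ Finset.range a, batchError d r (k * b) b ω' ∂P)
          - √(a : ℝ) * (b * overallMean Pi f X a b ω ^ 2)) := by
  have ha0 : (0 : ℝ) < a := by positivity
  have hE : Integrable (fun ω => ∑ k ∈ Finset.range a, batchError d r (k * b) b ω) P :=
    integrable_finsetSum _ fun k _ => (h.memLp_batchError hr6 _ _).integrable (by norm_num)
  have hZi : ∀ k, Integrable (fun ω => 2 / (b : ℝ) * pairSum d (k * b) b ω) P := fun k =>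
    ((h.memLp_pairSum _ _).const_mul _).integrable (by norm_num)
  have hZ : Integrable (fun ω => ∑ k ∈ Finset.range a, 2 / (b : ℝ) * pairSum d (k * b) b ω) P :=
    integrable_finsetSum _ fun k _ => hZi k
  have hZ0 : ∫ ω, ∑ k ∈ Finset.range a, 2 / (b : ℝ) * pairSum d (k * b) b ω ∂P = 0 := by
    rw [integral_finsetSum _ fun k _ => hZi k]
    refine Finset.sum_eq_zero fun k _ => ?_
    simpa using h.integral_mul_pairSum_eq_zero (2 / (b : ℝ)) (k * b) b (U := fun _ => 1) (B := 1)
      stronglyMeasurable_const (by simp)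
  have e : ∀ᵐ ω ∂P, modifiedBM Pi f X a b ω
      = (a : ℝ)⁻¹ * (∑ k ∈ Finset.range a, 2 / (b : ℝ) * pairSum d (k * b) b ω
        + ∑ k ∈ Finset.range a, batchError d r (k * b) b ω)
        - b * overallMean Pi f X a b ω ^ 2 := by
    filter_upwards [hY] with ω hω
    rw [modifiedBM, ← Finset.sum_add_distrib, div_mul_eq_mul_div, mul_comm (b : ℝ), Finset.sum_mul,
      div_eq_inv_mul]
    congr 2
    refine Finset.sum_congr rfl fun k _ => ?_
    rw [mul_comm, mul_batchMean_sq_eq hω hb]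
  have hI : ∫ ω, modifiedBM Pi f X a b ω ∂P
      = (a : ℝ)⁻¹ * ∫ ω, ∑ k ∈ Finset.range a, batchError d r (k * b) b ω ∂P
        - ∫ ω, b * overallMean Pi f X a b ω ^ 2 ∂P := by
    rw [integral_congr_ae e, integral_sub ((hZ.fun_add hE).const_mul _) hV, integral_const_mul,
      integral_add hZ hE, hZ0, zero_add]
  filter_upwards [e] with ω hω
  rw [hI, hω]
  have hs : √(a : ℝ) * (a : ℝ)⁻¹ = (√(a : ℝ))⁻¹ := by
    rw [← div_eq_mul_inv, Real.sqrt_div_self', one_div]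
  rw [← hs]
  ring

/-- The centred batch errors contribute at most a^{-1/2} √(a C₁/b), and √a b Ȳ² contributes at most
√a C₂/a in mean. -/
theorem exists_integral_abs_sub_le (h : MixingDifferences P ℱ 𝒢 κ D s d)
    (hrp : ∀ i, StronglyMeasurable[ℱ i] (r i)) (hrf : ∀ i, StronglyMeasurable[𝒢 i] (r i))
    (hr6 : ∀ i, MemLp (r i) 6 P) {B : ℝ} (hr4 : ∀ i, ∫ ω, r i ω ^ 4 ∂P ≤ B)
    (hY : ∀ᵐ ω ∂P, ∀ j, centred Pi f X j ω = d j ω + (r j ω - r (j + 1) ω)) :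
    ∃ C₁ C₂ : ℝ, ∀ a b : ℕ, 1 ≤ a → 1 ≤ b →
      Integrable (fun ω => √(a : ℝ) * (modifiedBM Pi f X a b ω
        - ∫ ω', modifiedBM Pi f X a b ω' ∂P - ∫ ω', b * overallMean Pi f X a b ω' ^ 2 ∂P)
        - (√(a : ℝ))⁻¹ * ∑ k ∈ Finset.range a, 2 / (b : ℝ) * pairSum d (k * b) b ω) P ∧
      ∫ ω, |√(a : ℝ) * (modifiedBM Pi f X a b ω
        - ∫ ω', modifiedBM Pi f X a b ω' ∂P - ∫ ω', b * overallMean Pi f X a b ω' ^ 2 ∂P)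
        - (√(a : ℝ))⁻¹ * ∑ k ∈ Finset.range a, 2 / (b : ℝ) * pairSum d (k * b) b ω| ∂P
        ≤ √(C₁ / b) + C₂ / √(a : ℝ) := by
  obtain ⟨C₁, hC₁0, hC₁⟩ := h.exists_variance_sum_batchError_le hrp hrf hr6 hr4
  obtain ⟨C₂, hC₂0, hC₂⟩ := h.exists_integral_overallMean_sq_le hr6 hr4 hY
  refine ⟨C₁, C₂, fun a b ha hb => ?_⟩
  have ha0 : (0 : ℝ) < a := by positivity
  have hsa : 0 < √(a : ℝ) := Real.sqrt_pos.2 ha0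
  obtain ⟨hV, hVle⟩ := hC₂ a b ha hb
  have hE : MemLp (fun ω => ∑ k ∈ Finset.range a, batchError d r (k * b) b ω) 2 P :=
    memLp_finsetSum _ fun k _ => h.memLp_batchError hr6 _ _
  set E : Ω → ℝ := fun ω => ∑ k ∈ Finset.range a, batchError d r (k * b) b ω with hEdef
  set V : Ω → ℝ := fun ω => b * overallMean Pi f X a b ω ^ 2 with hVdef
  have hV0 : ∀ ω, 0 ≤ V ω := fun ω => by positivity
  have hE1 : Integrable (fun ω => E ω - ∫ ω', E ω' ∂P) P :=
    (hE.integrable (by norm_num)).sub (integrable_const _)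
  have e := h.modifiedBM_sub_ae_eq hr6 hY ha hb hV
  have e' : (fun ω => √(a : ℝ) * (modifiedBM Pi f X a b ω
        - ∫ ω', modifiedBM Pi f X a b ω' ∂P - ∫ ω', b * overallMean Pi f X a b ω' ^ 2 ∂P)
        - (√(a : ℝ))⁻¹ * ∑ k ∈ Finset.range a, 2 / (b : ℝ) * pairSum d (k * b) b ω)
      =ᵐ[P] fun ω => (√(a : ℝ))⁻¹ * (E ω - ∫ ω', E ω' ∂P) - √(a : ℝ) * V ω := by
    filter_upwards [e] with ω hω
    rw [hω]
    ring
  refine ⟨((hE1.const_mul _).sub (hV.const_mul _)).congr e'.symm, ?_⟩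
  have e'' := integral_congr_ae (e'.fun_comp abs)
  simp only [Function.comp_def] at e''
  rw [e'']
  have i1 := (hE1.abs.const_mul (√(a : ℝ))⁻¹)
  have i2 := hV.const_mul √(a : ℝ)
  calc _ ≤ ∫ ω, ((√(a : ℝ))⁻¹ * |E ω - ∫ ω', E ω' ∂P| + √(a : ℝ) * V ω) ∂P := by
        refine integral_mono ((hE1.const_mul _).sub (hV.const_mul _)).abs (i1.add i2) fun ω => ?_
        refine (abs_sub _ _).trans (le_of_eq ?_)
        rw [abs_mul, abs_mul, abs_of_pos (inv_pos.2 hsa), abs_of_pos hsa, abs_of_nonneg (hV0 ω)]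
    _ = (√(a : ℝ))⁻¹ * ∫ ω, |E ω - ∫ ω', E ω' ∂P| ∂P + √(a : ℝ) * ∫ ω, V ω ∂P := by
        rw [integral_add i1 i2, integral_const_mul, integral_const_mul]
    _ ≤ (√(a : ℝ))⁻¹ * √(a * (C₁ / b)) + √(a : ℝ) * (C₂ / a) := by
        gcongr
        exact (integral_abs_sub_integral_le hE).trans (Real.sqrt_le_sqrt (hC₁ a b hb))
    _ = _ := by
        rw [Real.sqrt_mul ha0.le, inv_mul_cancel_left₀ hsa.ne']
        congr 1
        rw [mul_div_left_comm, Real.sqrt_div_self', mul_one_div]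

/-- The centred batch means estimator of a process that differs from martingale differences by
telescoping terms is asymptotically normal. -/
theorem tendstoInDistribution_modifiedBM (h : MixingDifferences P ℱ 𝒢 κ D s d)
    (hrp : ∀ i, StronglyMeasurable[ℱ i] (r i)) (hrf : ∀ i, StronglyMeasurable[𝒢 i] (r i))
    (hr6 : ∀ i, MemLp (r i) 6 P) {B : ℝ} (hr4 : ∀ i, ∫ ω, r i ω ^ 4 ∂P ≤ B)
    (hY : ∀ᵐ ω ∂P, ∀ j, centred Pi f X j ω = d j ω + (r j ω - r (j + 1) ω))
    (hf : Measurable f) (hX : ∀ n, Measurable (X n)) {a b : ℕ → ℕ}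
    (ha : Tendsto a atTop atTop) (hb : Tendsto b atTop atTop) :
    TendstoInDistribution (fun n ω => √(a n : ℝ) * (modifiedBM Pi f X (a n) (b n) ω
        - ∫ ω', modifiedBM Pi f X (a n) (b n) ω' ∂P
        - ∫ ω', (b n : ℝ) * overallMean Pi f X (a n) (b n) ω' ^ 2 ∂P))
      atTop (id : ℝ → ℝ) (fun _ => P) (gaussianReal 0 (2 * s ^ 2).toNNReal) := by
  obtain ⟨C₁, C₂, hC⟩ := h.exists_integral_abs_sub_le hrp hrf hr6 hr4 hY
  have haR : Tendsto (fun n => (a n : ℝ)) atTop atTop := tendsto_natCast_atTop_atTop.comp ha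
  have hbR : Tendsto (fun n => (b n : ℝ)) atTop atTop := tendsto_natCast_atTop_atTop.comp hb
  have hε : Tendsto (fun n => √(C₁ / b n) + C₂ / √(a n : ℝ)) atTop (nhds 0) := by
    have h1 : Tendsto (fun n => √(C₁ / b n)) atTop (nhds 0) := by
      simpa using (hbR.const_div_atTop C₁).sqrt
    simpa using h1.add ((Real.tendsto_sqrt_atTop.comp haR).const_div_atTop C₂)
  refine tendstoInDistribution_of_integral_abs_sub_le (h.tendstoInDistribution ha hb)
    (fun n => ?_) hε ?_ ?_
  · exact ((((measurable_modifiedBM hf hX _ _).sub_const _).sub_const _).const_mul _).aemeasurable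
  -- A batch count or batch length equal to 0 gives quotients their default value 0, so the
  -- estimates are claimed only eventually.
  · filter_upwards [ha.eventually_ge_atTop 1, hb.eventually_ge_atTop 1] with n h1 h2
      using (hC _ _ h1 h2).1
  · filter_upwards [ha.eventually_ge_atTop 1, hb.eventually_ge_atTop 1] with n h1 h2
      using (hC _ _ h1 h2).2

/-- Needed to change the sign of E(b Ȳ²) in the centring, as the second displayed limit requires. -/
theorem tendsto_sqrt_mul_integral_overallMean_sq (h : MixingDifferences P ℱ 𝒢 κ D s d)
    (hr6 : ∀ i, MemLp (r i) 6 P) {B : ℝ} (hr4 : ∀ i, ∫ ω, r i ω ^ 4 ∂P ≤ B)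
    (hY : ∀ᵐ ω ∂P, ∀ j, centred Pi f X j ω = d j ω + (r j ω - r (j + 1) ω)) {a b : ℕ → ℕ}
    (ha : Tendsto a atTop atTop) (hb : Tendsto b atTop atTop) :
    Tendsto (fun n => √(a n : ℝ) * ∫ ω, (b n : ℝ) * overallMean Pi f X (a n) (b n) ω ^ 2 ∂P)
      atTop (nhds 0) := by
  obtain ⟨C, hC0, hC⟩ := h.exists_integral_overallMean_sq_le hr6 hr4 hY
  have haR : Tendsto (fun n => (a n : ℝ)) atTop atTop := tendsto_natCast_atTop_atTop.comp ha
  refine squeeze_zero' (Eventually.of_forall fun n => ?_) ?_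
    ((Real.tendsto_sqrt_atTop.comp haR).const_div_atTop C)
  · exact mul_nonneg (Real.sqrt_nonneg _) (integral_nonneg fun ω => by positivity)
  · filter_upwards [ha.eventually_ge_atTop 1, hb.eventually_ge_atTop 1] with n h1 h2
    refine (mul_le_mul_of_nonneg_left (hC _ _ h1 h2).2 (Real.sqrt_nonneg _)).trans (le_of_eq ?_)
    rw [mul_div_left_comm, Real.sqrt_div_self', mul_one_div, Function.comp_apply]

end MixingDifferences

end

end BatchMeans

/-! ### The main theorem -/

theorem lemma2 {S Ω : Type*} [MeasurableSpace S] [MeasurableSpace Ω]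
    (Pi : Measure S) [IsProbabilityMeasure Pi]
    (K : Kernel S S) [IsMarkovKernel K]
    (hrev : K.IsReversible Pi)
    (hgeo : BatchMeans.GeometricallyErgodic K Pi)
    (P : Measure Ω) [IsProbabilityMeasure P]
    (X : ℕ → Ω → S) (hX : BatchMeans.IsMarkovChain K Pi P X)
    (f : S → ℝ) (hf : Measurable f) (hf8 : Integrable (fun x => f x ^ 8) Pi)
    (a b : ℕ → ℕ) (ha : Tendsto a atTop atTop) (hb : Tendsto b atTop atTop) :
    Summable (fun i : ℕ => BatchMeans.autocov P f X (i + 1)) ∧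
    TendstoInDistribution
      (fun (n : ℕ) (ω : Ω) => √(a n : ℝ) *
        (BatchMeans.modifiedBM Pi f X (a n) (b n) ω
          - ∫ ω', BatchMeans.modifiedBM Pi f X (a n) (b n) ω' ∂P
          - ∫ ω', (b n : ℝ) * BatchMeans.overallMean Pi f X (a n) (b n) ω' ^ 2 ∂P))
      atTop (id : ℝ → ℝ) (fun _ => P)
      (gaussianReal 0 (2 * BatchMeans.mcmcVar P f X ^ 2).toNNReal) ∧
    TendstoInDistribution
      (fun (n : ℕ) (ω : Ω) => √(a n : ℝ) *
        ((BatchMeans.modifiedBM Pi f X (a n) (b n) ω - BatchMeans.mcmcVar P f X)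
          - (∫ ω', BatchMeans.modifiedBM Pi f X (a n) (b n) ω' ∂P
            - ∫ ω', (b n : ℝ) * BatchMeans.overallMean Pi f X (a n) (b n) ω' ^ 2 ∂P
            - BatchMeans.mcmcVar P f X)))
      atTop (id : ℝ → ℝ) (fun _ => P)
      (gaussianReal 0 (2 * BatchMeans.mcmcVar P f X ^ 2).toNNReal) := by
  have hinv := hrev.invariant
  obtain ⟨κ, hκ, hκ1, hgap⟩ := BatchMeans.exists_spectral_gap hrev hgeo
  have hfL : MemLp f 8 Pi := by
    simpa using BatchMeans.memLp_of_integrable_even_pow (n := 8) (by decide) (by norm_num)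
      hf.aestronglyMeasurable hf8
  have hf2 : MemLp f 2 Pi := hfL.mono_exponent (by norm_num)
  have hmean : ∫ x, (f x - ∫ y, f y ∂Pi) ∂Pi = 0 := by
    rw [integral_sub (hf2.integrable (by norm_num)) (integrable_const _)]
    simp
  obtain ⟨g, hg, hg6, hp, hlim⟩ := BatchMeans.exists_poisson_solution hinv hκ hκ1 hgap
    (hf.sub_const (∫ y, f y ∂Pi)) (hfL.sub (memLp_const _)) hmean
  have hsum := hX.summable_autocov hinv hκ.le hκ1 hgap hf hf2
  obtain ⟨D, hD⟩ := hX.exists_mixingDifferences hinv hκ.le hκ1 hgap hg hg6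
  -- Identifies the variance of the martingale differences with σ_f².
  rw [← hX.mcmcVar_eq hinv hf hf2 hg (hg6.mono_exponent (by norm_num)) hsum hp hlim] at hD
  have hr6 : ∀ i, MemLp (fun ω => g (X i ω)) 6 P := fun i =>
    hg6.comp_measurePreserving (hX.measurePreserving hinv i)
  have hr4 : ∀ i, ∫ ω, g (X i ω) ^ 4 ∂P ≤ ∫ x, g x ^ 4 ∂Pi := fun i =>
    (hX.integral_comp hinv (hg.pow_const 4) i).le
  have hY : ∀ᵐ ω ∂P, ∀ j, BatchMeans.centred Pi f X j ω
      -- The Poisson equation evaluated along the chain, with r_j = g(X_j). It holds Π-almost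
      -- everywhere and every X_j has law Π, so it holds almost surely for all j at once.
      = BatchMeans.martingaleDiff K g X j ω + (g (X j ω) - g (X (j + 1) ω)) := by
    refine ae_all_iff.2 fun j => ?_
    filter_upwards [(hX.measurePreserving hinv j).quasiMeasurePreserving.ae hp] with ω hω
    rw [BatchMeans.centred, ← hω, BatchMeans.martingaleDiff]
    ring
  have hclt := hD.tendstoInDistribution_modifiedBM
    (fun i => (hg.comp (BatchMeans.measurable_past le_rfl)).stronglyMeasurable)
    (fun i => (hg.comp (BatchMeans.measurable_future le_rfl)).stronglyMeasurable)
    hr6 hr4 hY hf hX.measurable ha hb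
  have hV := (hD.tendsto_sqrt_mul_integral_overallMean_sq hr6 hr4 hY ha hb).const_mul 2
  rw [mul_zero] at hV
  refine ⟨(summable_nat_add_iff 1).2 hsum, hclt, ?_⟩
  -- σ_f² cancels, and E(b Ȳ²) enters with opposite signs in the two centrings. The difference is a
  -- constant tending to 0, and Slutsky applies.
  have e : ∀ (n : ℕ) (ω : Ω), √(a n : ℝ) *
      ((BatchMeans.modifiedBM Pi f X (a n) (b n) ω - BatchMeans.mcmcVar P f X)
        - (∫ ω', BatchMeans.modifiedBM Pi f X (a n) (b n) ω' ∂P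
          - ∫ ω', (b n : ℝ) * BatchMeans.overallMean Pi f X (a n) (b n) ω' ^ 2 ∂P
          - BatchMeans.mcmcVar P f X))
      - √(a n : ℝ) * (BatchMeans.modifiedBM Pi f X (a n) (b n) ω
        - ∫ ω', BatchMeans.modifiedBM Pi f X (a n) (b n) ω' ∂P
        - ∫ ω', (b n : ℝ) * BatchMeans.overallMean Pi f X (a n) (b n) ω' ^ 2 ∂P)
      = 2 * (√(a n : ℝ)
        * ∫ ω', (b n : ℝ) * BatchMeans.overallMean Pi f X (a n) (b n) ω' ^ 2 ∂P) := by
    intro n ω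
    ring
  refine BatchMeans.tendstoInDistribution_of_integral_abs_sub_le hclt (fun n => ?_) hV ?_ ?_
  · exact (((BatchMeans.measurable_modifiedBM hf hX.measurable _ _).sub_const _).sub_const
      _).const_mul _ |>.aemeasurable
  · refine Eventually.of_forall fun n => ?_
    simp_rw [e]
    exact integrable_const _
  · refine Eventually.of_forall fun n => ?_
    simp_rw [e]
    rw [integral_const, probReal_univ, one_smul, abs_of_nonneg]
    exact mul_nonneg zero_le_two
      (mul_nonneg (Real.sqrt_nonneg _) (integral_nonneg fun ω => by positivity))
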